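/- **Setting.** Let $N\ge 1$ and let $M_{j,j+1}\ge 1$ ($0\le j\le N$) be integers. Consider the chain of spins $S_0,\dots,S_{N+1}$ with $2S_0=M_{01}$, $2S_j=M_{j-1,j}+M_{j,j+1}$ for $1\le j\le N$, and $2S_{N+1}=M_{N,N+1}$. In the Schwinger representation, bosons $a_j,b_j$ at site $j$ satisfy $a_j^\dagger a_j+b_j^\dagger b_j=2S_j$, and $S_j^+=a_j^\dagger b_j$, $S^-_j=b_j^\dagger a_j$, $S^z_j=\frac12(a_j^\dagger a_j-b_j^\dagger b_j)$. The VBS state is $$|\mathrm{VBS}\rangle=\prod_{j=0}^{N}\left(a_j^\dagger b_{j+1}^\dagger-b_j^\dagger a_{j+1}^\dagger\right)^{M_{j,j+1}}|\mathrm{vac}\rangle .$$ Let $L\ge 2$, $k\ge 1$, $k+L-1\le N$, and let $\rho_L$ be the partial trace of $|\mathrm{VBS}\rangle\langle\mathrm{VBS}|/\langle\mathrm{VBS}|\mathrm{VBS}\rangle$ over all sites outside the block $k,\dots,k+L-1$. Relabel the sites of the block as $1,\dots,L$, so that $M_{01}$ and $M_{L,L+1}$ are the numbers of the bonds joining the block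 to the rest of the chain. Put $J_\pm=\frac12(M_{01}\pm M_{L,L+1})$ and $$|\mathrm{VBS}_L\rangle=\prod_{j=1}^{L-1}\left(a_j^\dagger b_{j+1}^\dagger-b_j^\dagger a_{j+1}^\dagger\right)^{M_{j,j+1}}|\mathrm{vac}\rangle .$$ For $J=|J_-|,|J_-|+1,\dots,J_+$ and $M=-J,\dots,J$ let $|\mathrm{VBS}_L(J,M)\rangle=\Psi^\dagger_{JM}|\mathrm{VBS}_L\rangle$, where $$\Psi^\dagger_{JM}=\sum_{m_1+m_L=M}\left(\tfrac12M_{01},m_1;\tfrac12M_{L,L+1},m_L\,\middle|\,J,M\right)\frac{(a_1^\dagger)^{\frac12M_{01}+m_1}(b_1^\dagger)^{\frac12M_{01}-m_1}}{\sqrt{(\frac12M_{01}+m_1)!\,(\frac12M_{01}-m_1)!}}\cdot\frac{(a_L^\dagger)^{\frac12M_{L,L+1}+m_L}(b_L^\dagger)^{\frac12M_{L,L+1}-m_L}}{\sqrt{(\frac12M_{L,L+1}+m_L)!\,(\frac12M_{L,L+1}-m_L)!}}$$ with Clebsch–Gordan coefficients $(\cdot\,;\cdot\,|\,\cdot)$.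 For a unit vector $\Omega$ with polar angles $\theta\in[0,\pi]$, $\phi\in[0,2\pi]$ put $u=\cos\frac\theta2e^{i\phi/2}$, $v=\sin\frac\theta2e^{-i\phi/2}$, and let $|G;J,\Omega\rangle=A_J^\dagger|\mathrm{VBS}_L\rangle$ with $$A_J^\dagger=(ua_1^\dagger+vb_1^\dagger)^{J_-+J}\,(a_1^\dagger b_L^\dagger-b_1^\dagger a_L^\dagger)^{J_+-J}\,(ua_L^\dagger+vb_L^\dagger)^{-J_-+J}.$$ The block Hamiltonian is $$H_b=\sum_{j=1}^{L-1}\ \sum_{J=S_j+S_{j+1}+1-M_{j,j+1}}^{S_j+S_{j+1}}C_J(j,j+1)\,P_J(j,j+1),$$ with arbitrary $C_J(j,j+1)>0$, where $P_J(j,j+1)$ is the orthogonal projection onto the subspace on which the bond spin $\vec S_j+\vec S_{j+1}$ equals $J$. **Theorem 1.** All the states above satisfy the boson-number constraint at each site, and the following hold. 1. $$\rho_L=\frac{\prod_{j=1}^{L-1}(M_{j,j+1}+1)}{\prod_{j=1}^{L}(2S_j+1)!}\,M_{01}!\,M_{L,L+1}!\sum_{J=|J_-|}^{J_+}\sum_{M=-J}^{J}|\mathrm{VBS}_L(J,M)\rangle\langle\mathrm{VBS}_L(J,M)|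 .$$ The $(M_{01}+1)(M_{L,L+1}+1)$ states $|\mathrm{VBS}_L(J,M)\rangle$ are nonzero and mutually orthogonal. 2. There are numbers $\Lambda(J)>0$ such that, for every $J$, $M$ and $\Omega$, $|\mathrm{VBS}_L(J,M)\rangle$ and $|G;J,\Omega\rangle$ are eigenvectors (nonzero) of $\rho_L$ with eigenvalue $\Lambda(J)$. For every $\mu\neq0$ the eigenspace of $\rho_L$ for $\mu$ is spanned by the $|\mathrm{VBS}_L(J,M)\rangle$ with $\Lambda(J)=\mu$. 3. For each $J$, the states $|G;J,\Omega\rangle$ ($\Omega$ arbitrary) and the states $|\mathrm{VBS}_L(J,M)\rangle$ ($-J\le M\le J$) have the same linear span. 4. $H_b\ge0$, and the space $\ker H_b$ of its zero-energy ground states has dimension $(M_{01}+1)(M_{L,L+1}+1)$. It is equal to the span of all $|\mathrm{VBS}_L(J,M)\rangle$, to the span of all $|G;J,\Omega\rangle$, to the span of all eigenvectors of $\rho_L$ with nonzero eigenvalue, and to the range of $\rho_L$. 5. $\rho_L$ does not depend on the spins outside the block: two chains with blocks of the same length $L$ and the same bond numbers $M_{01},M_{12},\dots,M_{L,L+1}$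 have the same $\rho_L$. -/

import Mathlib

noncomputable section

namespace AKLT

open scoped Nat

/-! ### Spin chains and their Hilbert spaces

A row of `L` sites is labelled by `Fin L`.  A bond sequence `m : ℕ → ℕ` gives the bond
numbers along the row: `m i` is the number of the bond to the left of site `i`, `m (i + 1)` the
number of the bond to its right. -/

/-- Twice the spin at each site: the sum of the two adjacent bond numbers. -/
abbrev twiceSpin (m : ℕ → ℕ) (L : ℕ) : Fin L → ℕ := fun i => m i + m (i + 1)

/-- Labels of the `S^z`-basis for a family of spins `s i / 2`: the label `x i : Fin (s i + 1)` is
the number of `a`-bosons at site `i` (so `S^z_i = x i - s i / 2`); the number of `b`-bosons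
is `s i - x i`. -/
abbrev Config {L : ℕ} (s : Fin L → ℕ) : Type := ∀ i, Fin (s i + 1)

/-- The Hilbert space `⨂ i, ℂ^(s i + 1)` of a family of spins `s i / 2`, in the orthonormal
basis of products of `S^z`-eigenvectors. -/
abbrev SpinSpace {L : ℕ} (s : Fin L → ℕ) : Type := EuclideanSpace ℂ (Config s)

/-! ### Schwinger bosons

The (finite particle) Fock space of the bosons `a_i, b_i` is the polynomial ring in the
creation operators, which commute: creation operators act by multiplication, annihilation operators
by partial differentiation, and the vacuum is `1`.  A polynomial in the creation operators is
identified with the state it creates from the vacuum. -/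

/-- Fock space of two bosonic modes `a`, `b` on each of `L` sites. -/
abbrev Fock (L : ℕ) : Type := MvPolynomial (Fin L × Bool) ℂ

/-- The creation operator `a†_i`. -/
def aDag {L : ℕ} (i : Fin L) : Fock L := MvPolynomial.X (i, true)

/-- The creation operator `b†_i`. -/
def bDag {L : ℕ} (i : Fin L) : Fock L := MvPolynomial.X (i, false)

/-- Occupation numbers of the modes in the basis state `x`. -/
def occupation {L : ℕ} (s : Fin L → ℕ) (x : Config s) : (Fin L × Bool) →₀ ℕ :=
  Finsupp.equivFunOnFinite.symm fun c => if c.2 then (x c.1 : ℕ) else s c.1 - (x c.1 : ℕ)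

/-- The constraint that there are `s i` bosons at each site `i`. -/
def HasSpins {L : ℕ} (s : Fin L → ℕ) (p : Fock L) : Prop :=
  ∀ α ∈ p.support, ∀ i, α (i, true) + α (i, false) = s i

/-- The vector of the spin Hilbert space given by a Fock state with `s i` bosons at site `i`.
The normalized number state is `∏ i, (a†_i)^{x i} (b†_i)^{s i - x i} / √((x i)! (s i - x i)!)`
applied to the vacuum, so the amplitude is the coefficient times `√(∏ i, (x i)! (s i - x i)!)`. -/
def toSpin {L : ℕ} (s : Fin L → ℕ) (p : Fock L) : SpinSpace s :=
  WithLp.toLp 2 fun x =>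
    p.coeff (occupation s x) * (Real.sqrt (∏ i, ((x i : ℕ)! * (s i - (x i : ℕ))! : ℝ)) : ℂ)

/-! ### Valence bond solid states -/

/-- The valence bond operator `a†_i b†_j - b†_i a†_j`. -/
def valenceBond {L : ℕ} (i j : Fin L) : Fock L := aDag i * bDag j - bDag i * aDag j

/-- The VBS state of a row of `L` sites: the product over the inner bonds `(j, j + 1)` of the
valence bond operators to the power of the bond number, applied to the vacuum. -/
def vbsFock (m : ℕ → ℕ) (L : ℕ) : Fock L :=
  ∏ j : Fin (L - 1), valenceBond (⟨j, by omega⟩ : Fin L) ⟨j + 1, by omega⟩ ^ m (j + 1)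

/-- The bonds of a chain with sites `0, …, N + 1` and bond numbers `M j = M_{j,j+1}`,
`0 ≤ j ≤ N`, as a bond sequence: there is no bond to the left of site `0` nor to the right of
site `N + 1`.  So `2 S_0 = M 0`, `2 S_j = M (j - 1) + M j` for `1 ≤ j ≤ N`, and
`2 S_{N+1} = M N`. -/
def chainBond (N : ℕ) (M : ℕ → ℕ) : ℕ → ℕ
  | 0 => 0
  | j + 1 => if j ≤ N then M j else 0

/-- The VBS state of the whole chain. -/
def chainVBS (N : ℕ) (M : ℕ → ℕ) : SpinSpace (twiceSpin (chainBond N M) (N + 2)) :=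
  toSpin _ (vbsFock (chainBond N M) (N + 2))

/-- The density matrix `|VBS⟩⟨VBS| / ⟨VBS|VBS⟩` of the whole chain. -/
def chainDensity (N : ℕ) (M : ℕ → ℕ) :
    Matrix (Config (twiceSpin (chainBond N M) (N + 2)))
      (Config (twiceSpin (chainBond N M) (N + 2))) ℂ :=
  fun z z' => chainVBS N M z * star (chainVBS N M z') / ((‖chainVBS N M‖ ^ 2 : ℝ) : ℂ)

open scoped Classical in
/-- Partial trace over all sites outside the image of the injection `e`. -/
def partialTrace {L K : ℕ} (s : Fin K → ℕ) (e : Fin L → Fin K)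
    (A : Matrix (Config s) (Config s) ℂ) :
    Matrix (Config fun i => s (e i)) (Config fun i => s (e i)) ℂ :=
  fun x x' => ∑ z : Config s, ∑ z' : Config s,
    if (∀ i, z (e i) = x i) ∧ (∀ i, z' (e i) = x' i) ∧ (∀ j, j ∉ Set.range e → z j = z' j)
    then A z z' else 0

/-- The bonds seen by the block of sites starting at `k`.  With the sites of the block
relabelled `1, …, L`, `blockBond N M k j` is `M_{j,j+1}` for `0 ≤ j ≤ L`. -/
def blockBond (N : ℕ) (M : ℕ → ℕ) (k : ℕ) : ℕ → ℕ := fun j => chainBond N M (k + j)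

/-- The reduced density matrix of the block of sites `k, …, k + L - 1`. -/
def blockDensity (N : ℕ) (M : ℕ → ℕ) (k L : ℕ) (h : k + L ≤ N + 1) :
    Matrix (Config (twiceSpin (blockBond N M k) L)) (Config (twiceSpin (blockBond N M k) L)) ℂ :=
  partialTrace (twiceSpin (chainBond N M) (N + 2)) (fun i : Fin L => ⟨k + i, by omega⟩)
    (chainDensity N M)

/-! ### Degenerate VBS states

For a row of `L` sites with bond sequence `m` put `n₁ = m 0` and `n₂ = m L` (the two
dangling bonds).  The spins `J` between `|n₁ - n₂| / 2` and `(n₁ + n₂) / 2` are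
`J = (n₁ + n₂) / 2 - t` with `0 ≤ t ≤ min n₁ n₂`, and the `M` between `-J` and `J` are `M = J - r`
with `0 ≤ r ≤ 2 J = n₁ + n₂ - 2 t`. -/

/-- The Clebsch–Gordan coefficient `(j₁, m₁; j₂, m₂ | J, M)` (Condon–Shortley phases,
Racah's formula), where `j₁ = n₁ / 2`, `m₁ = j₁ - p`, `j₂ = n₂ / 2`, `m₂ = j₂ - q`,
`J = j₁ + j₂ - t`, `M = J - r`; thus `m₁ + m₂ = M` reads `p + q = t + r`, and, for instance,
`J - j₂ + m₁ = n₁ - t - p` and `J - j₁ - m₂ = q - t`.  The sum is over all `k` for which the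
arguments of the factorials are nonnegative. -/
def clebschGordan (n₁ p n₂ q t r : ℕ) : ℝ :=
  if p + q = t + r then
    Real.sqrt ((n₁ + n₂ - 2 * t + 1 : ℝ) * (n₁ - t)! * (n₂ - t)! * t ! / (n₁ + n₂ - t + 1)!) *
    Real.sqrt ((n₁ + n₂ - 2 * t - r)! * r ! * p ! * (n₁ - p)! * q ! * (n₂ - q)!) *
    ∑ k ∈ (Finset.range (t + 1)).filter
        (fun k => k ≤ p ∧ q + k ≤ n₂ ∧ t + p ≤ n₁ + k ∧ t ≤ q + k),
      (-1 : ℝ) ^ k / (k ! * (t - k)! * (p - k)! * (n₂ - (q + k))! *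
        (n₁ + k - (t + p))! * (q + k - t)!)
  else 0

/-- The spin state creation operator `ψ†_{S,m} = (a†)^{S+m} (b†)^{S-m} / √((S+m)! (S-m)!)` at
site `i`, with `S = n / 2` and `m = S - p`. -/
def spinCreate {L : ℕ} (i : Fin L) (n p : ℕ) : Fock L :=
  MvPolynomial.C ((Real.sqrt ((n - p)! * p !))⁻¹ : ℂ) * (aDag i ^ (n - p) * bDag i ^ p)

/-- The operator `Ψ†_{JM}`, coupling the spins `m 0 / 2` at the first site and
`m L / 2` at the last site of the row to total spin `J`. -/
def coupledCreate (m : ℕ → ℕ) (L : ℕ) (hL : 2 ≤ L) (t r : ℕ) : Fock L :=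
  ∑ p ∈ Finset.range (m 0 + 1), ∑ q ∈ Finset.range (m L + 1),
    MvPolynomial.C (clebschGordan (m 0) p (m L) q t r : ℂ) *
      (spinCreate (⟨0, by omega⟩ : Fin L) (m 0) p *
        spinCreate (⟨L - 1, by omega⟩ : Fin L) (m L) q)

/-- The degenerate VBS state `|VBS_L(J,M)⟩ = Ψ†_{JM} |VBS_L⟩`, as a Fock state. -/
def degFock (m : ℕ → ℕ) (L : ℕ) (hL : 2 ≤ L) (t r : ℕ) : Fock L :=
  coupledCreate m L hL t r * vbsFock m L

/-- The degenerate VBS state `|VBS_L(J,M)⟩`. -/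
def degVBS (m : ℕ → ℕ) (L : ℕ) (hL : 2 ≤ L) (t r : ℕ) : SpinSpace (twiceSpin m L) :=
  toSpin _ (degFock m L hL t r)

/-- The spinor coordinate `u = cos (θ/2) e^{iϕ/2}`. -/
def spinorU (θ ϕ : ℝ) : ℂ := (Real.cos (θ / 2) : ℂ) * Complex.exp (Complex.I * ϕ / 2)

/-- The spinor coordinate `v = sin (θ/2) e^{-iϕ/2}`. -/
def spinorV (θ ϕ : ℝ) : ℂ := (Real.sin (θ / 2) : ℂ) * Complex.exp (-(Complex.I * ϕ / 2))

/-- The operator `A†_J` for the unit vector with polar angles `θ, ϕ`.  Here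
`J₋ + J = m 0 - t`, `J₊ - J = t` and `-J₋ + J = m L - t`. -/
def aJDag (m : ℕ → ℕ) (L : ℕ) (hL : 2 ≤ L) (t : ℕ) (θ ϕ : ℝ) : Fock L :=
  let first : Fin L := ⟨0, by omega⟩
  let last : Fin L := ⟨L - 1, by omega⟩
  let u : Fock L := MvPolynomial.C (spinorU θ ϕ)
  let v : Fock L := MvPolynomial.C (spinorV θ ϕ)
  (u * aDag first + v * bDag first) ^ (m 0 - t) * valenceBond first last ^ t *
    (u * aDag last + v * bDag last) ^ (m L - t)

/-- The state `|G; J, Ω⟩ = A†_J |VBS_L⟩`, as a Fock state. -/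
def gFock (m : ℕ → ℕ) (L : ℕ) (hL : 2 ≤ L) (t : ℕ) (θ ϕ : ℝ) : Fock L :=
  aJDag m L hL t θ ϕ * vbsFock m L

/-- The state `|G; J, Ω⟩`. -/
def gState (m : ℕ → ℕ) (L : ℕ) (hL : 2 ≤ L) (t : ℕ) (θ ϕ : ℝ) : SpinSpace (twiceSpin m L) :=
  toSpin _ (gFock m L hL t θ ϕ)

/-! ### The block Hamiltonian -/

/-- The raising operator `S⁺_j = a†_j b_j` in the basis of number states. -/
def spinPlus {L : ℕ} (s : Fin L → ℕ) (j : Fin L) : Matrix (Config s) (Config s) ℂ :=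
  fun x y => if (x j : ℕ) = y j + 1 ∧ (∀ i, i ≠ j → x i = y i) then
    (Real.sqrt (((y j : ℕ) + 1 : ℝ) * ((s j : ℝ) - (y j : ℕ))) : ℂ) else 0

/-- The lowering operator `S⁻_j = b†_j a_j`, the adjoint of `S⁺_j`. -/
def spinMinus {L : ℕ} (s : Fin L → ℕ) (j : Fin L) : Matrix (Config s) (Config s) ℂ :=
  (spinPlus s j).conjTranspose

/-- The operator `S^z_j = (a†_j a_j - b†_j b_j) / 2`. -/
def spinZ {L : ℕ} (s : Fin L → ℕ) (j : Fin L) : Matrix (Config s) (Config s) ℂ :=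
  Matrix.diagonal fun x => ((x j : ℕ) : ℂ) - (s j : ℂ) / 2

/-- The square of the bond spin `S_i + S_j`:
`(S⁺ S⁻ + S⁻ S⁺) / 2 + (S^z)²` for the sums of the two spins. -/
def bondSpinSq {L : ℕ} (s : Fin L → ℕ) (i j : Fin L) : Matrix (Config s) (Config s) ℂ :=
  let sp := spinPlus s i + spinPlus s j
  let sm := spinMinus s i + spinMinus s j
  let sz := spinZ s i + spinZ s j
  (1 / 2 : ℂ) • (sp * sm + sm * sp) + sz * sz

/-- The projector `P_J(i,j)` onto the subspace on which the bond spin `S_i + S_j` is `J`, i.e. its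
square is `J (J + 1)`. -/
def bondProj {L : ℕ} (s : Fin L → ℕ) (i j : Fin L) (J : ℝ) : SpinSpace s →ₗ[ℂ] SpinSpace s :=
  ((Module.End.eigenspace (Matrix.toEuclideanLin (bondSpinSq s i j))
    ((J * (J + 1) : ℝ) : ℂ)).starProjection : SpinSpace s →L[ℂ] SpinSpace s).toLinearMap

/-- The block Hamiltonian: the sum over the inner bonds `(j, j + 1)` and over
`J = S_j + S_{j+1} - t`, `0 ≤ t ≤ M_{j,j+1} - 1`, of `C_J(j,j+1) P_J(j,j+1)`, where
`C j t` stands for `C_J(j,j+1)`. -/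
def blockHamiltonian (m : ℕ → ℕ) (L : ℕ) (C : ℕ → ℕ → ℝ) :
    SpinSpace (twiceSpin m L) →ₗ[ℂ] SpinSpace (twiceSpin m L) :=
  ∑ j : Fin (L - 1), ∑ t ∈ Finset.range (m (j + 1)),
    let i₁ : Fin L := ⟨j, by omega⟩
    let i₂ : Fin L := ⟨j + 1, by omega⟩
    (C j t : ℂ) • bondProj (twiceSpin m L) i₁ i₂
      ((twiceSpin m L i₁ : ℝ) / 2 + (twiceSpin m L i₂ : ℝ) / 2 - t)

/-- The pairs `(t, r)` which label the pairs `(J, M)` with `|J₋| ≤ J ≤ J₊`, `-J ≤ M ≤ J`: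
`J = J₊ - t` and `M = J - r`. -/
def labels (m : ℕ → ℕ) (L : ℕ) : Finset ((_ : ℕ) × ℕ) :=
  (Finset.range (min (m 0) (m L) + 1)).sigma fun t => Finset.range (m 0 + m L - 2 * t + 1)

/-- The constant
`∏_{j=1}^{L-1} (M_{j,j+1} + 1) M_{01}! M_{L,L+1}! / ∏_{j=1}^{L} (2 S_j + 1)!`. -/
def densityConst (m : ℕ → ℕ) (L : ℕ) : ℝ :=
  (∏ j ∈ Finset.Icc 1 (L - 1), (m j + 1 : ℝ)) * (m 0)! * (m L)! /
    ∏ i : Fin L, ((twiceSpin m L i + 1)! : ℝ)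

end AKLT

end

open AKLT

/-! States are polynomials in the creation operators, so the VBS state is a product of powers of the
binomials `bond i j`. With the inner product for which multiplication by a variable is adjoint to
its derivative, `toSpin` is an isometry on polynomials with the prescribed numbers of bosons
(`inner_toSpin`). Orthogonality then comes from representation theory, and ground states from unique
factorization.

Representation theory enters through generating polynomials. For a multiplet `f_0, …, f_d` put `f =
∑ f_r v^r`. Lowering acts on `f` as `d/dv` and raising as `d v - v² d/dv` (`IsLadder`), so products
of ladders are ladders and a singlet factor changes nothing. Since raising and lowering are adjoint,
coefficients at different positions or from multiplets of different dimension are orthogonal, and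
`⟨f_r, g_r⟩ = (d choose r) ⟨f_0, g_0⟩`. Applied to `spinor i ^ (n₁ - t) * bond i j ^ t * spinor j ^
(n₂ - t)`, this makes the matrix of Racah's coefficients orthogonal. Applied to the same ladder
times `vbsFock`, which is a singlet of the whole block, it makes the `|VBS_L(J,M)⟩` orthogonal with
norms independent of `M`.

Ground states: a state has no bond spin above `S_i + S_j - m` exactly when `bond i j ^ m` divides it
(`bondProj_eq_zero_iff`). The bonds are irreducible and pairwise coprime, so `ker H_b` consists of
the multiples of `vbsFock`. The cofactor carries `M_{01}` bosons at the first site and `M_{L,L+1}`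
at the last, which gives the dimension (`ker_blockHamiltonian`).

Density matrix: expanding the two bonds cut by the block writes the chain state as a sum of outer
states times number states of the two end spins times `vbsFock`. The outer states are coefficients
of ladders of the total spins to the left and to the right, hence orthogonal with binomial norms.
The binomials compensate the normalization of the number states, so all of these enter with equal
weight (`partialTrace_vbsFock`), and the orthogonal Clebsch–Gordan matrix turns the sum into one
over `(J, M)`. The constant is fixed by the trace. It involves the block alone, so it can be read
off from the chain with one extra site at each end and the product formula for the norm of a chain
(`blockTrace_mul_densityConst`).

The spectrum is that of a sum of orthogonal rank-one operators. The state `|G; J, Ω⟩` is the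
homogenized generating polynomial of the `J`-multiplet evaluated at `(u, v)`. It is therefore an
eigenvector, and varying `v / u` recovers every coefficient. -/

noncomputable section
namespace AKLT
open scoped Nat ComplexConjugate
open MvPolynomial

/-! ### The Bargmann–Fock inner product -/

section Bargmann

variable {σ : Type*}

/-- The squared norm of the monomial with exponents `α` in Fock space. -/
def factorialWeight (α : σ →₀ ℕ) : ℂ := α.prod fun _ n => (n ! : ℂ)

/-- The inner product of Fock space, in which multiplication by a variable is adjoint to the partial
derivative. -/
def fockInner : MvPolynomial σ ℂ →ₗ⋆[ℂ] MvPolynomial σ ℂ →ₗ[ℂ] ℂ :=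
  LinearMap.mk₂'ₛₗ (starRingEnd ℂ) (RingHom.id ℂ)
    (fun p q => (AddMonoidAlgebra.coeff q).sum fun α c => conj (p.coeff α) * c * factorialWeight α)
    (fun p p' q => by
      simp only [Finsupp.sum, ← Finset.sum_add_distrib, coeff_add, map_add, add_mul])
    (fun c p q => by
      simp only [Finsupp.sum, Finset.mul_sum, coeff_smul, smul_eq_mul, map_mul, mul_assoc])
    (fun p q q' => by
      classical
      rw [AddMonoidAlgebra.coeff_add, Finsupp.sum_add_index' (fun _ => by simp) (fun _ _ _ => by ring)])
    (fun c p q => by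
      classical
      rw [AddMonoidAlgebra.coeff_smul, Finsupp.sum_smul_index' (by simp), Finsupp.sum,
        Finsupp.sum, smul_eq_mul, Finset.mul_sum]
      refine Finset.sum_congr rfl fun i _ => ?_
      simp only [smul_eq_mul, RingHom.id_apply]; ring)

theorem fockInner_monomial_right (p : MvPolynomial σ ℂ) (α : σ →₀ ℕ) (c : ℂ) :
    fockInner p (monomial α c) = conj (p.coeff α) * c * factorialWeight α := by
  simp only [fockInner, LinearMap.mk₂'ₛₗ_apply]
  exact Finsupp.sum_single_index (by simp)

theorem fockInner_eq_sum (p q : MvPolynomial σ ℂ) :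
    fockInner p q = ∑ α ∈ q.support, conj (p.coeff α) * q.coeff α * factorialWeight α := rfl

theorem fockInner_smul_smul (a b : ℂ) (p q : MvPolynomial σ ℂ) :
    fockInner (a • p) (b • q) = conj a * b * fockInner p q := by
  rw [LinearMap.map_smulₛₗ₂, LinearMap.map_smul, smul_eq_mul, smul_eq_mul, mul_assoc]

theorem conj_factorialWeight (α : σ →₀ ℕ) : conj (factorialWeight α) = factorialWeight α := by
  simp [factorialWeight, Finsupp.prod]

theorem fockInner_conj_symm (p q : MvPolynomial σ ℂ) : conj (fockInner p q) = fockInner q p := by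
  classical
  rw [fockInner_eq_sum, fockInner_eq_sum, map_sum]
  have h1 : ∀ p q : MvPolynomial σ ℂ,
      ∑ α ∈ q.support, conj (p.coeff α) * q.coeff α * factorialWeight α =
      ∑ α ∈ q.support ∪ p.support, conj (p.coeff α) * q.coeff α * factorialWeight α := fun p q =>
    Finset.sum_subset Finset.subset_union_left fun α _ h => by
      simp [notMem_support_iff.1 h]
  rw [← map_sum, h1, h1, map_sum, Finset.union_comm]
  refine Finset.sum_congr rfl fun α _ => ?_
  simp only [map_mul, conj_factorialWeight, Complex.conj_conj]; ring

theorem factorialWeight_add_single (α : σ →₀ ℕ) (c : σ) :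
    factorialWeight (α + Finsupp.single c 1) = (α c + 1) * factorialWeight α := by
  classical
  have hs : (α + Finsupp.single c 1).support ⊆ insert c α.support := fun i hi => by
    by_contra h
    simp only [Finset.mem_insert, Finsupp.mem_support_iff, not_or, not_not] at h
    simp [h.2, Ne.symm h.1] at hi
  have h2 : α.support ⊆ insert c α.support := Finset.subset_insert _ _
  unfold factorialWeight
  rw [Finsupp.prod_of_support_subset _ hs _ (by simp),
    Finsupp.prod_of_support_subset _ h2 _ (by simp),
    ← Finset.mul_prod_erase _ _ (Finset.mem_insert_self c _),
    ← Finset.mul_prod_erase _ (fun i => ((α i)! : ℂ)) (Finset.mem_insert_self c _), ← mul_assoc]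
  congr 1
  · simp [Nat.factorial_succ]
  · refine Finset.prod_congr rfl fun i hi => ?_
    simp [(Finset.ne_of_mem_erase hi).symm]

/-- On a monomial `q` the derivative produces the exponent of `c`, which is also the factor by which
`factorialWeight` grows when that exponent is raised to its value. -/
theorem fockInner_X_mul (c : σ) (p q : MvPolynomial σ ℂ) :
    fockInner (X c * p) q = fockInner p (pderiv c q) := by
  classical
  induction q using MvPolynomial.induction_on' with
  | add f g hf hg => simp only [map_add, hf, hg]
  | monomial α a =>
    rw [pderiv_monomial, fockInner_monomial_right, fockInner_monomial_right, mul_comm (X c)]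
    by_cases h : α c = 0
    · simp [coeff_mul_X', h]
    · obtain ⟨β, rfl⟩ : ∃ β, α = β + Finsupp.single c 1 :=
        ⟨α - Finsupp.single c 1, (tsub_add_cancel_of_le (Finsupp.single_le_iff.2 (by omega))).symm⟩
      rw [coeff_mul_X, factorialWeight_add_single, add_tsub_cancel_right]
      simp; ring

theorem fockInner_mul_X_right (c : σ) (p q : MvPolynomial σ ℂ) :
    fockInner p (X c * q) = fockInner (pderiv c p) q := by
  rw [← fockInner_conj_symm, fockInner_X_mul, fockInner_conj_symm]

/-- A mode absent from `Y` contributes `n!` to the squared norm. This strips modes off one at a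
time. -/
theorem fockInner_self_pow_mul {c : σ} {Y : MvPolynomial σ ℂ} (hY : pderiv c Y = 0) (n : ℕ) :
    fockInner (X c ^ n * Y) (X c ^ n * Y) = n ! * fockInner Y Y := by
  induction n with
  | zero => simp
  | succ n ih =>
    have : pderiv c (X c ^ (n + 1) * Y) = C (n + 1 : ℂ) * (X c ^ n * Y) := by
      simp [hY]; ring
    rw [pow_succ', mul_assoc (X c), fockInner_X_mul, ← mul_assoc (X c), ← pow_succ', this, C_mul',
      map_smul, ih, Nat.factorial_succ]
    push_cast; simp; ring

theorem fockInner_self (p : MvPolynomial σ ℂ) :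
    fockInner p p = ((∑ α ∈ p.support, ‖p.coeff α‖ ^ 2 * (α.prod fun _ n => (n ! : ℝ)) : ℝ) : ℂ) := by
  rw [fockInner_eq_sum]
  push_cast
  refine Finset.sum_congr rfl fun α _ => ?_
  rw [RCLike.conj_mul]
  simp [factorialWeight, Finsupp.prod]

theorem fockInner_self_eq_zero {p : MvPolynomial σ ℂ} (h : fockInner p p = 0) : p = 0 := by
  rw [fockInner_self, Complex.ofReal_eq_zero, Finset.sum_eq_zero_iff_of_nonneg] at h
  · ext α
    by_contra hα
    have := h α (by simpa [mem_support_iff] using hα)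
    rcases mul_eq_zero.1 this with h' | h'
    · exact hα (by simpa using h')
    · rw [Finsupp.prod, Finset.prod_eq_zero_iff] at h'
      obtain ⟨i, _, hi⟩ := h'
      exact Nat.factorial_ne_zero _ (by exact_mod_cast hi)
  · intro α _
    have : (0 : ℝ) ≤ α.prod fun _ n => (n ! : ℝ) := Finset.prod_nonneg fun _ _ => by positivity
    positivity

end Bargmann

/-! ### Total spin operators and ladders -/

section Ladder

variable {ι : Type*}

/-- The total raising operator `∑ a†_i b_i` (for `β = true`) or lowering operator `∑ b†_i a_i`
(for `β = false`) of the sites in `T`. -/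
def hop (T : Finset ι) (β : Bool) :
    Derivation ℂ (MvPolynomial (ι × Bool) ℂ) (MvPolynomial (ι × Bool) ℂ) :=
  ∑ i ∈ T, (X (i, β) : MvPolynomial (ι × Bool) ℂ) • pderiv (i, !β)

theorem hop_apply (T : Finset ι) (β : Bool) (p : MvPolynomial (ι × Bool) ℂ) :
    hop T β p = ∑ i ∈ T, X (i, β) * pderiv (i, !β) p := by
  classical
  rw [hop]
  induction T using Finset.induction_on with
  | empty => simp
  | insert a s ha ih => rw [Finset.sum_insert ha, Finset.sum_insert ha, ← ih]; rfl

theorem hop_X [DecidableEq ι] (T : Finset ι) (β γ : Bool) (i : ι) :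
    hop T β (X (i, γ)) = if i ∈ T ∧ γ = !β then X (i, β) else 0 := by
  rw [hop_apply]
  by_cases hγ : γ = !β
  · subst hγ
    simp [pderiv_X, Pi.single_apply]
  · rw [if_neg (fun h => hγ h.2)]
    exact Finset.sum_eq_zero fun j _ => by
      rw [pderiv_X_of_ne (by simpa using fun _ => hγ), mul_zero]

theorem fockInner_hop (T : Finset ι) (β : Bool) (p q : MvPolynomial (ι × Bool) ℂ) :
    fockInner (hop T β p) q = fockInner p (hop T (!β) q) := by
  simp only [hop_apply, map_sum, LinearMap.sum_apply, fockInner_X_mul, fockInner_mul_X_right,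
    Bool.not_not]

theorem fockInner_hop_right (T : Finset ι) (β : Bool) (p q : MvPolynomial (ι × Bool) ℂ) :
    fockInner p (hop T β q) = fockInner (hop T (!β) p) q := by
  rw [fockInner_hop, Bool.not_not]

/-- The valence bond `a†_i b†_j - b†_i a†_j`. -/
def bond (i j : ι) : MvPolynomial (ι × Bool) ℂ :=
  X (i, true) * X (j, false) - X (i, false) * X (j, true)

/-- `W` is annihilated by the total spin of the sites in `T`. -/
def IsSinglet (T : Finset ι) (W : MvPolynomial (ι × Bool) ℂ) : Prop := ∀ β, hop T β W = 0

namespace IsSinglet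

variable {T : Finset ι} {V W : MvPolynomial (ι × Bool) ℂ}

theorem C (c : ℂ) : IsSinglet T (MvPolynomial.C c) := fun β => by simp

theorem X {i : ι} (hi : i ∉ T) (γ : Bool) : IsSinglet T (MvPolynomial.X (i, γ)) := fun β => by
  classical
  simp [hop_X, hi]

theorem mul (hV : IsSinglet T V) (hW : IsSinglet T W) : IsSinglet T (V * W) := fun β => by
  simp [hV β, hW β]

theorem pow (hV : IsSinglet T V) (n : ℕ) : IsSinglet T (V ^ n) := fun β => by
  simp [Derivation.leibniz_pow, hV β]

theorem prod {κ : Type*} {s : Finset κ} {f : κ → MvPolynomial (ι × Bool) ℂ}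
    (h : ∀ k ∈ s, IsSinglet T (f k)) : IsSinglet T (∏ k ∈ s, f k) := by
  classical
  induction s using Finset.induction_on with
  | empty => simpa using IsSinglet.C (T := T) 1
  | insert a s ha ih =>
    rw [Finset.prod_insert ha]
    exact (h a (by simp)).mul (ih fun k hk => h k (by simp [hk]))

/-- With both sites in `T` the bond is a determinant of two spinors, hence invariant. With both
outside, the spin of `T` does not act on it. Only a bond cut by `T` fails to be a singlet. -/
theorem bond {i j : ι} (h : i ∈ T ↔ j ∈ T) : IsSinglet T (bond i j) := fun β => by
  classical
  cases β <;> by_cases hi : i ∈ T <;> simp [AKLT.bond, hop_X, hi, ← h] <;> ring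

end IsSinglet

/-- The coefficients of `f` form a multiplet of dimension `d + 1` of the total spin of the
sites in `T`. -/
def IsLadder (T : Finset ι) (d : ℕ) (f : Polynomial (MvPolynomial (ι × Bool) ℂ)) : Prop :=
  (∀ r, hop T false (f.coeff r) = f.derivative.coeff r) ∧
    ∀ r, hop T true (f.coeff r) =
      ((d : Polynomial (MvPolynomial (ι × Bool) ℂ)) * Polynomial.X * f -
        Polynomial.X ^ 2 * f.derivative).coeff r

/-- The spin operators are derivations acting on the coefficients, and the operators of `IsLadder`
are first order in the polynomial variable. Leibniz' rule on both sides shows that ladders multiply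
and their dimensions `d` add. -/
theorem derivation_coeff_mul {A : Type*} [CommRing A] [Algebra ℂ A] (D : Derivation ℂ A A)
    {f g f' g' : Polynomial A} (hf : ∀ r, D (f.coeff r) = f'.coeff r)
    (hg : ∀ r, D (g.coeff r) = g'.coeff r) (r : ℕ) :
    D ((f * g).coeff r) = (f' * g + f * g').coeff r := by
  simp only [Polynomial.coeff_add, Polynomial.coeff_mul, map_sum, Derivation.leibniz, hf, hg,
    ← Finset.sum_add_distrib, smul_eq_mul]
  exact Finset.sum_congr rfl fun _ _ => by ring

theorem ladder_leibniz {A : Type*} [CommRing A] (a b x f g f' g' : A) :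
    (a * x * f - x ^ 2 * f') * g + f * (b * x * g - x ^ 2 * g') =
      (a + b) * x * (f * g) - x ^ 2 * (f' * g + f * g') := by ring

namespace IsLadder

variable {T : Finset ι} {d e : ℕ} {f g : Polynomial (MvPolynomial (ι × Bool) ℂ)}
  {W : MvPolynomial (ι × Bool) ℂ}

theorem mul (hf : IsLadder T d f) (hg : IsLadder T e g) : IsLadder T (d + e) (f * g) := by
  refine ⟨fun r => ?_, fun r => ?_⟩
  · rw [derivation_coeff_mul _ hf.1 hg.1, Polynomial.derivative_mul]
  · rw [derivation_coeff_mul _ hf.2 hg.2, Polynomial.derivative_mul]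
    rw [ladder_leibniz, Nat.cast_add]

theorem C (hW : IsSinglet T W) : IsLadder T 0 (Polynomial.C W) := by
  refine ⟨fun r => ?_, fun r => ?_⟩ <;> by_cases hr : r = 0 <;>
    simp [Polynomial.coeff_C, hr, hW _]

theorem pow (hf : IsLadder T d f) (n : ℕ) : IsLadder T (n * d) (f ^ n) := by
  induction n with
  | zero => simpa using IsLadder.C (T := T) (IsSinglet.C 1)
  | succ n ih => rw [pow_succ, add_mul, one_mul]; exact ih.mul hf

theorem lower (hf : IsLadder T d f) (r : ℕ) :
    hop T false (f.coeff r) = (r + 1 : ℂ) • f.coeff (r + 1) := by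
  rw [hf.1, Polynomial.coeff_derivative, smul_eq_C_mul, mul_comm]; simp

theorem raise_zero (hf : IsLadder T d f) : hop T true (f.coeff 0) = 0 := by
  rw [hf.2]; simp [mul_assoc]

theorem raise_succ (hf : IsLadder T d f) (r : ℕ) :
    hop T true (f.coeff (r + 1)) = (d - r : ℂ) • f.coeff r := by
  rw [hf.2, smul_eq_C_mul, mul_assoc, Polynomial.coeff_sub, ← Polynomial.C_eq_natCast,
    Polynomial.coeff_C_mul, Polynomial.coeff_X_mul]
  cases r with
  | zero => simp [pow_two, mul_assoc]
  | succ r =>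
    rw [pow_two, mul_assoc, Polynomial.coeff_X_mul, Polynomial.coeff_X_mul,
      Polynomial.coeff_derivative]
    simp; ring

/-- Lowering `f_r` on the left is raising `g_{s+1}` on the right. All inner products between ladders
follow from this recursion along the diagonals of `(r, s)`. -/
theorem fockInner_step (hf : IsLadder T d f) (hg : IsLadder T e g) (r s : ℕ) :
    (r + 1 : ℂ) * fockInner (f.coeff (r + 1)) (g.coeff (s + 1)) =
      (e - s) * fockInner (f.coeff r) (g.coeff s) := by
  have h := fockInner_hop T false (f.coeff r) (g.coeff (s + 1))
  rw [hf.lower, Bool.not_false, hg.raise_succ] at h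
  simpa using h

/-- The recursion descends to `r = 0`, where raising annihilates `f_0` while `g_s` with `s > 0` is
obtained by lowering. -/
theorem fockInner_eq_zero_of_lt (hf : IsLadder T d f) (hg : IsLadder T e g) {r s : ℕ}
    (h : r < s) : fockInner (f.coeff r) (g.coeff s) = 0 := by
  induction r generalizing s with
  | zero =>
    obtain ⟨s, rfl⟩ : ∃ s', s = s' + 1 := ⟨s - 1, by omega⟩
    have := fockInner_hop_right T false (f.coeff 0) (g.coeff s)
    rw [hg.lower, Bool.not_false, hf.raise_zero] at this
    have h0 : (s + 1 : ℂ) ≠ 0 := by exact_mod_cast s.succ_ne_zero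
    simpa [h0] using this
  | succ r ih =>
    obtain ⟨s, rfl⟩ : ∃ s', s = s' + 1 := ⟨s - 1, by omega⟩
    have := hf.fockInner_step hg r s
    rw [ih (by omega), mul_zero] at this
    have h0 : (r + 1 : ℂ) ≠ 0 := by exact_mod_cast r.succ_ne_zero
    simpa [h0] using this

theorem fockInner_eq_zero_of_ne (hf : IsLadder T d f) (hg : IsLadder T e g) {r s : ℕ}
    (h : r ≠ s) : fockInner (f.coeff r) (g.coeff s) = 0 := by
  rcases lt_or_gt_of_ne h with h | h
  · exact hf.fockInner_eq_zero_of_lt hg h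
  · rw [← fockInner_conj_symm, hg.fockInner_eq_zero_of_lt hf h, map_zero]

/-- On the diagonal, the recursion and the conjugate of the one with `f` and `g` exchanged differ
only in the factors `e - r` and `d - r`. -/
theorem fockInner_eq_zero_of_dim_ne (hf : IsLadder T d f) (hg : IsLadder T e g) (h : d ≠ e)
    (r s : ℕ) : fockInner (f.coeff r) (g.coeff s) = 0 := by
  by_cases hrs : r = s
  · subst hrs
    have h1 := hf.fockInner_step hg r r
    have h2 := congrArg conj (hg.fockInner_step hf r r)
    simp only [map_mul, fockInner_conj_symm, map_sub, map_add, map_natCast, map_one] at h2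
    have h3 : ((d : ℂ) - e) * fockInner (f.coeff r) (g.coeff r) = 0 := by linear_combination h1 - h2
    have h0 : (d : ℂ) - e ≠ 0 := sub_ne_zero.2 (by exact_mod_cast h)
    simpa [h0] using h3
  · exact hf.fockInner_eq_zero_of_ne hg hrs

/-- On the diagonal the recursion is that of the binomial coefficients. As in Schur's lemma, `f` and
`g` may be different multiplets. -/
theorem fockInner_same (hf : IsLadder T d f) (hg : IsLadder T d g) (r : ℕ) :
    fockInner (f.coeff r) (g.coeff r) = d.choose r * fockInner (f.coeff 0) (g.coeff 0) := by
  induction r with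
  | zero => simp
  | succ r ih =>
    have h0 : (r + 1 : ℂ) ≠ 0 := by exact_mod_cast r.succ_ne_zero
    have h1 := hf.fockInner_step hg r r
    have h2 : (d.choose (r + 1) : ℂ) * (r + 1) = d.choose r * (d - r) := by
      rcases le_or_gt r d with h | h
      · rw [← Nat.cast_sub h]; exact_mod_cast Nat.choose_succ_right_eq d r
      · simp [Nat.choose_eq_zero_of_lt h, Nat.choose_eq_zero_of_lt (h.trans r.lt_succ_self)]
    apply mul_left_cancel₀ h0
    rw [h1, ih]
    linear_combination (-fockInner (f.coeff 0) (g.coeff 0)) * h2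

end IsLadder

/-- The spinor `a†_i + v b†_i`, as a polynomial in `v`. -/
def spinor (i : ι) : Polynomial (MvPolynomial (ι × Bool) ℂ) :=
  Polynomial.C (X (i, true)) + Polynomial.X * Polynomial.C (X (i, false))

theorem isLadder_spinor {T : Finset ι} {i : ι} (hi : i ∈ T) : IsLadder T 1 (spinor i) := by
  classical
  refine ⟨fun r => ?_, fun r => ?_⟩ <;>
  · unfold spinor
    rcases r with _ | _ | _ | r <;>
    simp [hop_X, hi, Polynomial.coeff_C, Polynomial.coeff_X, mul_add,
      pow_two, mul_assoc]

theorem spinor_pow_coeff (i : ι) (n r : ℕ) :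
    (spinor i ^ n).coeff r = (n.choose r : ℂ) • (X (i, true) ^ (n - r) * X (i, false) ^ r) := by
  rw [spinor, add_pow, Polynomial.finsetSum_coeff]
  rw [Finset.sum_congr rfl (g := fun m => if r = n - m then (n.choose m : ℂ) •
    (X (i, true) ^ m * X (i, false) ^ (n - m) : MvPolynomial (ι × Bool) ℂ) else 0)]
  · rcases le_or_gt r n with h | h
    · rw [Finset.sum_eq_single_of_mem (n - r) (by simp), if_pos (by omega),
        Nat.choose_symm h, Nat.sub_sub_self h]
      intro m hm hne
      rw [if_neg]
      simp at hm; omega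
    · rw [Nat.choose_eq_zero_of_lt h]
      simp only [Nat.cast_zero, zero_smul]
      exact Finset.sum_eq_zero fun m hm => if_neg (by omega)
  · intro m _
    have : Polynomial.C (X (i, true)) ^ m * (Polynomial.X * Polynomial.C (X (i, false))) ^ (n - m) *
        (n.choose m : Polynomial (MvPolynomial (ι × Bool) ℂ)) = Polynomial.C ((n.choose m : ℂ) •
        (X (i, true) ^ m * X (i, false) ^ (n - m))) * Polynomial.X ^ (n - m) := by
      rw [smul_eq_C_mul]; simp; ring
    rw [this, Polynomial.coeff_C_mul_X_pow]

end Ladder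

/-! ### Coupling two spins -/

section Coupling

variable {ι : Type*}

/-- The number state with `n₁ - p`, `p`, `n₂ - q`, `q` bosons in the modes `a_i`, `b_i`, `a_j`,
`b_j`. -/
def twoSite (i j : ι) (n₁ n₂ p q : ℕ) : MvPolynomial (ι × Bool) ℂ :=
  X (i, true) ^ (n₁ - p) * X (i, false) ^ p * (X (j, true) ^ (n₂ - q) * X (j, false) ^ q)

/-- The generating polynomial of the states of total spin `(n₁ + n₂) / 2 - t` of the spins
`n₁ / 2` at `i` and `n₂ / 2` at `j`. -/
def coupling (i j : ι) (n₁ n₂ t : ℕ) : Polynomial (MvPolynomial (ι × Bool) ℂ) :=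
  spinor i ^ (n₁ - t) * Polynomial.C (bond i j ^ t) * spinor j ^ (n₂ - t)

theorem isLadder_coupling {T : Finset ι} {i j : ι} (hi : i ∈ T) (hj : j ∈ T) {n₁ n₂ t : ℕ}
    (h₁ : t ≤ n₁) (h₂ : t ≤ n₂) : IsLadder T (n₁ + n₂ - 2 * t) (coupling i j n₁ n₂ t) := by
  have := (((isLadder_spinor hi).pow (n₁ - t)).mul
    (IsLadder.C ((IsSinglet.bond (by simp [hi, hj] : i ∈ T ↔ j ∈ T)).pow t))).mul
    ((isLadder_spinor hj).pow (n₂ - t))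
  rw [show n₁ + n₂ - 2 * t = (n₁ - t) * 1 + 0 + (n₂ - t) * 1 by omega]
  exact this

theorem bond_pow (i j : ι) (t : ℕ) : bond i j ^ t = ∑ k ∈ Finset.range (t + 1),
    ((-1) ^ k * t.choose k : ℂ) • twoSite i j t t k (t - k) := by
  rw [bond, sub_eq_neg_add, add_pow]
  refine Finset.sum_congr rfl fun k hk => ?_
  have hk' : t - (t - k) = k := by simp at hk; omega
  rw [smul_eq_C_mul, twoSite, hk', neg_pow]
  simp only [mul_pow, map_mul, map_pow, map_neg, map_one, map_natCast]; ring

theorem twoSite_mul {i j : ι} {n₁ n₂ m₁ m₂ p q p' q' : ℕ} (hp : p ≤ n₁) (hq : q ≤ n₂)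
    (hp' : p' ≤ m₁) (hq' : q' ≤ m₂) : twoSite i j n₁ n₂ p q * twoSite i j m₁ m₂ p' q' =
      twoSite i j (n₁ + m₁) (n₂ + m₂) (p + p') (q + q') := by
  rw [twoSite, twoSite, twoSite, show n₁ + m₁ - (p + p') = (n₁ - p) + (m₁ - p') by omega,
    show n₂ + m₂ - (q + q') = (n₂ - q) + (m₂ - q') by omega]
  ring

/-- The indices which contribute to a Clebsch–Gordan coefficient. -/
def couplingRange (n₁ p n₂ q t : ℕ) : Finset ℕ := (Finset.range (t + 1)).filter
  (fun k => k ≤ p ∧ q + k ≤ n₂ ∧ t + p ≤ n₁ + k ∧ t ≤ q + k)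

/-- The coefficients of the coupled states in the basis of number states. -/
def couplingCoeff (n₁ p n₂ q t r : ℕ) : ℝ :=
  if p + q = t + r then ∑ k ∈ couplingRange n₁ p n₂ q t,
    (-1) ^ k * t.choose k * ((n₁ - t).choose (p - k) * (n₂ - t).choose (q + k - t)) else 0

theorem coupling_coeff (i j : ι) {n₁ n₂ t : ℕ} (h₁ : t ≤ n₁) (h₂ : t ≤ n₂) (r : ℕ) :
    (coupling i j n₁ n₂ t).coeff r =
      ∑ p ∈ Finset.range (n₁ + 1), ∑ q ∈ Finset.range (n₂ + 1),
        (couplingCoeff n₁ p n₂ q t r : ℂ) • twoSite i j n₁ n₂ p q := by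
  have hL : (coupling i j n₁ n₂ t).coeff r = ∑ k ∈ Finset.range (t + 1),
      ∑ x ∈ (Finset.HasAntidiagonal.antidiagonal r).filter (fun x => x.1 ≤ n₁ - t ∧ x.2 ≤ n₂ - t),
        ((-1) ^ k * t.choose k * ((n₁ - t).choose x.1 * (n₂ - t).choose x.2) : ℂ) •
          twoSite i j n₁ n₂ (x.1 + k) (x.2 + (t - k)) := by
    rw [coupling, mul_right_comm, Polynomial.coeff_mul_C, bond_pow, Polynomial.coeff_mul,
      Finset.mul_sum]
    refine Finset.sum_congr rfl fun k hk => ?_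
    rw [Finset.sum_filter, Finset.sum_mul]
    refine Finset.sum_congr rfl fun x _ => ?_
    rw [spinor_pow_coeff, spinor_pow_coeff]
    split_ifs with h
    · simp only [Finset.mem_range] at hk
      have := twoSite_mul (i := i) (j := j) h.1 h.2 (show k ≤ t by omega)
        (show t - k ≤ t by omega)
      rw [Nat.sub_add_cancel h₁, Nat.sub_add_cancel h₂] at this
      rw [← this]
      simp only [twoSite, smul_eq_C_mul, map_mul]; ring
    · rw [not_and_or, not_le, not_le] at h
      rcases h with h | h <;> simp [Nat.choose_eq_zero_of_lt h]
  have hR : ∑ p ∈ Finset.range (n₁ + 1), ∑ q ∈ Finset.range (n₂ + 1),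
        (couplingCoeff n₁ p n₂ q t r : ℂ) • twoSite i j n₁ n₂ p q =
      ∑ k ∈ Finset.range (t + 1), ∑ y ∈ (Finset.range (n₁ + 1) ×ˢ Finset.range (n₂ + 1)).filter
        (fun y => y.1 + y.2 = t + r ∧ k ≤ y.1 ∧ y.2 + k ≤ n₂ ∧ t + y.1 ≤ n₁ + k ∧ t ≤ y.2 + k),
        ((-1) ^ k * t.choose k * ((n₁ - t).choose (y.1 - k) * (n₂ - t).choose (y.2 + k - t)) : ℂ) •
          twoSite i j n₁ n₂ y.1 y.2 := by
    rw [← Finset.sum_product']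
    simp only [Finset.sum_filter]
    rw [Finset.sum_comm]
    refine Finset.sum_congr rfl fun y _ => ?_
    rw [couplingCoeff, couplingRange, Finset.sum_filter]
    split_ifs with h
    · push_cast
      rw [Finset.sum_smul]
      refine Finset.sum_congr rfl fun k _ => ?_
      simp only [h, true_and]
      split_ifs <;> simp
    · simp [h]
  rw [hL, hR]
  refine Finset.sum_congr rfl fun k hk => ?_
  simp only [Finset.mem_range] at hk
  -- Here `p` and `q` count the `b`-bosons at `i` and `j`. The spinors supply `x.1` and `x.2`, the
  -- `k`-th term of the bond power supplies `k` and `t - k`.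
  refine Finset.sum_nbij' (fun x => (x.1 + k, x.2 + (t - k))) (fun y => (y.1 - k, y.2 + k - t))
    ?_ ?_ ?_ ?_ ?_
  · rintro ⟨x, y⟩ h
    simp at h ⊢; omega
  · rintro ⟨x, y⟩ h
    simp at h ⊢; omega
  · rintro ⟨x, y⟩ h
    simp at h ⊢; omega
  · rintro ⟨x, y⟩ h
    simp at h ⊢; omega
  · rintro ⟨x, y⟩ h
    simp only [Nat.add_sub_cancel]
    rw [show y + (t - k) + k - t = y by omega]

/-- The factor by which the normalized coupled states differ from the coefficients of
`coupling`. -/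
def couplingNorm (n₁ n₂ t r : ℕ) : ℝ :=
  √((n₁ + n₂ - 2 * t + 1 : ℝ) * (n₁ - t)! * (n₂ - t)! * t ! / (n₁ + n₂ - t + 1)!) *
    √((n₁ + n₂ - 2 * t - r)! * r !) / (t ! * (n₁ - t)! * (n₂ - t)!)

/-- Up to `t! (n₁ - t)! (n₂ - t)!`, the denominators in Racah's sum form the product of three
binomials obtained by expanding `coupling`. The factorials of `p` and `q` under the root normalize
the number states. -/
theorem clebschGordan_eq {n₁ n₂ t : ℕ} (h₁ : t ≤ n₁) (h₂ : t ≤ n₂) (p q r : ℕ) :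
    clebschGordan n₁ p n₂ q t r = couplingNorm n₁ n₂ t r *
      √((n₁ - p)! * p ! * ((n₂ - q)! * q !)) * couplingCoeff n₁ p n₂ q t r := by
  rw [clebschGordan, couplingNorm, couplingCoeff]
  split_ifs with h
  swap
  · simp
  have hs : √((n₁ + n₂ - 2 * t - r)! * r ! * p ! * (n₁ - p)! * q ! * (n₂ - q)! : ℝ) =
      √((n₁ + n₂ - 2 * t - r)! * r !) * √((n₁ - p)! * p ! * ((n₂ - q)! * q !)) := by
    rw [← Real.sqrt_mul (by positivity)]; congr 1; ring
  rw [hs, Finset.mul_sum, Finset.mul_sum, couplingRange]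
  refine Finset.sum_congr rfl fun k hk => ?_
  simp only [Finset.mem_filter, Finset.mem_range] at hk
  rw [Nat.cast_choose ℝ (show k ≤ t by omega), Nat.cast_choose ℝ (show p - k ≤ n₁ - t by omega),
    Nat.cast_choose ℝ (show q + k - t ≤ n₂ - t by omega),
    show n₁ - t - (p - k) = n₁ + k - (t + p) by omega,
    show n₂ - t - (q + k - t) = n₂ - (q + k) by omega]
  field_simp

theorem couplingNorm_pos {n₁ n₂ t : ℕ} (h₁ : t ≤ n₁) (h₂ : t ≤ n₂) (r : ℕ) :
    0 < couplingNorm n₁ n₂ t r := by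
  have h3 : (0 : ℝ) < n₁ + n₂ - 2 * t + 1 := by
    have : (t : ℝ) ≤ n₁ := by exact_mod_cast h₁
    have : (t : ℝ) ≤ n₂ := by exact_mod_cast h₂
    linarith
  unfold couplingNorm
  positivity

/-- Comparison of coefficients in `(1 - x)^{-(a+1)} (1 - x)^{-(b+1)} = (1 - x)^{-(a+b+2)}`. -/
theorem sum_antidiagonal_choose_add_mul (a b t : ℕ) :
    ∑ x ∈ Finset.HasAntidiagonal.antidiagonal t, (a + x.1).choose a * (b + x.2).choose b =
      (a + b + 1 + t).choose (a + b + 1) := by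
  have h := PowerSeries.mk_one_pow_eq_mk_choose_add ℚ (a + b + 1)
  rw [show a + b + 1 + 1 = (a + 1) + (b + 1) by ring, pow_add,
    PowerSeries.mk_one_pow_eq_mk_choose_add, PowerSeries.mk_one_pow_eq_mk_choose_add] at h
  have := congrArg (PowerSeries.coeff t) h
  rw [PowerSeries.coeff_mul] at this
  simp only [PowerSeries.coeff_mk] at this
  exact_mod_cast this

end Coupling

/-! ### Orthonormality of the coupled states and orthogonality of the Clebsch–Gordan matrix -/

section Orthonormality

variable {ι : Type*}

theorem twoSite_eq_monomial (i j : ι) (n₁ n₂ p q : ℕ) : twoSite i j n₁ n₂ p q =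
    monomial (Finsupp.single (i, true) (n₁ - p) + Finsupp.single (i, false) p +
      (Finsupp.single (j, true) (n₂ - q) + Finsupp.single (j, false) q)) 1 := by
  simp only [twoSite, X_pow_eq_monomial, monomial_mul, mul_one]

theorem fockInner_twoSite {i j : ι} (hij : i ≠ j) {n₁ n₂ : ℕ} (p q p' q' : ℕ) :
    fockInner (twoSite i j n₁ n₂ p q) (twoSite i j n₁ n₂ p' q') =
      if p = p' ∧ q = q' then ((n₁ - p)! * p ! * ((n₂ - q)! * q !) : ℂ) else 0 := by
  classical
  split_ifs with h
  · obtain ⟨rfl, rfl⟩ := h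
    have h1 : pderiv (j, false) (1 : MvPolynomial (ι × Bool) ℂ) = 0 := by simp
    have h2 : pderiv (j, true) (X (j, false) ^ q * 1 : MvPolynomial (ι × Bool) ℂ) = 0 := by
      simp [Derivation.leibniz_pow]
    have h3 : pderiv (i, false) (X (j, true) ^ (n₂ - q) * (X (j, false) ^ q * 1) :
        MvPolynomial (ι × Bool) ℂ) = 0 := by
      simp [Derivation.leibniz_pow, pderiv_X, hij.symm]
    have h4 : pderiv (i, true) (X (i, false) ^ p * (X (j, true) ^ (n₂ - q) *
        (X (j, false) ^ q * 1)) : MvPolynomial (ι × Bool) ℂ) = 0 := by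
      simp [Derivation.leibniz_pow, pderiv_X, hij.symm]
    have h5 : twoSite i j n₁ n₂ p q = X (i, true) ^ (n₁ - p) * (X (i, false) ^ p *
        (X (j, true) ^ (n₂ - q) * (X (j, false) ^ q * 1))) := by
      rw [twoSite]; ring
    rw [h5, fockInner_self_pow_mul h4, fockInner_self_pow_mul h3, fockInner_self_pow_mul h2,
      fockInner_self_pow_mul h1]
    have : fockInner (1 : MvPolynomial (ι × Bool) ℂ) 1 = 1 := by
      simpa [factorialWeight] using fockInner_monomial_right (1 : MvPolynomial (ι × Bool) ℂ) 0 1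
    rw [this]; ring
  · rw [twoSite_eq_monomial, twoSite_eq_monomial, fockInner_monomial_right, coeff_monomial, if_neg]
    · simp
    · intro h'
      refine h ⟨?_, ?_⟩
      · simpa [hij, hij.symm] using DFunLike.congr_fun h' (i, false)
      · simpa [hij, hij.symm] using DFunLike.congr_fun h' (j, false)

theorem coupling_coeff_zero (i j : ι) {n₁ n₂ t : ℕ} (h₁ : t ≤ n₁) (h₂ : t ≤ n₂) :
    (coupling i j n₁ n₂ t).coeff 0 = ∑ k ∈ Finset.range (t + 1),
      ((-1) ^ k * t.choose k : ℂ) • twoSite i j n₁ n₂ k (t - k) := by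
  rw [coupling, Polynomial.mul_coeff_zero, Polynomial.mul_coeff_zero, Polynomial.coeff_C_zero,
    spinor_pow_coeff, spinor_pow_coeff, bond_pow, Finset.mul_sum, Finset.sum_mul]
  refine Finset.sum_congr rfl fun k hk => ?_
  simp only [Finset.mem_range] at hk
  rw [twoSite, twoSite, show n₁ - k = (n₁ - t) + (t - k) by omega,
    show n₂ - (t - k) = (n₂ - t) + k by omega, show t - (t - k) = k by omega]
  simp only [smul_eq_C_mul]
  simp
  ring

/-- The squared norm of the highest state of the multiplet. Number states are orthogonal. After
extraction of `t!² (n₁ - t)! (n₂ - t)!` the `k`-th term is `(n₁-k choose n₁-t) (n₂-t+k choose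
n₂-t)`, and the antidiagonal sum above applies. -/
theorem fockInner_coupling_coeff_zero {i j : ι} (hij : i ≠ j) {n₁ n₂ t : ℕ} (h₁ : t ≤ n₁)
    (h₂ : t ≤ n₂) :
    fockInner ((coupling i j n₁ n₂ t).coeff 0) ((coupling i j n₁ n₂ t).coeff 0) =
      (t ! * t ! * (n₁ - t)! * (n₂ - t)! * (n₁ + n₂ - t + 1).choose t : ℂ) := by
  rw [coupling_coeff_zero i j h₁ h₂]
  simp only [map_sum, LinearMap.sum_apply, fockInner_smul_smul, fockInner_twoSite hij]
  rw [Finset.sum_congr rfl (g := fun k => (t ! * t ! * (n₁ - t)! * (n₂ - t)! : ℂ) *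
    (((n₁ - k).choose (n₁ - t) * (n₂ - (t - k)).choose (n₂ - t) : ℕ) : ℂ))]
  · rw [← Finset.mul_sum, ← Nat.cast_sum]
    congr 2
    have h := sum_antidiagonal_choose_add_mul (n₁ - t) (n₂ - t) t
    rw [show n₁ - t + (n₂ - t) + 1 + t = n₁ + n₂ - t + 1 by omega,
      Finset.Nat.sum_antidiagonal_eq_sum_range_succ
        (fun x y => (n₁ - t + x).choose (n₁ - t) * (n₂ - t + y).choose (n₂ - t)),
      ← Finset.sum_range_reflect] at h
    rw [← Nat.choose_symm (by omega), show n₁ + n₂ - t + 1 - t = n₁ - t + (n₂ - t) + 1 by omega, ← h]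
    refine Finset.sum_congr rfl fun k hk => ?_
    simp only [Finset.mem_range] at hk
    congr 2 <;> omega
  · intro k hk
    simp only [Finset.mem_range] at hk
    rw [Finset.sum_eq_single_of_mem k (by simpa using hk), if_pos ⟨rfl, rfl⟩]
    · rw [show n₁ - t = n₁ - k - (t - k) by omega, Nat.choose_symm (by omega),
        show n₂ - t = n₂ - (t - k) - k by omega, Nat.choose_symm (by omega)]
      push_cast
      have hc : conj ((-1) ^ k * t.choose k : ℂ) = (-1) ^ k * t.choose k := by simp
      rw [hc, Nat.cast_choose ℂ (show k ≤ t by omega), Nat.cast_choose ℂ (show t - k ≤ n₁ - k by omega),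
        Nat.cast_choose ℂ (show k ≤ n₂ - (t - k) by omega)]
      have hsgn : ((-1 : ℂ) ^ k) * (-1) ^ k = 1 := by rw [← mul_pow]; simp
      have e1 : (((n₁ - k - (t - k))! : ℕ) : ℂ) ≠ 0 := by exact_mod_cast Nat.factorial_ne_zero _
      have e2 : (((n₂ - (t - k) - k)! : ℕ) : ℂ) ≠ 0 := by exact_mod_cast Nat.factorial_ne_zero _
      have e3 : ((k ! : ℕ) : ℂ) ≠ 0 := by exact_mod_cast Nat.factorial_ne_zero _
      have e4 : (((t - k)! : ℕ) : ℂ) ≠ 0 := by exact_mod_cast Nat.factorial_ne_zero _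
      field_simp
      linear_combination ((t ! : ℂ) ^ 2 * (n₁ - k)! * (n₂ - (t - k))!) * hsgn
    · intro l _ hl
      rw [if_neg (fun h => hl h.1)]; simp

/-- The normalized state of total spin `J = (n₁ + n₂) / 2 - t` and `S^z = J - r` of the spins
`n₁ / 2` at `i` and `n₂ / 2` at `j`. -/
def coupledState (i j : ι) (n₁ n₂ t r : ℕ) : MvPolynomial (ι × Bool) ℂ :=
  (couplingNorm n₁ n₂ t r : ℂ) • (coupling i j n₁ n₂ t).coeff r

/-- The normalized number states of two sites. -/
def unitTwoSite (i j : ι) (n₁ n₂ p q : ℕ) : MvPolynomial (ι × Bool) ℂ :=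
  (√((n₁ - p)! * p ! * ((n₂ - q)! * q !)) : ℂ)⁻¹ • twoSite i j n₁ n₂ p q

theorem sqrt_factorials_ne_zero (n₁ n₂ p q : ℕ) :
    ((√((n₁ - p)! * p ! * ((n₂ - q)! * q !)) : ℝ) : ℂ) ≠ 0 := by
  rw [Complex.ofReal_ne_zero]; positivity

theorem twoSite_eq_smul (i j : ι) (n₁ n₂ p q : ℕ) : twoSite i j n₁ n₂ p q =
    (√((n₁ - p)! * p ! * ((n₂ - q)! * q !)) : ℂ) • unitTwoSite i j n₁ n₂ p q := by
  rw [unitTwoSite, smul_inv_smul₀ (sqrt_factorials_ne_zero _ _ _ _)]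

theorem coupledState_eq_sum (i j : ι) {n₁ n₂ t : ℕ} (h₁ : t ≤ n₁) (h₂ : t ≤ n₂) (r : ℕ) :
    coupledState i j n₁ n₂ t r = ∑ p ∈ Finset.range (n₁ + 1), ∑ q ∈ Finset.range (n₂ + 1),
      (clebschGordan n₁ p n₂ q t r : ℂ) • unitTwoSite i j n₁ n₂ p q := by
  rw [coupledState, coupling_coeff i j h₁ h₂, Finset.smul_sum]
  refine Finset.sum_congr rfl fun p _ => ?_
  rw [Finset.smul_sum]
  refine Finset.sum_congr rfl fun q _ => ?_
  rw [clebschGordan_eq h₁ h₂, twoSite_eq_smul, smul_smul, smul_smul]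
  congr 1
  push_cast; ring

theorem fockInner_unitTwoSite {i j : ι} (hij : i ≠ j) {n₁ n₂ : ℕ} (p q p' q' : ℕ) :
    fockInner (unitTwoSite i j n₁ n₂ p q) (unitTwoSite i j n₁ n₂ p' q') =
      if p = p' ∧ q = q' then 1 else 0 := by
  rw [unitTwoSite, unitTwoSite, fockInner_smul_smul, fockInner_twoSite hij]
  split_ifs with h
  · obtain ⟨rfl, rfl⟩ := h
    have h0 := sqrt_factorials_ne_zero n₁ n₂ p q
    have h1 : ((√((n₁ - p)! * p ! * ((n₂ - q)! * q !)) : ℝ) : ℂ) ^ 2 =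
        (n₁ - p)! * p ! * ((n₂ - q)! * q !) := by
      rw [← Complex.ofReal_pow, Real.sq_sqrt (by positivity)]; push_cast; rfl
    rw [← h1, map_inv₀, Complex.conj_ofReal, ← mul_inv, ← pow_two, inv_mul_cancel₀ (pow_ne_zero 2 h0)]
  · simp

/-- The factor after `couplingNorm ^ 2` is the squared norm of the `r`-th coefficient of `coupling`:
the ladder binomial times the norm of the highest state. -/
theorem couplingNorm_sq_mul {n₁ n₂ t r : ℕ} (h₁ : t ≤ n₁) (h₂ : t ≤ n₂)
    (hr : r ≤ n₁ + n₂ - 2 * t) : couplingNorm n₁ n₂ t r ^ 2 * ((n₁ + n₂ - 2 * t).choose r *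
      (t ! * t ! * (n₁ - t)! * (n₂ - t)! * (n₁ + n₂ - t + 1).choose t)) = 1 := by
  have h3 : (n₁ + n₂ - 2 * t + 1 : ℝ) = ((n₁ + n₂ - 2 * t + 1 : ℕ) : ℝ) := by
    push_cast [show 2 * t ≤ n₁ + n₂ by omega]; ring
  have h4 : ((n₁ + n₂ - 2 * t + 1)! : ℝ) = ((n₁ + n₂ - 2 * t + 1 : ℕ) : ℝ) * (n₁ + n₂ - 2 * t)! := by
    rw [Nat.factorial_succ]; push_cast; ring
  rw [couplingNorm, h3, div_pow, mul_pow, Real.sq_sqrt (by positivity), Real.sq_sqrt (by positivity),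
    Nat.cast_choose ℝ hr, Nat.cast_choose ℝ (show t ≤ n₁ + n₂ - t + 1 by omega),
    show n₁ + n₂ - t + 1 - t = n₁ + n₂ - 2 * t + 1 by omega, h4]
  have h5 : ((n₁ + n₂ - 2 * t + 1 : ℕ) : ℝ) ≠ 0 := by positivity
  field_simp

/-- For the total spin of `{i, j}`, `r` separates the states within a ladder and the dimension
separates different `t`. -/
theorem fockInner_coupledState {i j : ι} (hij : i ≠ j) {n₁ n₂ t t' r r' : ℕ} (h₁ : t ≤ n₁)
    (h₂ : t ≤ n₂) (h₁' : t' ≤ n₁) (h₂' : t' ≤ n₂) (hr : r ≤ n₁ + n₂ - 2 * t) :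
    fockInner (coupledState i j n₁ n₂ t r) (coupledState i j n₁ n₂ t' r') =
      if t = t' ∧ r = r' then 1 else 0 := by
  classical
  rw [coupledState, coupledState, fockInner_smul_smul]
  have hl := isLadder_coupling (T := {i, j}) (i := i) (j := j) (by simp) (by simp) h₁ h₂
  have hl' := isLadder_coupling (T := {i, j}) (i := i) (j := j) (by simp) (by simp) h₁' h₂'
  split_ifs with h
  · obtain ⟨rfl, rfl⟩ := h
    rw [hl.fockInner_same hl, fockInner_coupling_coeff_zero hij h₁ h₂, Complex.conj_ofReal,
      ← pow_two]
    exact_mod_cast couplingNorm_sq_mul h₁ h₂ hr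
  · by_cases ht : t = t'
    · subst ht
      rw [hl.fockInner_eq_zero_of_ne hl' (fun hr => h ⟨rfl, hr⟩)]; simp
    · rw [hl.fockInner_eq_zero_of_dim_ne hl' (by omega)]; simp

/-- The labels `(t, r)` of the coupled states of the spins `n₁ / 2` and `n₂ / 2`. -/
def couplingLabels (n₁ n₂ : ℕ) : Finset ((_ : ℕ) × ℕ) :=
  (Finset.range (min n₁ n₂ + 1)).sigma fun t => Finset.range (n₁ + n₂ - 2 * t + 1)

theorem mem_couplingLabels {n₁ n₂ : ℕ} {a : (_ : ℕ) × ℕ} :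
    a ∈ couplingLabels n₁ n₂ ↔ (a.1 ≤ n₁ ∧ a.1 ≤ n₂) ∧ a.2 ≤ n₁ + n₂ - 2 * a.1 := by
  simp [couplingLabels]

theorem card_couplingLabels (n₁ n₂ : ℕ) : (couplingLabels n₁ n₂).card = (n₁ + 1) * (n₂ + 1) := by
  have h : ∀ c, c ≤ n₁ → c ≤ n₂ → ∑ t ∈ Finset.range (c + 1), (n₁ + n₂ - 2 * t + 1) =
      (c + 1) * (n₁ + n₂ - c + 1) := by
    intro c
    induction c with
    | zero => simp
    | succ c ih =>
      intro h1 h2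
      rw [Finset.sum_range_succ, ih (by omega) (by omega)]
      obtain ⟨x, rfl⟩ := Nat.exists_eq_add_of_le h1
      obtain ⟨y, rfl⟩ := Nat.exists_eq_add_of_le h2
      rw [show c + 1 + x + (c + 1 + y) - c = c + 2 + x + y by omega,
        show c + 1 + x + (c + 1 + y) - 2 * (c + 1) = x + y by omega,
        show c + 1 + x + (c + 1 + y) - (c + 1) = c + 1 + x + y by omega]
      ring
  rw [couplingLabels, Finset.card_sigma]
  simp only [Finset.card_range]
  rw [h _ (min_le_left _ _) (min_le_right _ _)]
  rcases le_total n₁ n₂ with h | h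
  · rw [min_eq_left h, Nat.add_sub_cancel_left]
  · rw [min_eq_right h, Nat.add_sub_cancel, mul_comm]

theorem sum_clebschGordan_mul {n₁ n₂ : ℕ} {a b : (_ : ℕ) × ℕ} (ha : a ∈ couplingLabels n₁ n₂)
    (hb : b ∈ couplingLabels n₁ n₂) :
    ∑ p ∈ Finset.range (n₁ + 1), ∑ q ∈ Finset.range (n₂ + 1),
      clebschGordan n₁ p n₂ q a.1 a.2 * clebschGordan n₁ p n₂ q b.1 b.2 =
      if a = b then 1 else 0 := by
  obtain ⟨⟨h1, h2⟩, h3⟩ := mem_couplingLabels.1 ha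
  obtain ⟨⟨h1', h2'⟩, h3'⟩ := mem_couplingLabels.1 hb
  -- The coefficients do not refer to any sites, so the two elements of `Bool` serve as sites.
  have h := fockInner_coupledState (Bool.false_ne_true) (r' := b.2) h1 h2 h1' h2' h3
  rw [coupledState_eq_sum _ _ h1 h2, coupledState_eq_sum _ _ h1' h2', ← Finset.sum_product',
    ← Finset.sum_product'] at h
  simp only [map_sum, LinearMap.sum_apply, map_smulₛₗ, LinearMap.smul_apply,
    fockInner_unitTwoSite Bool.false_ne_true, ← Prod.ext_iff, Complex.conj_ofReal, smul_eq_mul,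
    mul_ite, mul_one, mul_zero, RingHom.id_apply] at h
  rw [Finset.sum_congr rfl (g := fun x : ℕ × ℕ => ((clebschGordan n₁ x.1 n₂ x.2 a.1 a.2 *
    clebschGordan n₁ x.1 n₂ x.2 b.1 b.2 : ℝ) : ℂ))] at h
  · rw [← Finset.sum_product']
    have h4 : (a = b) ↔ (a.1 = b.1 ∧ a.2 = b.2) := by
      rw [Sigma.ext_iff]; simp
    simp only [h4]
    rw [← Complex.ofReal_sum] at h
    split_ifs at h ⊢ <;> exact_mod_cast h
  · intro x hx
    rw [Finset.sum_eq_single_of_mem x hx]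
    · simp; ring
    · intro y _ hy
      simp [hy]

/-- There are as many labels `(t, r)` as pairs `(p, q)`, so the matrix with orthonormal rows is
square and its columns are orthonormal too. -/
theorem sum_clebschGordan_mul' {n₁ n₂ p q p' q' : ℕ} (hp : p ≤ n₁) (hq : q ≤ n₂) (hp' : p' ≤ n₁)
    (hq' : q' ≤ n₂) :
    ∑ a ∈ couplingLabels n₁ n₂,
      clebschGordan n₁ p n₂ q a.1 a.2 * clebschGordan n₁ p' n₂ q' a.1 a.2 =
      if p = p' ∧ q = q' then 1 else 0 := by
  let P : Finset (ℕ × ℕ) := Finset.range (n₁ + 1) ×ˢ Finset.range (n₂ + 1)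
  let A : Matrix (couplingLabels n₁ n₂) P ℝ :=
    fun a x => clebschGordan n₁ x.1.1 n₂ x.1.2 a.1.1 a.1.2
  have hA : A * A.transpose = 1 := by
    ext a b
    rw [Matrix.mul_apply, Matrix.one_apply]
    have := sum_clebschGordan_mul a.2 b.2
    rw [← Finset.sum_product', ← Finset.sum_coe_sort] at this
    simp only [← Subtype.ext_iff] at this
    exact this
  replace hA := (Matrix.mul_eq_one_comm_of_card_eq _ _ _ (by simp [P, card_couplingLabels])).1 hA
  have := congrFun (congrFun hA ⟨(p, q), by simp [P]; omega⟩) ⟨(p', q'), by simp [P]; omega⟩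
  rw [Matrix.mul_apply, Matrix.one_apply] at this
  rw [← Finset.sum_coe_sort]
  simpa [A, Matrix.transpose_apply, Matrix.transpose] using this

theorem unitTwoSite_eq_sum (i j : ι) {n₁ n₂ p q : ℕ} (hp : p ≤ n₁) (hq : q ≤ n₂) :
    unitTwoSite i j n₁ n₂ p q = ∑ a ∈ couplingLabels n₁ n₂,
      (clebschGordan n₁ p n₂ q a.1 a.2 : ℂ) • coupledState i j n₁ n₂ a.1 a.2 := by
  rw [Finset.sum_congr rfl (g := fun a => ∑ x ∈ Finset.range (n₁ + 1) ×ˢ Finset.range (n₂ + 1),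
    ((clebschGordan n₁ p n₂ q a.1 a.2 * clebschGordan n₁ x.1 n₂ x.2 a.1 a.2 : ℝ) : ℂ) •
      unitTwoSite i j n₁ n₂ x.1 x.2)]
  · rw [Finset.sum_comm]
    simp only [← Finset.sum_smul, ← Complex.ofReal_sum]
    rw [Finset.sum_eq_single_of_mem (p, q) (by simp; omega)]
    · rw [sum_clebschGordan_mul' hp hq hp hq]; simp
    · intro x hx hne
      simp only [Finset.mem_product, Finset.mem_range] at hx
      rw [sum_clebschGordan_mul' hp hq (by omega) (by omega), if_neg]
      · simp
      · rintro ⟨rfl, rfl⟩; exact hne rfl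
  · intro a ha
    obtain ⟨⟨h1, h2⟩, _⟩ := mem_couplingLabels.1 ha
    rw [coupledState_eq_sum i j h1 h2, ← Finset.sum_product', Finset.smul_sum]
    refine Finset.sum_congr rfl fun x _ => ?_
    rw [smul_smul]; push_cast; rfl

end Orthonormality

/-! ### Fock states and spin states -/

section ToSpin

variable {L : ℕ} (s : Fin L → ℕ)

theorem occupation_true (x : Config s) (i : Fin L) : occupation s x (i, true) = x i := by
  simp [occupation]

theorem occupation_false (x : Config s) (i : Fin L) :
    occupation s x (i, false) = s i - x i := by
  simp [occupation]

theorem occupation_injective : Function.Injective (occupation s) := fun x y h => by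
  funext i
  apply Fin.ext
  rw [← occupation_true, h, occupation_true]

theorem exists_occupation {α : (Fin L × Bool) →₀ ℕ}
    (h : ∀ i, α (i, true) + α (i, false) = s i) : ∃ x, occupation s x = α := by
  refine ⟨fun i => ⟨α (i, true), by have := h i; omega⟩, ?_⟩
  ext ⟨i, β⟩
  cases β
  · rw [occupation_false]; have := h i; simp only; omega
  · rw [occupation_true]

theorem occupation_add (x : Config s) (i : Fin L) :
    occupation s x (i, true) + occupation s x (i, false) = s i := by
  rw [occupation_true, occupation_false]; have := (x i).2; omega

/-- The squared norm of the monomial whose normalization is the basis state `x`. -/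
def configWeight (x : Config s) : ℝ := ∏ i, ((x i : ℕ)! * (s i - (x i : ℕ))! : ℝ)

theorem configWeight_pos (x : Config s) : 0 < configWeight s x :=
  Finset.prod_pos fun _ _ => by positivity

theorem factorialWeight_occupation (x : Config s) :
    factorialWeight (occupation s x) = (configWeight s x : ℂ) := by
  rw [factorialWeight, Finsupp.prod_fintype _ _ (by simp), Fintype.prod_prod_type, configWeight]
  push_cast
  refine Finset.prod_congr rfl fun i _ => ?_
  rw [Fintype.prod_bool, occupation_true, occupation_false]

theorem toSpin_apply (p : Fock L) (x : Config s) :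
    toSpin s p x = p.coeff (occupation s x) * (√(configWeight s x) : ℂ) := rfl

/-- `toSpin` as a linear map. -/
def toSpinLin : Fock L →ₗ[ℂ] SpinSpace s where
  toFun := toSpin s
  map_add' p q := by ext x; simp [toSpin_apply, add_mul]
  map_smul' c p := by ext x; simp [toSpin_apply, mul_assoc]

theorem toSpinLin_apply (p : Fock L) : toSpinLin s p = toSpin s p := rfl

variable {s}

/-- The square roots in `toSpin` multiply to the weight of the monomial. The constraint on `q`
suffices, because monomials of `p` outside the support of `q` do not contribute. -/
theorem inner_toSpin {q : Fock L} (hq : HasSpins s q) (p : Fock L) :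
    inner ℂ (toSpin s p) (toSpin s q) = fockInner p q := by
  classical
  have h : ∑ α ∈ Finset.univ.image (occupation s),
      conj (p.coeff α) * q.coeff α * factorialWeight α = fockInner p q := by
    rw [fockInner_eq_sum]
    refine (Finset.sum_subset (fun α hα => ?_) fun α _ hα => ?_).symm
    · obtain ⟨x, rfl⟩ := exists_occupation s (hq α hα)
      simp
    · simp [notMem_support_iff.1 hα]
  rw [← h, Finset.sum_image fun x _ y _ hxy => occupation_injective s hxy, PiLp.inner_apply]
  refine Finset.sum_congr rfl fun x _ => ?_
  rw [RCLike.inner_apply, toSpin_apply, toSpin_apply, factorialWeight_occupation, map_mul,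
    Complex.conj_ofReal]
  have := Real.mul_self_sqrt (configWeight_pos s x).le
  have h2 : (√(configWeight s x) : ℂ) * √(configWeight s x) = configWeight s x := by
    exact_mod_cast this
  linear_combination conj (p.coeff (occupation s x)) * q.coeff (occupation s x) * h2

theorem toSpin_eq_zero {p : Fock L} (hp : HasSpins s p) (h : toSpin s p = 0) : p = 0 :=
  fockInner_self_eq_zero (by rw [← inner_toSpin hp, h, inner_zero_left])

theorem exists_toSpin_eq (v : SpinSpace s) : ∃ p, HasSpins s p ∧ toSpin s p = v := by
  classical
  refine ⟨∑ x, monomial (occupation s x) (v x / √(configWeight s x) : ℂ), ?_, ?_⟩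
  · intro α hα
    rw [mem_support_iff, coeff_sum] at hα
    obtain ⟨x, _, hx⟩ := Finset.exists_ne_zero_of_sum_ne_zero hα
    rw [coeff_monomial] at hx
    split_ifs at hx with h
    · rw [← h]; exact occupation_add s x
    · exact absurd rfl hx
  · ext x
    rw [toSpin_apply, coeff_sum, Finset.sum_eq_single_of_mem x (Finset.mem_univ _)]
    · rw [coeff_monomial, if_pos rfl, div_mul_cancel₀]
      exact Complex.ofReal_ne_zero.2 (Real.sqrt_pos.2 (configWeight_pos s x)).ne'
    · intro y _ hy
      rw [coeff_monomial, if_neg (fun h => hy (occupation_injective s h))]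

/-! ### Grading by the numbers of bosons at the sites -/

/-- The multidegree of a mode: one boson at its site. -/
def siteDegree (c : Fin L × Bool) : Fin L → ℕ := Pi.single c.1 1

theorem weight_siteDegree (α : (Fin L × Bool) →₀ ℕ) (i : Fin L) :
    Finsupp.weight siteDegree α i = α (i, true) + α (i, false) := by
  rw [Finsupp.weight_apply, Finsupp.sum_fintype _ _ (by simp), Fintype.sum_prod_type,
    Finset.sum_apply, Finset.sum_eq_single_of_mem i (Finset.mem_univ _)]
  · simp [siteDegree]
  · intro j _ hj
    simp [siteDegree, hj]

theorem hasSpins_iff {p : Fock L} : HasSpins s p ↔ IsWeightedHomogeneous siteDegree p s := by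
  refine ⟨fun h α hα => funext fun i => ?_, fun h α hα i => ?_⟩
  · rw [weight_siteDegree, h α (mem_support_iff.2 hα)]
  · rw [← weight_siteDegree, h (mem_support_iff.1 hα)]

theorem isWeightedHomogeneous_bond (i j : Fin L) : IsWeightedHomogeneous siteDegree
    (bond i j : Fock L) (Pi.single i 1 + Pi.single j 1) :=
  ((isWeightedHomogeneous_X ℂ siteDegree (i, true)).mul (isWeightedHomogeneous_X ℂ _ (j, false))).sub
    ((isWeightedHomogeneous_X ℂ siteDegree (i, false)).mul (isWeightedHomogeneous_X ℂ _ (j, true)))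

theorem isWeightedHomogeneous_twoSite (i j : Fin L) {n₁ n₂ p q : ℕ} (hp : p ≤ n₁) (hq : q ≤ n₂) :
    IsWeightedHomogeneous siteDegree (twoSite i j n₁ n₂ p q : Fock L)
      (n₁ • Pi.single i 1 + n₂ • Pi.single j 1) := by
  have h := ((((isWeightedHomogeneous_X ℂ siteDegree (i, true)).pow (n₁ - p)).mul
    ((isWeightedHomogeneous_X ℂ siteDegree (i, false)).pow p))).mul
    (((isWeightedHomogeneous_X ℂ siteDegree (j, true)).pow (n₂ - q)).mul
    ((isWeightedHomogeneous_X ℂ siteDegree (j, false)).pow q))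
  simp only [siteDegree, ← add_smul, Nat.sub_add_cancel hp, Nat.sub_add_cancel hq] at h
  exact h

/-- The component with `s i` bosons at each site `i`. -/
def spinComponent (s : Fin L → ℕ) : Fock L →ₗ[ℂ] Fock L := weightedHomogeneousComponent siteDegree s

theorem spinComponent_hasSpins (p : Fock L) : HasSpins s (spinComponent s p) :=
  hasSpins_iff.2 (weightedHomogeneousComponent_isWeightedHomogeneous s p)

theorem spinComponent_of_hasSpins {p : Fock L} (hp : HasSpins s p) : spinComponent s p = p :=
  (hasSpins_iff.1 hp).weightedHomogeneousComponent_same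

theorem toSpin_spinComponent (p : Fock L) : toSpin s (spinComponent s p) = toSpin s p := by
  classical
  ext x
  rw [toSpin_apply, toSpin_apply, spinComponent, coeff_weightedHomogeneousComponent, if_pos]
  funext i
  rw [weight_siteDegree, occupation_add]

/-- Lifts equalities of spin vectors to polynomials: `toSpin` is injective on admissible polynomials
and discards the other multidegrees. -/
theorem eq_spinComponent_of_toSpin_eq {p q : Fock L} (hp : HasSpins s p)
    (h : toSpin s p = toSpin s q) : p = spinComponent s q := by
  have h2 : HasSpins s (p - spinComponent s q) :=
    hasSpins_iff.2 ((hasSpins_iff.1 hp).sub (hasSpins_iff.1 (spinComponent_hasSpins q)))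
  refine sub_eq_zero.1 (toSpin_eq_zero h2 ?_)
  rw [← toSpinLin_apply, map_sub, toSpinLin_apply, toSpinLin_apply, toSpin_spinComponent, h,
    sub_self]

/-- Serves to make the cofactor in a divisibility relation homogeneous. -/
theorem spinComponent_mul {p : Fock L} {n : Fin L → ℕ} (hp : IsWeightedHomogeneous siteDegree p n)
    (q : Fock L) : spinComponent (n + s) (p * q) = p * spinComponent s q := by
  classical
  induction q using MvPolynomial.induction_on' with
  | add f g hf hg => rw [mul_add, map_add, hf, hg, map_add, mul_add]
  | monomial α a =>
    have hm := isWeightedHomogeneous_monomial (R := ℂ) siteDegree α a rfl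
    have hpm := hp.mul hm
    by_cases h : Finsupp.weight siteDegree α = s
    · rw [h] at hm hpm
      rw [spinComponent_of_hasSpins (hasSpins_iff.2 hm), spinComponent_of_hasSpins (hasSpins_iff.2 hpm)]
    · rw [spinComponent, spinComponent, hm.weightedHomogeneousComponent_ne _ (Ne.symm h),
        hpm.weightedHomogeneousComponent_ne, mul_zero]
      simpa using Ne.symm h

/-! ### Spin operators -/

theorem occupation_shift {x y : Config s} {j : Fin L} (hj : (x j : ℕ) = y j + 1)
    (h : ∀ i, i ≠ j → x i = y i) :
    occupation s x + Finsupp.single (j, false) 1 = occupation s y + Finsupp.single (j, true) 1 := by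
  classical
  ext ⟨i, β⟩
  by_cases hi : i = j
  · subst hi
    have := (x i).2
    cases β <;> simp [occupation_true, occupation_false] <;> omega
  · cases β <;> simp [occupation_true, occupation_false, h i hi, Ne.symm hi]

theorem configWeight_shift {x y : Config s} {j : Fin L} (hj : (x j : ℕ) = y j + 1)
    (h : ∀ i, i ≠ j → x i = y i) :
    ((s j : ℝ) - (y j : ℕ)) * configWeight s x = ((y j : ℕ) + 1) * configWeight s y := by
  have h1 := factorialWeight_add_single (occupation s x) (j, false)
  have h2 := factorialWeight_add_single (occupation s y) (j, true)
  rw [occupation_shift hj h, h2, factorialWeight_occupation, factorialWeight_occupation,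
    occupation_true, occupation_false] at h1
  have h3 : s j = (s j - (x j : ℕ)) + 1 + y j := by have := (x j).2; omega
  have h4 : (s j : ℝ) - (y j : ℕ) = ((s j - (x j : ℕ) : ℕ) : ℝ) + 1 := by
    rw [sub_eq_iff_eq_add]; exact_mod_cast h3
  rw [h4]
  exact_mod_cast h1.symm

/-- The matrix element of `S⁺` is the geometric mean of the exponents `s j - y j` and `y j + 1`,
which the derivatives in `b` and `a` bring down. The norms of the two number states account for the
difference. -/
theorem spinPlus_factor {x y : Config s} {j : Fin L} (hj : (x j : ℕ) = y j + 1)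
    (h : ∀ i, i ≠ j → x i = y i) :
    √(((y j : ℕ) + 1 : ℝ) * ((s j : ℝ) - (y j : ℕ))) * √(configWeight s y) =
        ((s j : ℝ) - (y j : ℕ)) * √(configWeight s x) ∧
    √(((y j : ℕ) + 1 : ℝ) * ((s j : ℝ) - (y j : ℕ))) * √(configWeight s x) =
        ((y j : ℕ) + 1 : ℝ) * √(configWeight s y) := by
  have h0 : (0 : ℝ) ≤ (s j : ℝ) - (y j : ℕ) := by
    have := (y j).2
    rw [sub_nonneg]; exact_mod_cast (by omega : (y j : ℕ) ≤ s j)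
  have h1 : (0 : ℝ) ≤ (y j : ℕ) + 1 := by positivity
  have hs := configWeight_shift hj h
  constructor
  · rw [← Real.sqrt_mul (by positivity), mul_comm _ ((s j : ℝ) - _), mul_assoc, ← hs, ← mul_assoc,
      ← pow_two, Real.sqrt_mul (by positivity), Real.sqrt_sq h0]
  · rw [← Real.sqrt_mul (by positivity), mul_assoc, hs, ← mul_assoc,
      ← pow_two, Real.sqrt_mul (by positivity), Real.sqrt_sq h1]

theorem hop_singleton (j : Fin L) (β : Bool) (f : Fock L) :
    hop {j} β f = X (j, β) * pderiv (j, !β) f := by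
  rw [hop_apply, Finset.sum_singleton]

theorem toEuclideanLin_apply (A : Matrix (Config s) (Config s) ℂ) (v : SpinSpace s) (x : Config s) :
    Matrix.toEuclideanLin A v x = ∑ y, A x y * v y := rfl

theorem toSpin_hop_true (j : Fin L) (f : Fock L) :
    toSpin s (hop {j} true f) = Matrix.toEuclideanLin (spinPlus s j) (toSpin s f) := by
  classical
  ext x
  rw [toEuclideanLin_apply, toSpin_apply, hop_singleton, coeff_X_mul', Bool.not_true]
  by_cases hx : (x j : ℕ) = 0
  · rw [if_neg (by simp [occupation_true, hx]), zero_mul, eq_comm]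
    exact Finset.sum_eq_zero fun y _ => by rw [spinPlus, if_neg (by omega), zero_mul]
  · have hlt := (x j).2
    let y : Config s := Function.update x j ⟨x j - 1, by omega⟩
    have hj : (x j : ℕ) = y j + 1 := by simp [y]; omega
    have hne : ∀ i, i ≠ j → x i = y i := fun i hi => by simp [y, hi]
    have ho := occupation_shift hj hne
    rw [if_pos (by simp [occupation_true, hx]), coeff_pderiv, Finset.sum_eq_single_of_mem y
      (Finset.mem_univ _)]
    · have h1 : occupation s x - Finsupp.single (j, true) 1 + Finsupp.single (j, false) 1 =
          occupation s y := by
        rw [tsub_add_eq_add_tsub (Finsupp.single_le_iff.2 (by rw [occupation_true]; omega)), ho,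
          add_tsub_cancel_right]
      have h2 : (((occupation s x - Finsupp.single (j, true) 1 : (Fin L × Bool) →₀ ℕ) (j, false) : ℕ) : ℂ) + 1 =
          (s j : ℂ) - (y j : ℕ) := by
        rw [eq_sub_iff_add_eq]
        simp only [Finsupp.tsub_apply, occupation_false]
        simp only [Finsupp.single_apply, Prod.mk.injEq, Bool.true_eq_false, and_false, if_false]
        exact_mod_cast (by omega : s j - (x j : ℕ) - 0 + 1 + (y j : ℕ) = s j)
      rw [h1, h2, toSpin_apply, spinPlus, if_pos ⟨hj, hne⟩]
      have := congrArg (fun r : ℝ => (r : ℂ)) (spinPlus_factor hj hne).1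
      push_cast at this
      linear_combination (-coeff (occupation s y) f) * this
    · intro z _ hz
      rw [spinPlus, if_neg, zero_mul]
      rintro ⟨h1, h2⟩
      refine hz (funext fun i => ?_)
      by_cases hi : i = j
      · subst hi; exact Fin.ext (by omega)
      · rw [← h2 i hi, hne i hi]

theorem toSpin_hop_false (j : Fin L) (f : Fock L) :
    toSpin s (hop {j} false f) = Matrix.toEuclideanLin (spinMinus s j) (toSpin s f) := by
  classical
  ext y
  rw [toEuclideanLin_apply, toSpin_apply, hop_singleton, coeff_X_mul', Bool.not_false]
  by_cases hy : (y j : ℕ) = s j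
  · rw [if_neg (by simp [occupation_false, hy]), zero_mul, eq_comm]
    exact Finset.sum_eq_zero fun x _ => by
      have := (x j).2
      rw [spinMinus, Matrix.conjTranspose_apply, spinPlus, if_neg (by omega), star_zero, zero_mul]
  · have hlt := (y j).2
    let x : Config s := Function.update y j ⟨y j + 1, by omega⟩
    have hj : (x j : ℕ) = y j + 1 := by simp [x]
    have hne : ∀ i, i ≠ j → x i = y i := fun i hi => by simp [x, hi]
    have ho := occupation_shift hj hne
    rw [if_pos (by simp [occupation_false]; omega), coeff_pderiv, Finset.sum_eq_single_of_mem x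
      (Finset.mem_univ _)]
    · have h1 : occupation s y - Finsupp.single (j, false) 1 + Finsupp.single (j, true) 1 =
          occupation s x := by
        rw [tsub_add_eq_add_tsub (Finsupp.single_le_iff.2 (by rw [occupation_false]; omega)), ← ho,
          add_tsub_cancel_right]
      have h2 : (((occupation s y - Finsupp.single (j, false) 1 : (Fin L × Bool) →₀ ℕ) (j, true) : ℕ) : ℂ) + 1 =
          (y j : ℕ) + 1 := by
        simp [Finsupp.tsub_apply, occupation_true]
      rw [h1, h2, toSpin_apply, spinMinus, Matrix.conjTranspose_apply, spinPlus, if_pos ⟨hj, hne⟩]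
      have := congrArg (fun r : ℝ => (r : ℂ)) (spinPlus_factor hj hne).2
      push_cast at this
      rw [RCLike.star_def, Complex.conj_ofReal]
      linear_combination (-coeff (occupation s x) f) * this
    · intro z _ hz
      rw [spinMinus, Matrix.conjTranspose_apply, spinPlus, if_neg, star_zero, zero_mul]
      rintro ⟨h1, h2⟩
      refine hz (funext fun i => ?_)
      by_cases hi : i = j
      · subst hi; exact Fin.ext (by omega)
      · rw [h2 i hi, hne i hi]

/-- The operator `2 S^z` of the sites in `T`. -/
def imbalance {ι : Type*} (T : Finset ι) :
    Derivation ℂ (MvPolynomial (ι × Bool) ℂ) (MvPolynomial (ι × Bool) ℂ) :=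
  ⁅hop T true, hop T false⁆

theorem coeff_X_mul_pderiv {σ : Type*} (c : σ) (f : MvPolynomial σ ℂ) (α : σ →₀ ℕ) :
    coeff α (X c * pderiv c f) = α c * coeff α f := by
  classical
  induction f using MvPolynomial.induction_on' with
  | add f g hf hg => simp only [map_add, mul_add, coeff_add, hf, hg]
  | monomial β a =>
    rw [X_mul_pderiv_monomial, ← Nat.cast_smul_eq_nsmul ℂ, coeff_smul, coeff_monomial, smul_eq_mul]
    split_ifs with h
    · rw [h]
    · simp

/-- The relation `[S⁺, S⁻] = 2 S^z`. A commutator of derivations is a derivation, so it is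
determined by its values on the variables. -/
theorem imbalance_eq {ι : Type*} (T : Finset ι) (f : MvPolynomial (ι × Bool) ℂ) : imbalance T f =
    ∑ i ∈ T, (X (i, true) * pderiv (i, true) f - X (i, false) * pderiv (i, false) f) := by
  classical
  have h : imbalance T = mkDerivation ℂ fun c : ι × Bool => if c.1 ∈ T then
      (if c.2 then X c else - X c : MvPolynomial (ι × Bool) ℂ) else 0 := by
    refine derivation_ext fun ⟨i, β⟩ => ?_
    rw [mkDerivation_X, imbalance, Derivation.commutator_apply]
    cases β <;> by_cases hi : i ∈ T <;> simp [hop_X, hi]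
  rw [h]
  induction f using MvPolynomial.induction_on with
  | C a => simp
  | add f g hf hg => simp only [map_add, mul_add, hf, hg, ← Finset.sum_add_distrib]
                     exact Finset.sum_congr rfl fun _ _ => by ring
  | mul_X f c hf =>
    obtain ⟨i, β⟩ := c
    rw [Derivation.leibniz, hf, mkDerivation_X]
    have h1 : ∀ j ∈ T, X (j, true) * pderiv (j, true) (f * X (i, β)) -
        X (j, false) * pderiv (j, false) (f * X (i, β)) = X (i, β) * (X (j, true) *
        pderiv (j, true) f - X (j, false) * pderiv (j, false) f) + (if i = j then
          f * (if β then X (i, β) else - X (i, β)) else 0) := by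
      intro j _
      simp only [pderiv_mul, pderiv_X]
      by_cases hij : i = j
      · subst hij
        cases β <;> simp <;> ring
      · simp [hij]; ring
    rw [Finset.sum_congr rfl h1, Finset.sum_add_distrib, ← Finset.mul_sum, Finset.sum_ite_eq]
    simp only [smul_eq_mul, mul_ite, mul_zero]
    rw [add_comm]

theorem toSpin_imbalance (j : Fin L) (f : Fock L) :
    toSpin s (imbalance {j} f) = (2 : ℂ) • Matrix.toEuclideanLin (spinZ s j) (toSpin s f) := by
  classical
  ext x
  rw [PiLp.smul_apply, toEuclideanLin_apply, Finset.sum_eq_single_of_mem x (Finset.mem_univ _),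
    toSpin_apply, toSpin_apply, imbalance_eq, Finset.sum_singleton, coeff_sub, coeff_X_mul_pderiv,
    coeff_X_mul_pderiv, occupation_true, occupation_false, spinZ, Matrix.diagonal_apply_eq,
    smul_eq_mul, Nat.cast_sub (by have := (x j).2; omega)]
  · ring
  · intro y _ hy
    rw [spinZ, Matrix.diagonal_apply_ne _ hy.symm, zero_mul]

end ToSpin

/-! ### The square of the total spin -/

section Casimir

variable {ι : Type*}

/-- The square of the total spin of the sites in `T`. -/
def casimir (T : Finset ι) : MvPolynomial (ι × Bool) ℂ →ₗ[ℂ] MvPolynomial (ι × Bool) ℂ :=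
  (1 / 2 : ℂ) • ((hop T true).toLinearMap ∘ₗ (hop T false).toLinearMap +
    (hop T false).toLinearMap ∘ₗ (hop T true).toLinearMap) +
  (1 / 4 : ℂ) • ((imbalance T).toLinearMap ∘ₗ (imbalance T).toLinearMap)

theorem casimir_apply (T : Finset ι) (f : MvPolynomial (ι × Bool) ℂ) : casimir T f =
    (1 / 2 : ℂ) • (hop T true (hop T false f) + hop T false (hop T true f)) +
      (1 / 4 : ℂ) • imbalance T (imbalance T f) := rfl

theorem imbalance_apply (T : Finset ι) (f : MvPolynomial (ι × Bool) ℂ) :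
    imbalance T f = hop T true (hop T false f) - hop T false (hop T true f) :=
  Derivation.commutator_apply f

/-- A derivation which kills `W` commutes with multiplication by `W`. Hence singlet factors do not
affect the total spin. -/
theorem IsSinglet.casimir_mul {T : Finset ι} {W : MvPolynomial (ι × Bool) ℂ} (hW : IsSinglet T W)
    (f : MvPolynomial (ι × Bool) ℂ) : casimir T (W * f) = W * casimir T f := by
  have h1 : ∀ β f, hop T β (W * f) = W * hop T β f := fun β f => by simp [hW β]
  have h2 : ∀ f, imbalance T (W * f) = W * imbalance T f := fun f => by
    simp only [imbalance_apply, h1, mul_sub]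
  simp only [casimir_apply, h1, h2, mul_add, mul_smul_comm, smul_add]

/-- The eigenvalue `J (J + 1)` of the square of a spin, where `J = d / 2`. -/
def spinSq (d : ℕ) : ℝ := d / 2 * (d / 2 + 1)

theorem IsLadder.casimir_coeff {T : Finset ι} {d : ℕ} {f : Polynomial (MvPolynomial (ι × Bool) ℂ)}
    (hf : IsLadder T d f) (r : ℕ) : casimir T (f.coeff r) = (spinSq d : ℂ) • f.coeff r := by
  have h1 : hop T true (hop T false (f.coeff r)) = ((r + 1) * (d - r) : ℂ) • f.coeff r := by
    rw [hf.lower, Derivation.map_smul, hf.raise_succ, smul_smul]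
  have h2 : hop T false (hop T true (f.coeff r)) = (r * (d - r + 1) : ℂ) • f.coeff r := by
    cases r with
    | zero => simp [hf.raise_zero]
    | succ r =>
      rw [hf.raise_succ, Derivation.map_smul, hf.lower, smul_smul]
      congr 1; push_cast; ring
  have h3 : imbalance T (f.coeff r) = (d - 2 * r : ℂ) • f.coeff r := by
    rw [imbalance_apply, h1, h2, ← sub_smul]; congr 1; ring
  rw [casimir_apply, h1, h2, h3, Derivation.map_smul, h3, ← add_smul, smul_smul, smul_smul, smul_smul,
    ← add_smul]
  congr 1
  rw [spinSq]; push_cast; ring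

theorem spinSq_injective : Function.Injective spinSq := by
  intro a b h
  have h2 : ((a : ℝ) - b) * (a + b + 2) = 0 := by unfold spinSq at h; linear_combination 4 * h
  have h3 : (a : ℝ) + b + 2 ≠ 0 := by positivity
  have h4 := (mul_eq_zero.1 h2).resolve_right h3
  exact_mod_cast sub_eq_zero.1 h4

theorem hop_pair [DecidableEq ι] {i j : ι} (hij : i ≠ j) (β : Bool)
    (f : MvPolynomial (ι × Bool) ℂ) : hop {i, j} β f = hop {i} β f + hop {j} β f := by
  simp only [hop_apply, Finset.sum_pair hij, Finset.sum_singleton]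

theorem imbalance_pair [DecidableEq ι] {i j : ι} (hij : i ≠ j) (f : MvPolynomial (ι × Bool) ℂ) :
    imbalance {i, j} f = imbalance {i} f + imbalance {j} f := by
  simp only [imbalance_eq, Finset.sum_pair hij, Finset.sum_singleton]

end Casimir

/-! ### Bond spin projections and divisibility by powers of a valence bond -/

section BondProjection

variable {L : ℕ} {s : Fin L → ℕ}

theorem toSpin_add (f g : Fock L) : toSpin s (f + g) = toSpin s f + toSpin s g :=
  map_add (toSpinLin s) f g

theorem toSpin_smul (c : ℂ) (f : Fock L) : toSpin s (c • f) = c • toSpin s f :=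
  map_smul (toSpinLin s) c f

theorem toSpin_zero : toSpin s (0 : Fock L) = 0 := map_zero (toSpinLin s)

theorem toSpin_sum {κ : Type*} (t : Finset κ) (f : κ → Fock L) :
    toSpin s (∑ k ∈ t, f k) = ∑ k ∈ t, toSpin s (f k) := map_sum (toSpinLin s) f t

theorem toSpin_casimir {i j : Fin L} (hij : i ≠ j) (f : Fock L) : toSpin s (casimir {i, j} f) =
    Matrix.toEuclideanLin (bondSpinSq s i j) (toSpin s f) := by
  have hp : ∀ f, toSpin s (hop {i, j} true f) =
      Matrix.toEuclideanLin (spinPlus s i + spinPlus s j) (toSpin s f) := fun f => by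
    rw [hop_pair hij, toSpin_add, toSpin_hop_true, toSpin_hop_true, map_add, LinearMap.add_apply]
  have hm : ∀ f, toSpin s (hop {i, j} false f) =
      Matrix.toEuclideanLin (spinMinus s i + spinMinus s j) (toSpin s f) := fun f => by
    rw [hop_pair hij, toSpin_add, toSpin_hop_false, toSpin_hop_false, map_add, LinearMap.add_apply]
  have hz : ∀ f, toSpin s (imbalance {i, j} f) =
      (2 : ℂ) • Matrix.toEuclideanLin (spinZ s i + spinZ s j) (toSpin s f) := fun f => by
    rw [imbalance_pair hij, toSpin_add, toSpin_imbalance, toSpin_imbalance, map_add,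
      LinearMap.add_apply, smul_add]
  have hmul : ∀ (A B : Matrix (Config s) (Config s) ℂ) v, Matrix.toEuclideanLin (A * B) v =
      Matrix.toEuclideanLin A (Matrix.toEuclideanLin B v) := fun A B v => by
    simp only [Matrix.toLpLin_mul_same, LinearMap.coe_comp, Function.comp_apply]
  have hb : bondSpinSq s i j = (1 / 2 : ℂ) • ((spinPlus s i + spinPlus s j) *
      (spinMinus s i + spinMinus s j) + (spinMinus s i + spinMinus s j) *
      (spinPlus s i + spinPlus s j)) + (spinZ s i + spinZ s j) * (spinZ s i + spinZ s j) := rfl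
  rw [casimir_apply, hb, toSpin_add, toSpin_smul, toSpin_smul, toSpin_add, hp, hm, hm, hp, hz, hz]
  generalize spinPlus s i + spinPlus s j = P
  generalize spinMinus s i + spinMinus s j = Q
  generalize spinZ s i + spinZ s j = Z
  simp only [map_add, LinearMap.add_apply, map_smul, LinearMap.smul_apply, hmul, smul_smul]
  norm_num

theorem bondSpinSq_isSymmetric (i j : Fin L) :
    (Matrix.toEuclideanLin (bondSpinSq s i j)).IsSymmetric := by
  classical
  rw [Matrix.isSymmetric_toEuclideanLin_iff]
  have hz : ∀ i, (spinZ s i).conjTranspose = spinZ s i := fun i => by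
    rw [spinZ, Matrix.diagonal_conjTranspose]
    congr 1
    funext x
    simp
  simp only [Matrix.IsHermitian, bondSpinSq, spinMinus, Matrix.conjTranspose_add,
    Matrix.conjTranspose_smul, Matrix.conjTranspose_mul, Matrix.conjTranspose_conjTranspose, hz]
  simp

/-- The states of bond spin `d / 2`. -/
def bondEigenspace (s : Fin L → ℕ) (i j : Fin L) (d : ℕ) : Submodule ℂ (SpinSpace s) :=
  Module.End.eigenspace (Matrix.toEuclideanLin (bondSpinSq s i j)) ((spinSq d : ℝ) : ℂ)

theorem toSpin_mem_bondEigenspace {i j : Fin L} (hij : i ≠ j) {f : Fock L} {d : ℕ}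
    (h : casimir {i, j} f = (spinSq d : ℂ) • f) : toSpin s f ∈ bondEigenspace s i j d := by
  rw [bondEigenspace, Module.End.mem_eigenspace_iff, ← toSpin_casimir hij, h, toSpin_smul]

theorem bondProj_eq {i j : Fin L} {t : ℕ} (ht : 2 * t ≤ s i + s j) (v : SpinSpace s) :
    bondProj s i j ((s i : ℝ) / 2 + (s j : ℝ) / 2 - t) v =
      (bondEigenspace s i j (s i + s j - 2 * t)).starProjection v := by
  rw [bondProj, bondEigenspace, spinSq, Nat.cast_sub ht]
  have : ((s i : ℝ) / 2 + (s j : ℝ) / 2 - t) = ((s i + s j : ℕ) - (2 * t : ℕ) : ℝ) / 2 := by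
    push_cast; ring
  rw [this]
  rfl

theorem starProjection_bondEigenspace_of_ne {i j : Fin L} {d e : ℕ} (hde : d ≠ e) {v : SpinSpace s}
    (hv : v ∈ bondEigenspace s i j e) : (bondEigenspace s i j d).starProjection v = 0 := by
  rw [Submodule.starProjection_apply_eq_zero_iff, Submodule.mem_orthogonal]
  intro u hu
  have h := (bondSpinSq_isSymmetric (s := s) i j).orthogonalFamily_eigenspaces
  have hne : ((spinSq d : ℝ) : ℂ) ≠ ((spinSq e : ℝ) : ℂ) := fun h =>
    hde (spinSq_injective (Complex.ofReal_injective h))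
  exact h hne ⟨u, hu⟩ ⟨v, hv⟩

/-- A polynomial with spins `s i / 2`, `s j / 2` at `i ≠ j` is a sum of multiples of powers of the
valence bond which have definite bond spins. -/
def HasBondDecomposition (n₁ n₂ : ℕ) (i j : Fin L) (f : Fock L) : Prop :=
  ∃ g : ℕ → Fock L, f = ∑ t ∈ Finset.range (min n₁ n₂ + 1), g t ∧ ∀ t, t ≤ n₁ → t ≤ n₂ →
    bond i j ^ t ∣ g t ∧ casimir {i, j} (g t) = (spinSq (n₁ + n₂ - 2 * t) : ℂ) • g t

theorem HasBondDecomposition.sum {n₁ n₂ : ℕ} {i j : Fin L} {κ : Type*} {S : Finset κ}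
    {f : κ → Fock L} (h : ∀ k ∈ S, HasBondDecomposition n₁ n₂ i j (f k)) :
    HasBondDecomposition n₁ n₂ i j (∑ k ∈ S, f k) := by
  choose! g hg using h
  refine ⟨fun t => ∑ k ∈ S, g k t, ?_, fun t h1 h2 => ⟨?_, ?_⟩⟩
  · rw [Finset.sum_comm]; exact Finset.sum_congr rfl fun k hk => (hg k hk).1
  · exact Finset.dvd_sum fun k hk => ((hg k hk).2 t h1 h2).1
  · rw [map_sum, Finset.smul_sum]
    exact Finset.sum_congr rfl fun k hk => ((hg k hk).2 t h1 h2).2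

theorem coupling_coeff_eq_mul {ι : Type*} (i j : ι) (n₁ n₂ t r : ℕ) :
    (coupling i j n₁ n₂ t).coeff r =
      bond i j ^ t * (spinor i ^ (n₁ - t) * spinor j ^ (n₂ - t)).coeff r := by
  rw [coupling, mul_right_comm, Polynomial.coeff_mul_C, mul_comm]

/-- Number states are combinations of coupled states, and those labelled `t` are coefficients of
`coupling`, which contains the factor `bond i j ^ t`. -/
theorem hasBondDecomposition_twoSite_mul {i j : Fin L} {n₁ n₂ p q : ℕ} (hp : p ≤ n₁) (hq : q ≤ n₂)
    {R : Fock L} (hR : IsSinglet {i, j} R) :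
    HasBondDecomposition n₁ n₂ i j (R * twoSite i j n₁ n₂ p q) := by
  classical
  rw [twoSite_eq_smul, unitTwoSite_eq_sum i j hp hq, couplingLabels, Finset.sum_sigma,
    Finset.smul_sum, Finset.mul_sum]
  refine ⟨_, rfl, fun t h1 h2 => ⟨?_, ?_⟩⟩
  · refine Dvd.dvd.mul_left ?_ R
    rw [smul_eq_C_mul]
    refine Dvd.dvd.mul_left (Finset.dvd_sum fun r _ => ?_) _
    rw [coupledState, coupling_coeff_eq_mul, smul_smul, smul_eq_C_mul]
    exact Dvd.dvd.mul_left (Dvd.intro _ rfl) _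
  · have hl := isLadder_coupling (T := {i, j}) (i := i) (j := j) (by simp) (by simp) h1 h2
    rw [hR.casimir_mul, map_smul, map_sum, ← mul_smul_comm, smul_comm]
    congr 2
    rw [Finset.smul_sum]
    refine Finset.sum_congr rfl fun r _ => ?_
    simp only [coupledState, map_smul, hl.casimir_coeff]
    module

theorem HasSpins.hasBondDecomposition {f : Fock L} (hf : HasSpins s f) {i j : Fin L} (hij : i ≠ j) :
    HasBondDecomposition (s i) (s j) i j f := by
  classical
  rw [← support_sum_monomial_coeff f]
  refine HasBondDecomposition.sum fun α hα => ?_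
  have hi := hf α hα i
  have hj := hf α hα j
  -- The modes away from `i` and `j` form a singlet factor of the monomial. What remains is a
  -- two-site number state.
  let β : (Fin L × Bool) →₀ ℕ := α.filter fun c => c.1 ≠ i ∧ c.1 ≠ j
  have hβ : α = β + (Finsupp.single (i, true) (s i - α (i, false)) +
      Finsupp.single (i, false) (α (i, false)) + (Finsupp.single (j, true) (s j - α (j, false)) +
      Finsupp.single (j, false) (α (j, false)))) := by
    ext ⟨k, γ⟩
    by_cases h1 : k = i
    · subst h1
      cases γ
      · simp [β, hij]
      · simp [β, hij]; omega
    · by_cases h2 : k = j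
      · subst h2
        cases γ
        · simp [β, h1]
        · simp [β, h1]; omega
      · simp [β, h1, h2]
  have h : monomial α (f.coeff α) = monomial β (f.coeff α) *
      twoSite i j (s i) (s j) (α (i, false)) (α (j, false)) := by
    rw [twoSite_eq_monomial, monomial_mul, mul_one, ← hβ]
  rw [h]
  refine hasBondDecomposition_twoSite_mul (by omega) (by omega) fun γ => ?_
  rw [hop_pair hij, hop_singleton, hop_singleton, pderiv_monomial, pderiv_monomial]
  simp [β]

/-- The state `f` has no component of bond spin greater than `J₊ - m` if and only if it is a
multiple of the `m`-th power of the valence bond. -/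
theorem bondProj_eq_zero_iff {f : Fock L} (hf : HasSpins s f) {i j : Fin L} (hij : i ≠ j) {m : ℕ}
    (hmi : m ≤ s i) (hmj : m ≤ s j) :
    (∀ t < m, bondProj s i j ((s i : ℝ) / 2 + (s j : ℝ) / 2 - t) (toSpin s f) = 0) ↔
      bond i j ^ m ∣ f := by
  classical
  let n : Fin L → ℕ := m • (Pi.single i 1 + Pi.single j 1)
  have hb : IsWeightedHomogeneous siteDegree (bond i j ^ m : Fock L) n :=
    (isWeightedHomogeneous_bond i j).pow m
  have hn : ∃ s', s = n + s' := by
    refine ⟨s - n, (add_tsub_cancel_of_le fun k => ?_).symm⟩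
    by_cases h1 : k = i
    · subst h1; simpa [n, hij] using hmi
    · by_cases h2 : k = j
      · subst h2; simpa [n, h1] using hmj
      · simp [n, h1, h2]
  obtain ⟨s', hs'⟩ := hn
  have hni : s i = m + s' i := by rw [hs']; simp [n, hij]
  have hnj : s j = m + s' j := by rw [hs']; simp [n, hij.symm]
  constructor
  · intro h
    obtain ⟨g, hg, hg2⟩ := hf.hasBondDecomposition hij
    -- The summands have distinct bond spins, so each projection isolates one of them.
    have hz : ∀ t < m, toSpin s (g t) = 0 := by
      intro t ht
      have h1 := h t ht
      rw [bondProj_eq (by omega), hg, toSpin_sum, map_sum,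
        Finset.sum_eq_single_of_mem t (by simp; omega)] at h1
      · rwa [Submodule.starProjection_eq_self_iff.2
          (toSpin_mem_bondEigenspace hij (hg2 t (by omega) (by omega)).2)] at h1
      · intro t' ht' hne
        simp only [Finset.mem_range] at ht'
        exact starProjection_bondEigenspace_of_ne (by omega)
          (toSpin_mem_bondEigenspace hij (hg2 t' (by omega) (by omega)).2)
    -- The individual `g t` are not known to have the right boson numbers. Thus `f` and `F` are
    -- compared as spin vectors only, and `f` is the `s`-component of `F`.
    let F : Fock L := ∑ t ∈ (Finset.range (min (s i) (s j) + 1)).filter (m ≤ ·), g t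
    have hF : bond i j ^ m ∣ F := Finset.dvd_sum fun t ht => by
      simp only [Finset.mem_filter, Finset.mem_range] at ht
      exact (pow_dvd_pow _ ht.2).trans (hg2 t (by omega) (by omega)).1
    have hfF : toSpin s f = toSpin s F := by
      rw [hg, toSpin_sum, toSpin_sum, Finset.sum_filter]
      refine Finset.sum_congr rfl fun t _ => ?_
      split_ifs with hm
      · rfl
      · exact hz t (by omega)
    obtain ⟨q, hq⟩ := hF
    rw [eq_spinComponent_of_toSpin_eq hf hfF, hq, hs', spinComponent_mul hb]
    exact Dvd.intro _ rfl
  · rintro ⟨q, hq⟩ t ht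
    -- The cofactor has only `s i - m` and `s j - m` bosons at the two sites, so its bond spin is at
    -- most `(s i + s j) / 2 - m`. The singlet `bond i j ^ m` does not raise it.
    have hq' : f = bond i j ^ m * spinComponent s' q := by
      rw [← spinComponent_mul hb, ← hs', ← hq, spinComponent_of_hasSpins hf]
    obtain ⟨g, hg, hg2⟩ := (spinComponent_hasSpins (s := s') q).hasBondDecomposition hij
    rw [bondProj_eq (by omega), hq', hg, Finset.mul_sum, toSpin_sum, map_sum]
    refine Finset.sum_eq_zero fun t' ht' => ?_
    simp only [Finset.mem_range] at ht'
    refine starProjection_bondEigenspace_of_ne (e := s' i + s' j - 2 * t') (by omega)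
      (toSpin_mem_bondEigenspace hij ?_)
    rw [((IsSinglet.bond (by simp)).pow m).casimir_mul, (hg2 t' (by omega) (by omega)).2,
      mul_smul_comm]

end BondProjection

/-! ### Divisibility by valence bonds -/

section Divisibility

variable {ι : Type*}

/-- The bond has degree one in `X (i, true)`, and its two coefficients have no common factor. -/
theorem irreducible_bond {i j : ι} (hij : i ≠ j) : Irreducible (bond i j) := by
  classical
  have h : bond i j = X (j, false) * X (i, true) + -(X (i, false) * X (j, true)) := by
    rw [bond]; ring
  rw [h]
  refine irreducible_mul_X_add _ _ _ (X_ne_zero _) (by simp) ?_ ?_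
  · rw [vars_neg]
    intro hm
    have := vars_mul _ _ hm
    simp [hij] at this
  · have hp : Prime (X (j, false) : MvPolynomial (ι × Bool) ℂ) := X_prime
    rw [hp.irreducible.isRelPrime_iff_not_dvd, dvd_neg, hp.dvd_mul, X_dvd_X, X_dvd_X]
    simp [hij.symm]

/-- The substitution `a ↦ 1`, `b_k ↦ v k` sends `bond i j` to `v j - v i = 0` but `bond i' j'` to a
nonzero number, so the irreducible `bond i j` divides no power of the latter. -/
theorem isRelPrime_bond_pow {i j i' j' : ι} (hij : i ≠ j) {v : ι → ℂ} (h : v i = v j)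
    (h' : v i' ≠ v j') (m n : ℕ) : IsRelPrime (bond i j ^ m) (bond i' j' ^ n) := by
  refine ((irreducible_bond hij).isRelPrime_iff_not_dvd.2 fun hd => ?_).pow
  have := map_dvd (aeval (R := ℂ) fun c : ι × Bool => if c.2 then 1 else v c.1) hd
  simp only [bond, map_sub, map_mul, aeval_X] at this
  simp [h, sub_eq_zero] at this
  exact h' this.symm

end Divisibility

/-! ### The VBS polynomial of a block and the ground states of the block Hamiltonian -/

section Block

variable {m : ℕ → ℕ} {L : ℕ}

theorem vbsFock_eq (m : ℕ → ℕ) (L : ℕ) : vbsFock m L = ∏ j : Fin (L - 1),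
    bond (⟨j, by omega⟩ : Fin L) ⟨j + 1, by omega⟩ ^ m (j + 1) := rfl

theorem vbsFock_ne_zero (m : ℕ → ℕ) (L : ℕ) : vbsFock m L ≠ 0 := by
  rw [vbsFock_eq, Finset.prod_ne_zero_iff]
  intro j _
  have h : (⟨j, by omega⟩ : Fin L) ≠ ⟨j + 1, by omega⟩ := by simp [Fin.ext_iff]
  exact pow_ne_zero (m (j + 1)) (irreducible_bond h).ne_zero

theorem vbsFock_dvd_iff {f : Fock L} : vbsFock m L ∣ f ↔ ∀ j : Fin (L - 1),
    bond (⟨j, by omega⟩ : Fin L) ⟨j + 1, by omega⟩ ^ m (j + 1) ∣ f := by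
  refine ⟨fun h j => ?_, fun h => ?_⟩
  · rw [vbsFock_eq] at h
    exact (Finset.dvd_prod_of_mem (fun j : Fin (L - 1) =>
      bond (⟨j, by omega⟩ : Fin L) ⟨j + 1, by omega⟩ ^ m (j + 1)) (Finset.mem_univ j)).trans h
  · rw [vbsFock_eq]
    refine Fintype.prod_dvd_of_isRelPrime (fun j k hjk => ?_) h
    have hne : (j : ℕ) ≠ k := fun h => hjk (Fin.ext h)
    refine isRelPrime_bond_pow (by simp [Fin.ext_iff])
      -- A step function that jumps across the bond `(k, k + 1)` and across no other.
      (v := fun i : Fin L => if (i : ℕ) ≤ k then 0 else 1) ?_ ?_ _ _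
    · rcases lt_or_gt_of_ne hne with h | h
      · simp [h.le, Nat.succ_le_of_lt h]
      · simp [not_le.2 h, not_le.2 (h.trans (Nat.lt_succ_self _))]
    · simp

theorem isWeightedHomogeneous_vbsFock (m : ℕ → ℕ) (L : ℕ) :
    IsWeightedHomogeneous siteDegree (vbsFock m L) fun i : Fin L =>
      (if 0 < (i : ℕ) then m i else 0) + if (i : ℕ) + 1 < L then m (i + 1) else 0 := by
  have h := IsWeightedHomogeneous.prod (Finset.univ : Finset (Fin (L - 1))) _ _ fun j _ =>
    (isWeightedHomogeneous_bond (⟨j, by omega⟩ : Fin L) ⟨j + 1, by omega⟩).pow (m (j + 1))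
  rw [vbsFock_eq]
  convert h using 1
  funext i
  have hi := i.2
  simp only [Finset.sum_apply, Pi.smul_apply, Pi.add_apply, smul_eq_mul, mul_add,
    Finset.sum_add_distrib, Pi.single_apply, mul_ite, mul_one, mul_zero, Fin.ext_iff]
  rw [add_comm]
  congr 1
  · split_ifs with h1
    · rw [Finset.sum_eq_single_of_mem (⟨i, by omega⟩ : Fin (L - 1)) (Finset.mem_univ _)]
      · simp
      · intro j _ hj
        rw [if_neg]
        intro h2; exact hj (Fin.ext h2.symm)
    · exact (Finset.sum_eq_zero fun j _ => if_neg (by have := j.2; omega)).symm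
  · split_ifs with h1
    · rw [Finset.sum_eq_single_of_mem (⟨i - 1, by omega⟩ : Fin (L - 1)) (Finset.mem_univ _)]
      · rw [if_pos (by simp; omega)]; simp; congr 1; omega
      · intro j _ hj
        rw [if_neg]
        intro h2; exact hj (Fin.ext (by simp; omega))
    · exact (Finset.sum_eq_zero fun j _ => if_neg (by have := j.2; omega)).symm

theorem isSinglet_vbsFock (m : ℕ → ℕ) (L : ℕ) : IsSinglet Finset.univ (vbsFock m L) := by
  rw [vbsFock_eq]
  exact IsSinglet.prod fun j _ => (IsSinglet.bond (by simp)).pow _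

/-! ### The block Hamiltonian -/

theorem blockHamiltonian_isPositive {C : ℕ → ℕ → ℝ} (hC : ∀ j t, 0 < C j t) :
    (blockHamiltonian m L C).IsPositive := by
  refine LinearMap.isPositive_sum _ fun j _ => LinearMap.isPositive_sum _ fun t _ => ?_
  refine LinearMap.IsPositive.smul_of_nonneg ?_ (by exact_mod_cast (hC j t).le)
  exact (Submodule.isSymmetricProjection_starProjection _).isPositive

/-- If `H v = 0`, the nonnegative expectation values of all terms in `v` add up to zero, so each
vanishes. For a projection `P` with positive coefficient, `⟨P v, v⟩ = ‖P v‖²`. -/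
theorem blockHamiltonian_apply_eq_zero_iff {C : ℕ → ℕ → ℝ} (hC : ∀ j t, 0 < C j t)
    (v : SpinSpace (twiceSpin m L)) : blockHamiltonian m L C v = 0 ↔
      ∀ j : Fin (L - 1), ∀ t < m (j + 1), bondProj (twiceSpin m L) (⟨j, by omega⟩ : Fin L)
        ⟨j + 1, by omega⟩ ((twiceSpin m L (⟨j, by omega⟩ : Fin L) : ℝ) / 2 +
          (twiceSpin m L (⟨j + 1, by omega⟩ : Fin L) : ℝ) / 2 - t) v = 0 := by
  constructor
  · intro h j t ht
    have h1 : RCLike.re (inner ℂ (blockHamiltonian m L C v) v) = 0 := by rw [h]; simp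
    simp only [blockHamiltonian, LinearMap.sum_apply, sum_inner, map_sum] at h1
    have hnn : ∀ j : Fin (L - 1), ∀ t ∈ Finset.range (m (j + 1)), 0 ≤ RCLike.re (inner ℂ
        (((C j t : ℂ) • bondProj (twiceSpin m L) (⟨j, by omega⟩ : Fin L) ⟨j + 1, by omega⟩
          ((twiceSpin m L (⟨j, by omega⟩ : Fin L) : ℝ) / 2 +
          (twiceSpin m L (⟨j + 1, by omega⟩ : Fin L) : ℝ) / 2 - t)) v) v) := fun j t _ =>
      (LinearMap.IsPositive.smul_of_nonneg (Submodule.isSymmetricProjection_starProjection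
        _).isPositive (by exact_mod_cast (hC j t).le)).re_inner_nonneg_left v
    rw [Finset.sum_eq_zero_iff_of_nonneg fun j _ => Finset.sum_nonneg (hnn j)] at h1
    have h2 := (Finset.sum_eq_zero_iff_of_nonneg (hnn j)).1 (h1 j (Finset.mem_univ j)) t
      (Finset.mem_range.2 ht)
    rw [LinearMap.smul_apply, inner_smul_left, Complex.conj_ofReal] at h2
    have h3 := (mul_eq_zero.1 ((Complex.re_ofReal_mul _ _).symm.trans h2)).resolve_left (hC j t).ne'
    rw [bondProj] at h3 ⊢
    change RCLike.re (inner ℂ (Submodule.starProjection _ v) v) = 0 at h3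
    rw [Submodule.re_inner_starProjection_eq_normSq, sq_eq_zero_iff, norm_eq_zero] at h3
    rw [ContinuousLinearMap.coe_coe, Submodule.starProjection_apply, h3, ZeroMemClass.coe_zero]
  · intro h
    simp only [blockHamiltonian, LinearMap.sum_apply]
    refine Finset.sum_eq_zero fun j _ => Finset.sum_eq_zero fun t ht => ?_
    rw [LinearMap.smul_apply, h j t (Finset.mem_range.1 ht), smul_zero]

/-! ### The degenerate VBS states -/

/-- The first site of the row. -/
abbrev firstSite (hL : 2 ≤ L) : Fin L := ⟨0, by omega⟩

/-- The last site of the row. -/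
abbrev lastSite (hL : 2 ≤ L) : Fin L := ⟨L - 1, by omega⟩

variable (hL : 2 ≤ L)

theorem firstSite_ne_lastSite : firstSite hL ≠ lastSite hL := by
  simp [Fin.ext_iff]; omega

/-- The number of bosons which the dangling bonds contribute to each site. -/
def danglingDegree (m : ℕ → ℕ) (hL : 2 ≤ L) : Fin L → ℕ :=
  m 0 • Pi.single (firstSite hL) 1 + m L • Pi.single (lastSite hL) 1

theorem twiceSpin_eq (m : ℕ → ℕ) (hL : 2 ≤ L) : twiceSpin m L =
    (fun i : Fin L => (if 0 < (i : ℕ) then m i else 0) + if (i : ℕ) + 1 < L then m (i + 1) else 0) +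
      danglingDegree m hL := by
  funext i
  have hi := i.2
  simp only [twiceSpin, Pi.add_apply, danglingDegree, Pi.smul_apply, Pi.single_apply, Fin.ext_iff,
    smul_eq_mul, mul_ite, mul_one, mul_zero]
  by_cases h1 : (i : ℕ) = 0
  · rw [if_neg (by omega), if_pos (by omega), if_pos h1, if_neg (by omega), h1]; omega
  · by_cases h2 : (i : ℕ) = L - 1
    · rw [if_pos (by omega), if_neg (by omega), if_neg h1, if_pos h2,
        show (i : ℕ) + 1 = L by omega]; omega
    · rw [if_pos (by omega), if_pos (by omega), if_neg h1, if_neg h2]; omega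

theorem hasSpins_mul_vbsFock {g : Fock L} (hg : HasSpins (danglingDegree m hL) g) :
    HasSpins (twiceSpin m L) (g * vbsFock m L) := by
  rw [hasSpins_iff, mul_comm, twiceSpin_eq m hL]
  exact (isWeightedHomogeneous_vbsFock m L).mul (hasSpins_iff.1 hg)

theorem exists_of_vbsFock_dvd {f : Fock L} (hf : HasSpins (twiceSpin m L) f)
    (h : vbsFock m L ∣ f) : ∃ g, HasSpins (danglingDegree m hL) g ∧ f = g * vbsFock m L := by
  obtain ⟨q, rfl⟩ := h
  refine ⟨spinComponent _ q, spinComponent_hasSpins q, ?_⟩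
  rw [mul_comm (spinComponent _ q), ← spinComponent_mul (isWeightedHomogeneous_vbsFock m L), ← twiceSpin_eq,
    spinComponent_of_hasSpins hf]

theorem hasSpins_twoSite {p q : ℕ} (hp : p ≤ m 0) (hq : q ≤ m L) : HasSpins (danglingDegree m hL)
    (twoSite (firstSite hL) (lastSite hL) (m 0) (m L) p q) :=
  hasSpins_iff.2 (isWeightedHomogeneous_twoSite _ _ hp hq)

/-- The constraint forbids bosons away from the two ends, so only four modes can occur. -/
theorem exists_eq_sum_twoSite {g : Fock L} (hg : HasSpins (danglingDegree m hL) g) :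
    ∃ c : ℕ → ℕ → ℂ, g = ∑ p ∈ Finset.range (m 0 + 1), ∑ q ∈ Finset.range (m L + 1),
      c p q • twoSite (firstSite hL) (lastSite hL) (m 0) (m L) p q := by
  classical
  have hne := firstSite_ne_lastSite hL
  let α : ℕ → ℕ → (Fin L × Bool) →₀ ℕ := fun p q =>
    Finsupp.single (firstSite hL, true) (m 0 - p) + Finsupp.single (firstSite hL, false) p +
      (Finsupp.single (lastSite hL, true) (m L - q) + Finsupp.single (lastSite hL, false) q)
  have hα : ∀ β ∈ g.support, ∃ p ≤ m 0, ∃ q ≤ m L, β = α p q := by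
    intro β hβ
    have h := hg β hβ
    have h1 : β (firstSite hL, true) + β (firstSite hL, false) = m 0 := by
      rw [h]; simp [danglingDegree, hne]
    have h2 : β (lastSite hL, true) + β (lastSite hL, false) = m L := by
      rw [h]; simp [danglingDegree, hne.symm]
    refine ⟨β (firstSite hL, false), by omega, β (lastSite hL, false), by omega, ?_⟩
    ext ⟨k, γ⟩
    by_cases hk1 : k = firstSite hL
    · subst hk1
      cases γ
      · simp [α, hne.symm]
      · simp [α, hne.symm]; omega
    · by_cases hk2 : k = lastSite hL
      · subst hk2
        cases γ
        · simp [α, hne]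
        · simp [α, hne]; omega
      · have h3 := h k
        simp [danglingDegree, hk1, hk2] at h3
        cases γ <;> simp [α, h3, Ne.symm hk1, Ne.symm hk2]
  have hinj : ∀ p q p' q', α p q = α p' q' → p = p' ∧ q = q' := fun p q p' q' h =>
    ⟨by simpa [α, hne, hne.symm] using DFunLike.congr_fun h (firstSite hL, false),
      by simpa [α, hne, hne.symm] using DFunLike.congr_fun h (lastSite hL, false)⟩
  refine ⟨fun p q => g.coeff (α p q), ?_⟩
  rw [← Finset.sum_product']
  ext β
  rw [coeff_sum]
  simp only [coeff_smul, twoSite_eq_monomial, coeff_monomial, smul_eq_mul, mul_ite, mul_one,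
    mul_zero]
  by_cases hβ : β ∈ g.support
  · obtain ⟨p, hp, q, hq, rfl⟩ := hα β hβ
    rw [Finset.sum_eq_single_of_mem (p, q) (by simp; omega)]
    · simp [α]
    · intro x _ hx
      rw [if_neg]
      intro h
      obtain ⟨h1, h2⟩ := hinj _ _ _ _ h
      exact hx (Prod.ext h1 h2)
  · rw [notMem_support_iff.1 hβ]
    refine (Finset.sum_eq_zero fun x _ => ?_).symm
    split_ifs with h
    · rw [← notMem_support_iff.1 hβ, ← h]
    · rfl

theorem labels_eq (m : ℕ → ℕ) (L : ℕ) : labels m L = couplingLabels (m 0) (m L) := rfl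

theorem coupledCreate_eq {t : ℕ} (h₁ : t ≤ m 0) (h₂ : t ≤ m L) (r : ℕ) :
    coupledCreate m L hL t r =
      coupledState (firstSite hL) (lastSite hL) (m 0) (m L) t r := by
  rw [coupledState_eq_sum _ _ h₁ h₂, coupledCreate]
  refine Finset.sum_congr rfl fun p _ => Finset.sum_congr rfl fun q _ => ?_
  rw [smul_eq_C_mul, unitTwoSite, smul_eq_C_mul, spinCreate, spinCreate, twoSite,
    Real.sqrt_mul (show (0 : ℝ) ≤ (m 0 - p)! * (p)! by positivity), Complex.ofReal_mul, mul_inv,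
    C_mul]
  simp only [aDag, bDag]
  ring

theorem degFock_eq {t : ℕ} (h₁ : t ≤ m 0) (h₂ : t ≤ m L) (r : ℕ) : degFock m L hL t r =
    coupledState (firstSite hL) (lastSite hL) (m 0) (m L) t r * vbsFock m L := by
  rw [degFock, coupledCreate_eq hL h₁ h₂]

theorem HasSpins.sum_smul {s : Fin L → ℕ} {κ : Type*} {S : Finset κ} {f : κ → Fock L}
    (h : ∀ k ∈ S, HasSpins s (f k)) (c : κ → ℂ) : HasSpins s (∑ k ∈ S, c k • f k) :=
  hasSpins_iff.2 ((mem_weightedHomogeneousSubmodule ℂ siteDegree s _).1 (Submodule.sum_mem _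
    fun k hk => Submodule.smul_mem _ _ (hasSpins_iff.1 (h k hk))))

theorem hasSpins_degFock {t : ℕ} (h₁ : t ≤ m 0) (h₂ : t ≤ m L) (r : ℕ) :
    HasSpins (twiceSpin m L) (degFock m L hL t r) := by
  rw [degFock_eq hL h₁ h₂]
  refine hasSpins_mul_vbsFock hL ?_
  rw [coupledState, coupling_coeff _ _ h₁ h₂, ← Finset.sum_product', Finset.smul_sum]
  simp only [smul_smul]
  refine HasSpins.sum_smul (fun x hx => ?_) _
  simp only [Finset.mem_product, Finset.mem_range] at hx
  exact hasSpins_twoSite hL (by omega) (by omega)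

theorem toSpin_unitTwoSite_mul_vbsFock {p q : ℕ} (hp : p ≤ m 0) (hq : q ≤ m L) :
    toSpin (twiceSpin m L) (unitTwoSite (firstSite hL) (lastSite hL) (m 0) (m L) p q *
      vbsFock m L) = ∑ a ∈ labels m L,
        (clebschGordan (m 0) p (m L) q a.1 a.2 : ℂ) • degVBS m L hL a.1 a.2 := by
  rw [unitTwoSite_eq_sum _ _ hp hq, Finset.sum_mul, toSpin_sum, labels_eq]
  refine Finset.sum_congr rfl fun a ha => ?_
  obtain ⟨⟨h1, h2⟩, _⟩ := mem_couplingLabels.1 ha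
  rw [smul_mul_assoc, toSpin_smul, degVBS, degFock_eq hL h1 h2]

/-- The span of all states `|VBS_L(J,M)⟩`. -/
def degSpan (m : ℕ → ℕ) (L : ℕ) (hL : 2 ≤ L) : Submodule ℂ (SpinSpace (twiceSpin m L)) :=
  Submodule.span ℂ {ψ | ∃ a ∈ labels m L, ψ = degVBS m L hL a.1 a.2}

/-- The cofactor of an admissible multiple of `vbsFock` is a combination of number states of the end
spins, hence of coupled states. Conversely, every vector of the span lifts to an admissible
multiple, and lifts are unique. -/
theorem toSpin_mem_degSpan_iff {f : Fock L} (hf : HasSpins (twiceSpin m L) f) :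
    toSpin (twiceSpin m L) f ∈ degSpan m L hL ↔ vbsFock m L ∣ f := by
  constructor
  · intro h
    obtain ⟨q, hq, hqf⟩ : ∃ q, vbsFock m L ∣ q ∧ HasSpins (twiceSpin m L) q ∧
        toSpin (twiceSpin m L) q = toSpin (twiceSpin m L) f := by
      refine Submodule.span_induction (p := fun ψ _ => ∃ q, vbsFock m L ∣ q ∧
        HasSpins (twiceSpin m L) q ∧ toSpin (twiceSpin m L) q = ψ) ?_ ?_ ?_ ?_ h
      · rintro _ ⟨a, ha, rfl⟩
        obtain ⟨⟨h1, h2⟩, _⟩ := mem_couplingLabels.1 ha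
        exact ⟨degFock m L hL a.1 a.2, by rw [degFock]; exact Dvd.intro_left _ rfl,
          hasSpins_degFock hL h1 h2 _, rfl⟩
      · exact ⟨0, dvd_zero _, by simp [HasSpins], toSpin_zero⟩
      · rintro _ _ _ _ ⟨q, h1, h2, rfl⟩ ⟨q', h1', h2', rfl⟩
        exact ⟨q + q', dvd_add h1 h1', hasSpins_iff.2 ((hasSpins_iff.1 h2).add (hasSpins_iff.1 h2')),
          toSpin_add _ _⟩
      · rintro c _ _ ⟨q, h1, h2, rfl⟩
        refine ⟨c • q, ?_, ?_, toSpin_smul _ _⟩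
        · rw [smul_eq_C_mul]; exact h1.mul_left _
        · rw [smul_eq_C_mul]; exact hasSpins_iff.2 ((hasSpins_iff.1 h2).C_mul c)
    rwa [eq_spinComponent_of_toSpin_eq hf hqf.2.symm, spinComponent_of_hasSpins hqf.1]
  · intro h
    obtain ⟨g, hg, rfl⟩ := exists_of_vbsFock_dvd hL hf h
    obtain ⟨c, rfl⟩ := exists_eq_sum_twoSite hL hg
    rw [← Finset.sum_product', Finset.sum_mul, toSpin_sum]
    refine Submodule.sum_mem _ fun x hx => ?_
    simp only [Finset.mem_product, Finset.mem_range] at hx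
    rw [twoSite_eq_smul, smul_smul, smul_mul_assoc, toSpin_smul,
      toSpin_unitTwoSite_mul_vbsFock hL (by omega) (by omega)]
    exact Submodule.smul_mem _ _ (Submodule.sum_mem _ fun a ha => Submodule.smul_mem _ _
      (Submodule.subset_span ⟨a, ha, rfl⟩))

/-- Each inner bond imposes divisibility by its own power of the valence bond. By coprimality the
conditions combine to divisibility by `vbsFock`. -/
theorem ker_blockHamiltonian {C : ℕ → ℕ → ℝ} (hC : ∀ j t, 0 < C j t) :
    LinearMap.ker (blockHamiltonian m L C) = degSpan m L hL := by
  ext v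
  obtain ⟨f, hf, rfl⟩ := exists_toSpin_eq v
  rw [LinearMap.mem_ker, blockHamiltonian_apply_eq_zero_iff hC, toSpin_mem_degSpan_iff hL hf,
    vbsFock_dvd_iff]
  refine forall_congr' fun j => ?_
  exact bondProj_eq_zero_iff hf (by simp [Fin.ext_iff]) (by simp [twiceSpin])
    (by simp [twiceSpin])

end Block

/-! ### Partial traces of pure states -/

section PartialTrace

variable {L K : ℕ} (s : Fin K → ℕ) (e : Fin L → Fin K)

/-- The occupation numbers of the modes outside the image of `e`. -/
def outerOccupation (z : Config s) : (Fin K × Bool) →₀ ℕ :=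
  open scoped Classical in (occupation s z).filter fun c => c.1 ∉ Set.range e

/-- The restriction of a configuration to the sites in the image of `e`. -/
abbrev restrictConfig (z : Config s) : Config fun i => s (e i) := fun i => z (e i)

theorem outerOccupation_of_mem (z : Config s) (i : Fin L) (γ : Bool) :
    outerOccupation s e z (e i, γ) = 0 := by
  classical
  simp [outerOccupation]

theorem outerOccupation_of_notMem (z : Config s) {j : Fin K} (hj : j ∉ Set.range e) (γ : Bool) :
    outerOccupation s e z (j, γ) = occupation s z (j, γ) := by
  classical
  rw [outerOccupation, Finsupp.filter_apply_pos]
  exact hj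

theorem outerOccupation_eq_iff {z z' : Config s} : outerOccupation s e z = outerOccupation s e z' ↔
    ∀ j, j ∉ Set.range e → z j = z' j := by
  refine ⟨fun h j hj => ?_, fun h => ?_⟩
  · have := DFunLike.congr_fun h (j, true)
    rw [outerOccupation_of_notMem s e z hj, outerOccupation_of_notMem s e z' hj, occupation_true,
      occupation_true] at this
    exact Fin.ext this
  · ext ⟨j, γ⟩
    by_cases hj : j ∈ Set.range e
    · obtain ⟨i, rfl⟩ := hj
      rw [outerOccupation_of_mem, outerOccupation_of_mem]
    · rw [outerOccupation_of_notMem s e z hj, outerOccupation_of_notMem s e z' hj]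
      cases γ <;> simp [occupation_true, occupation_false, h j hj]

theorem ext_of_outerOccupation {z z' : Config s} (h : outerOccupation s e z = outerOccupation s e z')
    (h' : restrictConfig s e z = restrictConfig s e z') : z = z' := by
  funext j
  by_cases hj : j ∈ Set.range e
  · obtain ⟨i, rfl⟩ := hj
    exact congrFun h' i
  · exact (outerOccupation_eq_iff s e).1 h j hj

open scoped Classical in
/-- Twice the spins of the sites outside the image of `e`. -/
def outerSpins (j : Fin K) : ℕ := if j ∈ Set.range e then 0 else s j

variable {e} (he : Function.Injective e)
include he

theorem mapDomain_occupation (x : Config fun i => s (e i)) (i : Fin L) (γ : Bool) :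
    Finsupp.mapDomain (Prod.map e id) (occupation _ x) (e i, γ) = occupation _ x (i, γ) :=
  Finsupp.mapDomain_apply (he.prodMap Function.injective_id) _ (i, γ)

omit he in
theorem mapDomain_of_notMem (β : (Fin L × Bool) →₀ ℕ) {j : Fin K} (hj : j ∉ Set.range e)
    (γ : Bool) : Finsupp.mapDomain (Prod.map e id) β (j, γ) = 0 :=
  Finsupp.mapDomain_of_notMem_range _ _ fun ⟨c, hc⟩ => hj ⟨c.1, congrArg Prod.fst hc⟩

theorem occupation_eq_add (z : Config s) : occupation s z = outerOccupation s e z +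
    Finsupp.mapDomain (Prod.map e id) (occupation _ (restrictConfig s e z)) := by
  ext ⟨j, γ⟩
  rw [Finsupp.add_apply]
  by_cases hj : j ∈ Set.range e
  · obtain ⟨i, rfl⟩ := hj
    rw [outerOccupation_of_mem, mapDomain_occupation s he]
    cases γ <;> simp [occupation_true, occupation_false]
  · rw [outerOccupation_of_notMem s e z hj, mapDomain_of_notMem _ hj, add_zero]

theorem exists_outerOccupation {α : (Fin K × Bool) →₀ ℕ} (h1 : ∀ i γ, α (e i, γ) = 0)
    (h2 : ∀ j, j ∉ Set.range e → α (j, true) + α (j, false) = s j)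
    (x : Config fun i => s (e i)) :
    ∃ z, outerOccupation s e z = α ∧ restrictConfig s e z = x := by
  obtain ⟨z, hz⟩ := exists_occupation s
    (α := α + Finsupp.mapDomain (Prod.map e id) (occupation _ x)) (by
      intro j
      simp only [Finsupp.add_apply]
      by_cases hj : j ∈ Set.range e
      · obtain ⟨i, rfl⟩ := hj
        rw [mapDomain_occupation s he, mapDomain_occupation s he, h1, h1, zero_add, zero_add,
          occupation_add]
      · rw [mapDomain_of_notMem _ hj, mapDomain_of_notMem _ hj, add_zero, add_zero, h2 j hj])
  refine ⟨z, ?_, ?_⟩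
  · ext ⟨j, γ⟩
    by_cases hj : j ∈ Set.range e
    · obtain ⟨i, rfl⟩ := hj
      rw [outerOccupation_of_mem, h1]
    · rw [outerOccupation_of_notMem s e z hj, hz, Finsupp.add_apply, mapDomain_of_notMem _ hj,
        add_zero]
  · funext i
    apply Fin.ext
    rw [← occupation_true s z, hz, Finsupp.add_apply, h1, zero_add, mapDomain_occupation s he,
      occupation_true]

/-- The factors involve disjoint sets of modes, so a monomial of the product splits in only one way.
This is the tensor product of outside and block. -/
theorem coeff_mul_rename {O : Fock K} (hO : ∀ α ∈ O.support, ∀ i γ, α (e i, γ) = 0) (ψ : Fock L)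
    (z : Config s) : (O * rename (Prod.map e id) ψ).coeff (occupation s z) =
      O.coeff (outerOccupation s e z) * ψ.coeff (occupation _ (restrictConfig s e z)) := by
  classical
  have hinj : Function.Injective (Prod.map e (id : Bool → Bool)) := he.prodMap Function.injective_id
  induction ψ using MvPolynomial.induction_on' with
  | add f g hf hg => rw [map_add, mul_add, coeff_add, hf, hg, coeff_add, mul_add]
  | monomial β c =>
    rw [rename_monomial, coeff_mul_monomial', coeff_monomial]
    by_cases h : β = occupation _ (restrictConfig s e z)
    · rw [if_pos h, h, occupation_eq_add s he z, if_pos le_add_self, add_tsub_cancel_right]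
    · rw [if_neg h, mul_zero]
      split_ifs with hle
      · by_contra hne
        have h0 := hO _ (mem_support_iff.2 (left_ne_zero_of_mul hne))
        refine h ?_
        ext ⟨i, γ⟩
        have h1 := h0 i γ
        have h2 := hle (e i, γ)
        have h3 : Finsupp.mapDomain (Prod.map e id) β (e i, γ) = β (i, γ) :=
          Finsupp.mapDomain_apply hinj _ (i, γ)
        rw [Finsupp.tsub_apply, h3] at h1
        rw [h3] at h2
        have h4 : occupation s z (e i, γ) = occupation _ (restrictConfig s e z) (i, γ) := by
          cases γ <;> simp [occupation_true, occupation_false]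
        omega
      · rfl

/-- The squared norm of the monomial for the sites outside the image of `e`. -/
def outerWeight (s : Fin K → ℕ) (e : Fin L → Fin K) (z : Config s) : ℝ :=
  open scoped Classical in
  ∏ j ∈ Finset.univ.filter (· ∉ Set.range e), ((z j : ℕ)! * (s j - (z j : ℕ))! : ℝ)

omit he in
theorem outerWeight_nonneg (z : Config s) : 0 ≤ outerWeight s e z :=
  Finset.prod_nonneg fun _ _ => by positivity

theorem configWeight_eq_mul (z : Config s) :
    configWeight s z = outerWeight s e z * configWeight _ (restrictConfig s e z) := by
  classical
  rw [configWeight, ← Finset.prod_filter_mul_prod_filter_not _ (· ∉ Set.range e), outerWeight]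
  congr 1
  rw [configWeight]
  symm
  refine Finset.prod_bij (fun i _ => e i) (fun i _ => by simp) (fun i _ j _ h => he h) ?_
    fun i _ => rfl
  intro j hj
  simpa using hj

omit he in
theorem factorialWeight_outerOccupation (z : Config s) :
    factorialWeight (outerOccupation s e z) = (outerWeight s e z : ℂ) := by
  classical
  rw [factorialWeight, Finsupp.prod_fintype _ _ (by simp), Fintype.prod_prod_type, outerWeight,
    Finset.prod_filter]
  push_cast
  refine Finset.prod_congr rfl fun j _ => ?_
  rw [Fintype.prod_bool]
  by_cases hj : j ∉ Set.range e
  · rw [if_pos hj, outerOccupation_of_notMem s e z hj, outerOccupation_of_notMem s e z hj,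
      occupation_true, occupation_false, Complex.ofReal_mul, Complex.ofReal_natCast,
      Complex.ofReal_natCast]
  · rw [if_neg hj]
    obtain ⟨i, rfl⟩ := not_not.1 hj
    rw [outerOccupation_of_mem, outerOccupation_of_mem]
    simp

/-- The amplitude of the outer configuration of `z` in the state `O`. -/
def outerAmplitude (s : Fin K → ℕ) (e : Fin L → Fin K) (O : Fock K) (z : Config s) : ℂ :=
  O.coeff (outerOccupation s e z) * √(outerWeight s e z)

theorem toSpin_mul_rename {O : Fock K} (hO : ∀ α ∈ O.support, ∀ i γ, α (e i, γ) = 0) (ψ : Fock L)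
    (z : Config s) : toSpin s (O * rename (Prod.map e id) ψ) z =
      outerAmplitude s e O z * toSpin _ ψ (restrictConfig s e z) := by
  rw [toSpin_apply, toSpin_apply, coeff_mul_rename s he hO, outerAmplitude,
    configWeight_eq_mul s he, Real.sqrt_mul (outerWeight_nonneg s z)]
  push_cast; ring

omit he in
theorem outerAmplitude_congr {z z' : Config s} (h : outerOccupation s e z = outerOccupation s e z')
    (O : Fock K) : outerAmplitude s e O z = outerAmplitude s e O z' := by
  have h2 : outerWeight s e z = outerWeight s e z' := by
    have := factorialWeight_outerOccupation (e := e) s z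
    rw [h, factorialWeight_outerOccupation] at this
    exact_mod_cast this.symm
  rw [outerAmplitude, outerAmplitude, h, h2]

/-- With the block configuration frozen at `x`, the sum runs once over every outer configuration and
reproduces the Fock inner product. -/
theorem sum_outerAmplitude {O O' : Fock K} (h1 : ∀ α ∈ O.support, ∀ i γ, α (e i, γ) = 0)
    (h2 : ∀ α ∈ O.support, ∀ j, j ∉ Set.range e → α (j, true) + α (j, false) = s j)
    (x : Config fun i => s (e i)) :
    (open scoped Classical in ∑ z ∈ Finset.univ.filter (fun z : Config s => restrictConfig s e z = x),
      outerAmplitude s e O z * conj (outerAmplitude s e O' z)) = fockInner O' O := by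
  classical
  rw [fockInner_eq_sum]
  symm
  have hinj : Set.InjOn (outerOccupation s e)
      (Finset.univ.filter (fun z : Config s => restrictConfig s e z = x)) := by
    intro z hz z' hz' h
    simp only [Finset.coe_filter, Finset.mem_univ, true_and, Set.mem_ofPred_eq] at hz hz'
    exact ext_of_outerOccupation s e h (hz.trans hz'.symm)
  have h3 : ∑ α ∈ (Finset.univ.filter (fun z : Config s => restrictConfig s e z = x)).image
      (outerOccupation s e), conj (O'.coeff α) * O.coeff α * factorialWeight α =
      ∑ z ∈ Finset.univ.filter (fun z : Config s => restrictConfig s e z = x),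
      outerAmplitude s e O z * conj (outerAmplitude s e O' z) := by
    rw [Finset.sum_image hinj]
    refine Finset.sum_congr rfl fun z _ => ?_
    rw [factorialWeight_outerOccupation, outerAmplitude, outerAmplitude, map_mul,
      Complex.conj_ofReal]
    have := Real.mul_self_sqrt (outerWeight_nonneg (e := e) s z)
    have h4 : (√(outerWeight s e z) : ℂ) * √(outerWeight s e z) = outerWeight s e z := by
      exact_mod_cast this
    rw [← h4]; ring
  rw [← h3]
  refine Finset.sum_subset (fun α hα => ?_) fun α _ hα => by simp [notMem_support_iff.1 hα]
  obtain ⟨z, hz, hz'⟩ := exists_outerOccupation s he (h1 α hα) (h2 α hα) x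
  exact Finset.mem_image.2 ⟨z, by simp [hz'], hz⟩

/-- The partial trace of a pure state which is a sum of products of states of the outside and of
the block. -/
theorem partialTrace_sum {κ : Type*} (S : Finset κ) (O : κ → Fock K) (ψ : κ → Fock L)
    (hO : ∀ a ∈ S, HasSpins (outerSpins s e) (O a)) (x x' : Config fun i => s (e i)) :
    partialTrace s e (fun z z' => toSpin s (∑ a ∈ S, O a * rename (Prod.map e id) (ψ a)) z *
      star (toSpin s (∑ a ∈ S, O a * rename (Prod.map e id) (ψ a)) z')) x x' =
    ∑ a ∈ S, ∑ b ∈ S, fockInner (O b) (O a) * (toSpin _ (ψ a) x * conj (toSpin _ (ψ b) x')) := by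
  classical
  have h1 : ∀ a ∈ S, ∀ α ∈ (O a).support, ∀ i γ, α (e i, γ) = 0 := fun a ha α hα i γ => by
    have := hO a ha α hα (e i)
    rw [outerSpins, if_pos ⟨i, rfl⟩] at this
    cases γ <;> omega
  have h2 : ∀ a ∈ S, ∀ α ∈ (O a).support, ∀ j, j ∉ Set.range e →
      α (j, true) + α (j, false) = s j := fun a ha α hα j hj => by
    rw [hO a ha α hα j, outerSpins, if_neg hj]
  have h3 : ∀ z, toSpin s (∑ a ∈ S, O a * rename (Prod.map e id) (ψ a)) z =
      ∑ a ∈ S, outerAmplitude s e (O a) z * toSpin _ (ψ a) (restrictConfig s e z) := fun z => by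
    rw [toSpin_sum, WithLp.ofLp_sum, Finset.sum_apply]
    exact Finset.sum_congr rfl fun a ha => toSpin_mul_rename s he (h1 a ha) _ z
  have h4 : ∀ z : Config s, (∑ z' : Config s,
      if (∀ i, z (e i) = x i) ∧ (∀ i, z' (e i) = x' i) ∧ (∀ j, j ∉ Set.range e → z j = z' j)
      then toSpin s (∑ a ∈ S, O a * rename (Prod.map e id) (ψ a)) z *
        star (toSpin s (∑ a ∈ S, O a * rename (Prod.map e id) (ψ a)) z') else 0) =
      if restrictConfig s e z = x then ∑ a ∈ S, ∑ b ∈ S, (outerAmplitude s e (O a) z *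
        conj (outerAmplitude s e (O b) z)) * (toSpin _ (ψ a) x * conj (toSpin _ (ψ b) x'))
      else 0 := by
    intro z
    split_ifs with hz
    -- Exactly one `z'` agrees with `z` outside the block and with `x'` inside.
    · obtain ⟨z', hz1, hz2⟩ := exists_outerOccupation s he (α := outerOccupation s e z)
        (outerOccupation_of_mem s e z) (fun j hj => by
          rw [outerOccupation_of_notMem s e z hj, outerOccupation_of_notMem s e z hj,
            occupation_add]) x'
      rw [Finset.sum_eq_single_of_mem z' (Finset.mem_univ _), if_pos
        ⟨congrFun hz, congrFun hz2, (outerOccupation_eq_iff s e).1 hz1.symm⟩, h3, h3, hz, hz2,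
        RCLike.star_def, map_sum, Finset.sum_mul_sum]
      · refine Finset.sum_congr rfl fun a _ => Finset.sum_congr rfl fun b _ => ?_
        rw [outerAmplitude_congr s hz1, map_mul]; ring
      · intro w _ hw
        rw [if_neg]
        rintro ⟨_, h5, h6⟩
        refine hw (ext_of_outerOccupation s e ?_ ?_)
        · rw [hz1]; exact ((outerOccupation_eq_iff s e).2 h6).symm
        · rw [hz2]; exact funext h5
    · exact Finset.sum_eq_zero fun z' _ => if_neg fun h => hz (funext h.1)
  have h5 : partialTrace s e (fun z z' => toSpin s (∑ a ∈ S, O a * rename (Prod.map e id) (ψ a)) z *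
      star (toSpin s (∑ a ∈ S, O a * rename (Prod.map e id) (ψ a)) z')) x x' =
      ∑ z : Config s, ∑ z' : Config s,
      if (∀ i, z (e i) = x i) ∧ (∀ i, z' (e i) = x' i) ∧ (∀ j, j ∉ Set.range e → z j = z' j)
      then toSpin s (∑ a ∈ S, O a * rename (Prod.map e id) (ψ a)) z *
        star (toSpin s (∑ a ∈ S, O a * rename (Prod.map e id) (ψ a)) z') else 0 := by
    refine Finset.sum_congr rfl fun z _ => Finset.sum_congr rfl fun z' _ => ?_
    congr
  rw [h5, Finset.sum_congr rfl fun z _ => h4 z, ← Finset.sum_filter, Finset.sum_comm]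
  refine Finset.sum_congr rfl fun a ha => ?_
  rw [Finset.sum_comm]
  refine Finset.sum_congr rfl fun b hb => ?_
  rw [← Finset.sum_mul, sum_outerAmplitude s he (h1 a ha) (h2 a ha)]

omit he in
theorem trace_partialTrace (A : Matrix (Config s) (Config s) ℂ) :
    ∑ x, partialTrace s e A x x = ∑ z, A z z := by
  classical
  have h : ∀ x, partialTrace s e A x x = ∑ z, if restrictConfig s e z = x then A z z else 0 := by
    intro x
    change Finset.sum _ _ = _
    refine Finset.sum_congr rfl fun z _ => ?_
    split_ifs with hz
    · rw [Finset.sum_eq_single_of_mem z (Finset.mem_univ _), if_pos]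
      · exact ⟨congrFun hz, congrFun hz, fun _ _ => rfl⟩
      · intro z' _ hne
        rw [if_neg]
        rintro ⟨h1, h2, h3⟩
        refine hne (ext_of_outerOccupation s e ((outerOccupation_eq_iff s e).2 h3).symm ?_)
        rw [hz]; exact funext h2
    · exact Finset.sum_eq_zero fun z' _ => if_neg fun h => hz (funext h.1)
  rw [Finset.sum_congr rfl fun x _ => h x, Finset.sum_comm]
  exact Finset.sum_congr rfl fun z _ => by simp

end PartialTrace

/-! ### Segments of a row of sites -/

section Segment

variable (μ : ℕ → ℕ) {K : ℕ}

/-- The power of the valence bond between the sites `j` and `j + 1` of a row. -/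
def rowBond (K j : ℕ) : Fock K :=
  if h : j + 1 < K then bond ⟨j, by omega⟩ ⟨j + 1, h⟩ ^ μ (j + 1) else 1

/-- The product of the valence bonds of the sites `a, …, b` of a row. -/
def segment (K a b : ℕ) : Fock K := ∏ j ∈ Finset.Ico a b, rowBond μ K j

theorem rowBond_eq {i j : Fin K} (h : (j : ℕ) = i + 1) : rowBond μ K i = bond i j ^ μ j := by
  obtain ⟨j, hj⟩ := j
  obtain rfl : j = i + 1 := h
  rw [rowBond, dif_pos hj]

theorem vbsFock_eq_segment (K : ℕ) : vbsFock μ K = segment μ K 0 (K - 1) := by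
  rw [segment, ← Finset.range_eq_Ico, Finset.prod_range, vbsFock_eq]
  refine Finset.prod_congr rfl fun j _ => ?_
  rw [rowBond, dif_pos (by omega)]

theorem segment_succ {a b : ℕ} (hab : a ≤ b) :
    segment μ K a (b + 1) = segment μ K a b * rowBond μ K b :=
  Finset.prod_Ico_succ_top hab _

theorem isWeightedHomogeneous_segment {a b : ℕ} (hb : b < K) :
    IsWeightedHomogeneous siteDegree (segment μ K a b) fun i : Fin K =>
      (if a < (i : ℕ) ∧ (i : ℕ) ≤ b then μ i else 0) +
        if a ≤ (i : ℕ) ∧ (i : ℕ) < b then μ (i + 1) else 0 := by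
  have h1 : ∀ j ∈ Finset.Ico a b, IsWeightedHomogeneous siteDegree (rowBond μ K j)
      fun i : Fin K => (if (i : ℕ) = j + 1 then μ (j + 1) else 0) +
        if (i : ℕ) = j then μ (j + 1) else 0 := fun j hj => by
    rw [Finset.mem_Ico] at hj
    rw [rowBond, dif_pos (by omega)]
    convert (isWeightedHomogeneous_bond (⟨j, by omega⟩ : Fin K) ⟨j + 1, by omega⟩).pow (μ (j + 1))
      using 1
    funext i
    simp only [Pi.smul_apply, Pi.add_apply, Pi.single_apply, Fin.ext_iff, smul_eq_mul, mul_add,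
      mul_ite, mul_one, mul_zero]
    rw [add_comm]
  induction b with
  | zero =>
    simp only [segment, Finset.Ico_eq_empty_of_le (Nat.zero_le a), Finset.prod_empty]
    convert isWeightedHomogeneous_one ℂ siteDegree using 1
    funext i
    rw [if_neg (by omega), if_neg (by omega)]; rfl
  | succ b ih =>
    rcases le_or_gt a b with hab | hab
    · rw [segment_succ μ hab]
      convert (ih (by omega) fun j hj => h1 j (Finset.Ico_subset_Ico_right (Nat.le_succ b) hj)).mul
        (h1 b (Finset.mem_Ico.2 ⟨hab, Nat.lt_succ_self b⟩)) using 1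
      funext i
      simp only [Pi.add_apply]
      rw [add_add_add_comm]
      congr 1
      · by_cases h : (i : ℕ) = b + 1
        · rw [if_pos (by omega), if_neg (by omega), if_pos h, zero_add, h]
        · rw [if_neg h, add_zero]
          exact if_congr (by omega) rfl rfl
      · by_cases h : (i : ℕ) = b
        · rw [if_pos (by omega), if_neg (by omega), if_pos h, zero_add, h]
        · rw [if_neg h, add_zero]
          exact if_congr (by omega) rfl rfl
    · simp only [segment, Finset.Ico_eq_empty_of_le (Nat.succ_le_of_lt hab), Finset.prod_empty]
      convert isWeightedHomogeneous_one ℂ siteDegree using 1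
      funext i
      rw [if_neg (by omega), if_neg (by omega)]; rfl

theorem isSinglet_segment {T : Finset (Fin K)} {a b : ℕ} (h : ∀ i j : Fin K, a ≤ (i : ℕ) →
    (j : ℕ) ≤ b → (j : ℕ) = i + 1 → (i ∈ T ↔ j ∈ T)) : IsSinglet T (segment μ K a b) := by
  refine IsSinglet.prod fun j hj => ?_
  rw [Finset.mem_Ico] at hj
  rw [rowBond]
  split_ifs with hK
  · exact (IsSinglet.bond (h _ _ hj.1 (Nat.succ_le_of_lt hj.2) rfl)).pow _
  · simpa using IsSinglet.C (T := T) 1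

theorem pderiv_segment {a b : ℕ} {i : Fin K} (h : (i : ℕ) < a ∨ b < i) (γ : Bool) :
    pderiv (i, γ) (segment μ K a b) = 0 := by
  classical
  refine Finset.prod_induction _ (fun p => pderiv (i, γ) p = 0) (fun p q hp hq => ?_) (by simp)
    fun j hj => ?_
  · rw [pderiv_mul, hp, hq]; simp
  · rw [Finset.mem_Ico] at hj
    rw [rowBond]
    split_ifs with hK
    · have h1 : (⟨j, by omega⟩ : Fin K) ≠ i := fun h => by
        have := congrArg Fin.val h; simp at this; omega
      have h2 : (⟨j + 1, hK⟩ : Fin K) ≠ i := fun h => by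
        have := congrArg Fin.val h; simp at this; omega
      simp [bond, pderiv_X, h1, h2]
    · simp

end Segment

/-! ### The reduced density matrix -/

section Reduced

variable {μ : ℕ → ℕ} {K k L : ℕ}

/-- The embedding of the block into the row. -/
abbrev blockEmbed (hK : k + L < K) : Fin L → Fin K := fun i => ⟨k + i, by omega⟩

/-- The site to the left of the block. -/
abbrev leftSite (hk : 1 ≤ k) (hK : k + L < K) : Fin K := ⟨k - 1, by omega⟩

/-- The site to the right of the block. -/
abbrev rightSite (hK : k + L < K) : Fin K := ⟨k + L, hK⟩

/-- The states of the sites outside the block. -/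
def outerState (μ : ℕ → ℕ) (hk : 1 ≤ k) (hK : k + L < K) (p q : ℕ) : Fock K :=
  ((spinor (leftSite hk hK) ^ μ k).coeff p * segment μ K 0 (k - 1)) *
    ((spinor (rightSite hK) ^ μ (k + L)).coeff q * segment μ K (k + L) (K - 1))

variable (hk : 1 ≤ k) (hL : 2 ≤ L) (hK : k + L < K)


theorem blockEmbed_injective : Function.Injective (blockEmbed hK) := fun i j h => by
  simpa [Fin.ext_iff] using h

theorem mem_range_blockEmbed {j : Fin K} :
    j ∈ Set.range (blockEmbed hK) ↔ k ≤ (j : ℕ) ∧ (j : ℕ) < k + L := by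
  constructor
  · rintro ⟨i, rfl⟩; simp
  · rintro ⟨h1, h2⟩
    exact ⟨⟨j - k, by omega⟩, Fin.ext (by simp; omega)⟩

theorem rename_bond {ι κ : Type*} (f : ι → κ) (i j : ι) :
    rename (Prod.map f id) (bond i j) = bond (f i) (f j) := by
  simp [bond]

theorem rename_vbsFock : rename (Prod.map (blockEmbed hK) id) (vbsFock (fun j => μ (k + j)) L) =
    segment μ K k (k + L - 1) := by
  rw [segment, Finset.prod_Ico_eq_prod_range, show k + L - 1 - k = L - 1 by omega,
    Finset.prod_range, vbsFock_eq, map_prod]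
  refine Finset.prod_congr rfl fun j _ => ?_
  rw [rowBond, dif_pos (by omega), map_pow, rename_bond]
  rfl

include hk hL in
theorem vbsFock_split : vbsFock μ K = segment μ K 0 (k - 1) *
    bond (leftSite hk hK) (blockEmbed hK (firstSite hL)) ^ μ k *
    rename (Prod.map (blockEmbed hK) id) (vbsFock (fun j => μ (k + j)) L) *
    bond (blockEmbed hK (lastSite hL)) (rightSite hK) ^ μ (k + L) *
    segment μ K (k + L) (K - 1) := by
  have h1 : bond (leftSite hk hK) (blockEmbed hK (firstSite hL)) ^ μ k = rowBond μ K (k - 1) :=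
    (rowBond_eq μ (i := leftSite hk hK) (j := blockEmbed hK (firstSite hL))
      (by simp; omega)).symm
  have h2 : bond (blockEmbed hK (lastSite hL)) (rightSite hK) ^ μ (k + L) =
      rowBond μ K (k + L - 1) := by
    have := rowBond_eq μ (i := blockEmbed hK (lastSite hL)) (j := rightSite hK) (by simp; omega)
    rw [← this]
    congr 1
    change k + (L - 1) = k + L - 1
    omega
  rw [h1, h2, rename_vbsFock, ← segment_succ μ (Nat.zero_le _), Nat.sub_add_cancel hk,
    vbsFock_eq_segment]
  simp only [segment]
  rw [Finset.prod_Ico_consecutive _ (Nat.zero_le _) (by omega),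
    ← Finset.prod_Ico_succ_top (by omega), show k + L - 1 + 1 = k + L by omega,
    Finset.prod_Ico_consecutive _ (Nat.zero_le _) (by omega)]

theorem isWeightedHomogeneous_spinor_pow_coeff (i : Fin K) {n r : ℕ} (hr : r ≤ n) :
    IsWeightedHomogeneous siteDegree ((spinor i ^ n).coeff r) (n • Pi.single i 1) := by
  rw [spinor_pow_coeff, smul_eq_C_mul]
  have h := ((isWeightedHomogeneous_X ℂ siteDegree (i, true)).pow (n - r)).mul
    ((isWeightedHomogeneous_X ℂ siteDegree (i, false)).pow r)
  simp only [siteDegree, ← add_smul, Nat.sub_add_cancel hr] at h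
  exact h.C_mul _

theorem hasSpins_outerState (h0 : μ 0 = 0) (hμ : μ K = 0) {p q : ℕ} (hp : p ≤ μ k)
    (hq : q ≤ μ (k + L)) :
    HasSpins (outerSpins (twiceSpin μ K) (blockEmbed hK)) (outerState μ hk hK p q) := by
  rw [hasSpins_iff, outerState]
  convert ((isWeightedHomogeneous_spinor_pow_coeff (leftSite hk hK) hp).mul
    (isWeightedHomogeneous_segment μ (a := 0) (show k - 1 < K by omega))).mul
    ((isWeightedHomogeneous_spinor_pow_coeff (rightSite hK) hq).mul
    (isWeightedHomogeneous_segment μ (a := k + L) (show K - 1 < K by omega))) using 1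
  funext i
  have hi := i.2
  rw [outerSpins]
  simp only [Pi.add_apply, Pi.smul_apply, Pi.single_apply, Fin.ext_iff, smul_eq_mul, mul_ite,
    mul_one, mul_zero]
  by_cases h : i ∈ Set.range (blockEmbed hK)
  · rw [if_pos h]
    rw [mem_range_blockEmbed] at h
    rw [if_neg (by omega), if_neg (by omega), if_neg (by omega), if_neg (by omega),
      if_neg (by omega), if_neg (by omega)]
    rfl
  · rw [if_neg h]
    rw [mem_range_blockEmbed] at h
    rw [twiceSpin]
    rcases lt_or_ge (i : ℕ) k with h1 | h1
    · rw [if_neg (show ¬ (i : ℕ) = k + L by omega), if_neg (show ¬ (k + L < (i : ℕ) ∧ _) by omega),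
        if_neg (show ¬ (k + L ≤ (i : ℕ) ∧ _) by omega)]
      have h2 : (if 0 < (i : ℕ) ∧ (i : ℕ) ≤ k - 1 then μ i else 0) = μ i := by
        split_ifs with h3
        · rfl
        · rw [show (i : ℕ) = 0 by omega, h0]
      rw [h2]
      by_cases h3 : (i : ℕ) = k - 1
      · rw [if_pos h3, if_neg (by omega), show (i : ℕ) + 1 = k by omega]; ring
      · rw [if_neg h3, if_pos (by omega)]; ring
    · rw [if_neg (show ¬ (i : ℕ) = k - 1 by omega), if_neg (show ¬ (0 < (i : ℕ) ∧ _) by omega),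
        if_neg (show ¬ (0 ≤ (i : ℕ) ∧ _) by omega)]
      have h2 : (if k + L ≤ (i : ℕ) ∧ (i : ℕ) < K - 1 then μ (i + 1) else 0) = μ (i + 1) := by
        split_ifs with h3
        · rfl
        · rw [show (i : ℕ) + 1 = K by omega, hμ]
      rw [h2]
      by_cases h3 : (i : ℕ) = k + L
      · rw [if_pos h3, if_neg (by omega), h3]; ring
      · rw [if_neg h3, if_pos (by omega)]; ring

theorem isSinglet_spinor_pow_coeff {T : Finset (Fin K)} {i : Fin K} (hi : i ∉ T) (n r : ℕ) :
    IsSinglet T ((spinor i ^ n).coeff r) := by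
  rw [spinor_pow_coeff, smul_eq_C_mul]
  exact (IsSinglet.C _).mul (((IsSinglet.X hi _).pow _).mul ((IsSinglet.X hi _).pow _))

theorem isLadder_spinor_pow_mul {ι : Type*} {T : Finset ι} {i : ι} (hi : i ∈ T)
    {W : MvPolynomial (ι × Bool) ℂ} (hW : IsSinglet T W) (n : ℕ) :
    IsLadder T n (spinor i ^ n * Polynomial.C W) := by
  have h := ((isLadder_spinor hi).pow n).mul (IsLadder.C hW)
  rwa [mul_one, add_zero] at h

/-- In `p` the outer states form a ladder of the total spin of all sites left of the block, in `q`
one of all sites to the right; the outer bonds are singlets of both. The norms of the outer segments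
are therefore not needed. `outerState` keeps the binomials of `spinor ^ n` so as to be a ladder
coefficient. -/
theorem fockInner_outerState (p q p' q' : ℕ) :
    fockInner (outerState μ hk hK p q) (outerState μ hk hK p' q') = if p = p' ∧ q = q' then
      ((μ k).choose p * (μ (k + L)).choose q * fockInner (outerState μ hk hK 0 0)
        (outerState μ hk hK 0 0) : ℂ) else 0 := by
  classical
  have hl : ∀ q, IsLadder (Finset.univ.filter fun i : Fin K => (i : ℕ) < k) (μ k)
      (spinor (leftSite hk hK) ^ μ k * Polynomial.C (segment μ K 0 (k - 1) *
        ((spinor (rightSite hK) ^ μ (k + L)).coeff q * segment μ K (k + L) (K - 1)))) := fun q =>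
    isLadder_spinor_pow_mul (by simp; omega) ((isSinglet_segment μ fun i j _ _ _ => by
      simp only [Finset.mem_filter, Finset.mem_univ, true_and]; omega).mul
      ((isSinglet_spinor_pow_coeff (by simp) _ _).mul (isSinglet_segment μ fun i j _ _ _ => by
        simp only [Finset.mem_filter, Finset.mem_univ, true_and]; omega))) _
  have hr : IsLadder (Finset.univ.filter fun i : Fin K => k + L ≤ (i : ℕ)) (μ (k + L))
      (spinor (rightSite hK) ^ μ (k + L) * Polynomial.C ((spinor (leftSite hk hK) ^ μ k).coeff 0 *
        segment μ K 0 (k - 1) * segment μ K (k + L) (K - 1))) :=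
    isLadder_spinor_pow_mul (by simp) (((isSinglet_spinor_pow_coeff (by simp; omega) _ _).mul
      (isSinglet_segment μ fun i j _ _ _ => by
        simp only [Finset.mem_filter, Finset.mem_univ, true_and]; omega)).mul
      (isSinglet_segment μ fun i j _ _ _ => by
        simp only [Finset.mem_filter, Finset.mem_univ, true_and]; omega)) _
  have e1 : ∀ p q, outerState μ hk hK p q = (spinor (leftSite hk hK) ^ μ k * Polynomial.C
      (segment μ K 0 (k - 1) * ((spinor (rightSite hK) ^ μ (k + L)).coeff q *
        segment μ K (k + L) (K - 1)))).coeff p := fun p q => by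
    rw [Polynomial.coeff_mul_C, outerState]; ring
  have e2 : ∀ q, outerState μ hk hK 0 q = (spinor (rightSite hK) ^ μ (k + L) * Polynomial.C
      ((spinor (leftSite hk hK) ^ μ k).coeff 0 * segment μ K 0 (k - 1) *
        segment μ K (k + L) (K - 1))).coeff q := fun q => by
    rw [Polynomial.coeff_mul_C, outerState]; ring
  by_cases hp : p = p'
  · subst hp
    rw [e1, e1, (hl q).fockInner_same (hl q'), ← e1, ← e1, e2, e2]
    by_cases hq : q = q'
    · subst hq
      rw [if_pos ⟨rfl, rfl⟩, hr.fockInner_same hr, ← e2]; ring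
    · rw [if_neg (fun h => hq h.2), hr.fockInner_eq_zero_of_ne hr hq, mul_zero]
  · rw [if_neg (fun h => hp h.1), e1, e1, (hl q).fockInner_eq_zero_of_ne (hl q') hp]

-- Both cut bonds are expanded. A term with `x.1` `b`-bosons at the left neighbour has `μ k - x.1`
-- at the first site, and one with `x.2` at the last site has `μ (k + L) - x.2` at the right
-- neighbour.
include hL in
theorem vbsFock_eq_sum_outerState : vbsFock μ K =
    ∑ x ∈ Finset.range (μ k + 1) ×ˢ Finset.range (μ (k + L) + 1),
      ((-1) ^ x.1 * (-1) ^ x.2 : ℂ) • outerState μ hk hK x.1 (μ (k + L) - x.2) *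
        rename (Prod.map (blockEmbed hK) id)
          (twoSite (firstSite hL) (lastSite hL) (μ k) (μ (k + L)) (μ k - x.1) x.2 *
            vbsFock (fun j => μ (k + j)) L) := by
  rw [vbsFock_split hk hL hK, bond_pow, bond_pow, Finset.sum_product]
  simp only [Finset.mul_sum, Finset.sum_mul]
  rw [Finset.sum_comm]
  refine Finset.sum_congr rfl fun p hp => Finset.sum_congr rfl fun q hq => ?_
  simp only [Finset.mem_range] at hp hq
  rw [outerState, spinor_pow_coeff, spinor_pow_coeff, Nat.choose_symm (by omega), twoSite, twoSite,
    twoSite]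
  simp only [map_mul, map_pow, rename_X, Prod.map, id, smul_eq_C_mul]
  rw [show μ (k + L) - (μ (k + L) - q) = q by omega]
  ring

/-- Cross terms vanish by orthogonality of the outer states. The binomial `(μ k choose p)` times the
squared norm `p! (μ k - p)!` of the number state is `(μ k)!`, and likewise on the right, so all
normalized number states have the same weight. -/
theorem partialTrace_vbsFock (h0 : μ 0 = 0) (hμ : μ K = 0)
    (x x' : Config (twiceSpin (fun j => μ (k + j)) L)) :
    partialTrace (twiceSpin μ K) (blockEmbed hK) (fun z z' => toSpin (twiceSpin μ K) (vbsFock μ K) z *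
      star (toSpin (twiceSpin μ K) (vbsFock μ K) z')) x x' =
    fockInner (outerState μ hk hK 0 0) (outerState μ hk hK 0 0) * ((μ k)! * (μ (k + L))!) *
      ∑ p ∈ Finset.range (μ k + 1), ∑ q ∈ Finset.range (μ (k + L) + 1),
        toSpin (twiceSpin (fun j => μ (k + j)) L) (unitTwoSite (firstSite hL) (lastSite hL) (μ k)
          (μ (k + L)) p q * vbsFock (fun j => μ (k + j)) L) x *
        conj (toSpin (twiceSpin (fun j => μ (k + j)) L) (unitTwoSite (firstSite hL) (lastSite hL)
          (μ k) (μ (k + L)) p q * vbsFock (fun j => μ (k + j)) L) x') := by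
  have h := partialTrace_sum (twiceSpin μ K) (blockEmbed_injective hK)
    (Finset.range (μ k + 1) ×ˢ Finset.range (μ (k + L) + 1))
    (fun x => ((-1) ^ x.1 * (-1) ^ x.2 : ℂ) • outerState μ hk hK x.1 (μ (k + L) - x.2))
    (fun x => twoSite (firstSite hL) (lastSite hL) (μ k) (μ (k + L)) (μ k - x.1) x.2 *
            vbsFock (fun j => μ (k + j)) L) (fun y hy => by
      simp only [Finset.mem_product, Finset.mem_range] at hy
      rw [smul_eq_C_mul]
      exact hasSpins_iff.2 ((hasSpins_iff.1 (hasSpins_outerState hk hK h0 hμ (by omega)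
        (by omega))).C_mul _)) x x'
  rw [← vbsFock_eq_sum_outerState hk hL hK] at h
  rw [h, Finset.mul_sum, ← Finset.sum_range_reflect, Finset.sum_product]
  refine Finset.sum_congr rfl fun p hp => ?_
  rw [Finset.mul_sum]
  refine Finset.sum_congr rfl fun q hq => ?_
  rw [Finset.sum_eq_single_of_mem (p, q) (by simp_all)]
  · simp only [Finset.mem_range] at hp hq
    rw [fockInner_smul_smul, fockInner_outerState, if_pos ⟨rfl, rfl⟩, Nat.choose_symm (by omega),
      Nat.add_sub_cancel]
    have hsgn : conj ((-1) ^ p * (-1) ^ q : ℂ) * ((-1) ^ p * (-1) ^ q) = 1 := by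
      simp only [map_mul, map_pow, map_neg, map_one]
      rw [mul_mul_mul_comm, ← mul_pow, ← mul_pow]; simp
    rw [hsgn, twoSite_eq_smul, smul_mul_assoc, toSpin_smul, PiLp.smul_apply, PiLp.smul_apply,
      smul_eq_mul, smul_eq_mul, map_mul, Complex.conj_ofReal, Nat.cast_choose ℂ (by omega : p ≤ μ k),
      Nat.cast_choose ℂ (by omega : q ≤ μ (k + L)), show μ k - (μ k - p) = p by omega]
    have h1 : ((√((p)! * (μ k - p)! * ((μ (k + L) - q)! * q !)) : ℝ) : ℂ) *
        ((√((p)! * (μ k - p)! * ((μ (k + L) - q)! * q !)) : ℝ) : ℂ) =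
        (p)! * (μ k - p)! * ((μ (k + L) - q)! * q !) := by
      rw [← Complex.ofReal_mul, Real.mul_self_sqrt (by positivity)]; push_cast; rfl
    have e1 : ((p)! : ℂ) ≠ 0 := by exact_mod_cast Nat.factorial_ne_zero _
    have e2 : ((q)! : ℂ) ≠ 0 := by exact_mod_cast Nat.factorial_ne_zero _
    have e3 : ((μ k - p)! : ℂ) ≠ 0 := by exact_mod_cast Nat.factorial_ne_zero _
    have e4 : ((μ (k + L) - q)! : ℂ) ≠ 0 := by exact_mod_cast Nat.factorial_ne_zero _
    rw [mul_mul_mul_comm _ _ ((√((p)! * (μ k - p)! * ((μ (k + L) - q)! * q !)) : ℝ) : ℂ), h1]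
    field_simp
    rfl
  · rintro ⟨p', q'⟩ hy hne
    simp only [Finset.mem_product, Finset.mem_range] at hp hq hy
    rw [fockInner_smul_smul, fockInner_outerState, if_neg, mul_zero, zero_mul]
    rintro ⟨h1, h2⟩
    exact hne (Prod.ext h1 (by simp only at h2 ⊢; omega))

end Reduced

/-! ### Norms of valence bond solid states -/

/-- Each term is `m! n! (p+n choose n)`, and the hockey-stick identity sums them. -/
theorem sum_choose_mul_factorial (m n : ℕ) :
    (∑ p ∈ Finset.range (m + 1), m.choose p * ((n + p)! * (m - p)!)) * (n + 1) = (m + n + 1)! := by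
  have h : ∀ p ∈ Finset.range (m + 1), m.choose p * ((n + p)! * (m - p)!) =
      m ! * n ! * (p + n).choose n := fun p hp => by
    rw [Finset.mem_range] at hp
    have h1 := Nat.choose_mul_factorial_mul_factorial (show p ≤ m by omega)
    have h2 := Nat.choose_mul_factorial_mul_factorial (show n ≤ p + n by omega)
    rw [Nat.add_sub_cancel] at h2
    rw [add_comm n p, ← h1, ← h2]; ring
  rw [Finset.sum_congr rfl h, ← Finset.mul_sum, Nat.sum_range_add_choose]
  have h3 := Nat.choose_mul_factorial_mul_factorial (show n + 1 ≤ m + n + 1 by omega)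
  rw [show m + n + 1 - (n + 1) = m by omega, Nat.factorial_succ n] at h3
  rw [← h3]; ring

theorem fockInner_sum_of_orthogonal {σ κ : Type*} (S : Finset κ) (f : κ → MvPolynomial σ ℂ)
    (h : ∀ a ∈ S, ∀ b ∈ S, a ≠ b → fockInner (f a) (f b) = 0) :
    fockInner (∑ a ∈ S, f a) (∑ a ∈ S, f a) = ∑ a ∈ S, fockInner (f a) (f a) := by
  rw [map_sum]
  refine Finset.sum_congr rfl fun a ha => ?_
  rw [LinearMap.map_sum₂, Finset.sum_eq_single_of_mem a ha fun b hb hba => h b hb a ha hba]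

theorem fockInner_one {σ : Type*} : fockInner (1 : MvPolynomial σ ℂ) 1 = 1 := by
  rw [← C_1, C_apply, fockInner_monomial_right]
  simp [factorialWeight]

section ChainNorm

variable (μ : ℕ → ℕ) {K : ℕ}

/-- Expanding the last bond gives coefficients of ladders of the total spin of the sites up to `c`,
at distinct positions `p`, hence orthogonal. Each norm reduces to the position `0`, where the bond
leaves only `a`-bosons at `c`. The modes at `d` supply `(n + p)! (μ d - p)!`. -/
theorem fockInner_pow_mul_segment_succ {c d : Fin K} (hcd : (d : ℕ) = c + 1) (n : ℕ) :
    fockInner (X (d, true) ^ n * segment μ K 0 d) (X (d, true) ^ n * segment μ K 0 d) * (n + 1) =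
      (μ d + n + 1)! * fockInner (X (c, true) ^ μ d * segment μ K 0 c)
        (X (c, true) ^ μ d * segment μ K 0 c) := by
  have hne : d ≠ c := fun h => by rw [h] at hcd; omega
  let W : ℕ → Fock K := fun p =>
    segment μ K 0 c * (X (d, true) ^ (n + p) * X (d, false) ^ (μ d - p))
  have hW : ∀ p, IsLadder (Finset.univ.filter fun i : Fin K => i ≤ c) (μ d)
      (spinor c ^ μ d * Polynomial.C (W p)) := fun p => by
    have hd : d ∉ Finset.univ.filter fun i : Fin K => i ≤ c := by
      simp only [Finset.mem_filter, Finset.mem_univ, true_and, Fin.le_def]; omega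
    exact isLadder_spinor_pow_mul (by simp) ((isSinglet_segment μ fun i j _ _ _ => by
      simp only [Finset.mem_filter, Finset.mem_univ, true_and, Fin.le_def]; omega).mul
      (((IsSinglet.X hd _).pow _).mul ((IsSinglet.X hd _).pow _))) _
  have h1 : X (d, true) ^ n * segment μ K 0 d = ∑ p ∈ Finset.range (μ d + 1),
      ((-1) ^ p : ℂ) • (spinor c ^ μ d * Polynomial.C (W p)).coeff p := by
    rw [show segment μ K 0 d = segment μ K 0 c * bond c d ^ μ d by
      rw [hcd, segment_succ μ (Nat.zero_le _), rowBond_eq μ hcd, hcd], bond_pow, Finset.mul_sum,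
      Finset.mul_sum]
    refine Finset.sum_congr rfl fun p hp => ?_
    rw [Finset.mem_range] at hp
    rw [Polynomial.coeff_mul_C, spinor_pow_coeff, twoSite, show μ d - (μ d - p) = p by omega]
    simp only [smul_eq_C_mul, C_mul, W]
    ring
  have h2 : ∀ p, fockInner ((spinor c ^ μ d * Polynomial.C (W p)).coeff p)
      ((spinor c ^ μ d * Polynomial.C (W p)).coeff p) = (μ d).choose p * ((n + p)! * (μ d - p)!) *
        fockInner (X (c, true) ^ μ d * segment μ K 0 c) (X (c, true) ^ μ d * segment μ K 0 c) := by
    intro p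
    have e : (spinor c ^ μ d * Polynomial.C (W p)).coeff 0 = X (d, true) ^ (n + p) *
        (X (d, false) ^ (μ d - p) * (X (c, true) ^ μ d * segment μ K 0 c)) := by
      rw [Polynomial.coeff_mul_C, spinor_pow_coeff]
      simp only [W, Nat.choose_zero_right, Nat.cast_one, one_smul, pow_zero, Nat.sub_zero]
      ring
    have hS : ∀ γ, pderiv (d, γ) (X (c, true) ^ μ d * segment μ K 0 c) = 0 := fun γ => by
      rw [pderiv_mul, pderiv_segment μ (Or.inr (by omega)), pderiv_pow,
        pderiv_X_of_ne (by simp [hne.symm])]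
      simp
    rw [(hW p).fockInner_same (hW p), e, fockInner_self_pow_mul, fockInner_self_pow_mul (hS _)]
    · ring
    · rw [pderiv_mul, hS, pderiv_pow, pderiv_X_of_ne (by simp)]
      simp
  rw [h1, fockInner_sum_of_orthogonal]
  · have h3 : ∀ p : ℕ, conj ((-1) ^ p : ℂ) * (-1) ^ p = 1 := fun p => by
      rw [map_pow, map_neg, map_one, ← mul_pow]; simp
    simp only [fockInner_smul_smul, h3, one_mul, h2]
    rw [← Finset.sum_mul, ← sum_choose_mul_factorial]
    push_cast; ring
  · intro p _ p' _ hpp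
    rw [fockInner_smul_smul, (hW p).fockInner_eq_zero_of_ne (hW p') hpp, mul_zero]

/-- The extra factor `X (c, true) ^ n` makes the induction close: removing the bond at the last site
leaves such a factor, with exponent the bond number, at the preceding site. -/
theorem fockInner_pow_mul_segment (h0 : μ 0 = 0) (c : Fin K) (n : ℕ) :
    fockInner (X (c, true) ^ n * segment μ K 0 c) (X (c, true) ^ n * segment μ K 0 c) *
      ((n + 1) * ∏ i ∈ Finset.range c, (μ (i + 1) + 1 : ℂ)) =
      (μ c + n + 1)! * ∏ i ∈ Finset.range c, ((μ i + μ (i + 1) + 1)! : ℂ) := by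
  obtain ⟨j, hj⟩ := c
  induction j generalizing n with
  | zero =>
    have := fockInner_self_pow_mul (c := ((⟨0, hj⟩ : Fin K), true)) (Y := 1) (by simp) n
    simp only [segment, Finset.Ico_self, Finset.prod_empty, this, Finset.range_zero, fockInner_one, h0,
      zero_add, Nat.factorial_succ]
    push_cast; ring
  | succ j ih =>
    have h1 := fockInner_pow_mul_segment_succ μ (c := ⟨j, by omega⟩) (d := ⟨j + 1, hj⟩) rfl n
    have h2 := ih (μ (j + 1)) (by omega)
    simp only at h1 h2 ⊢
    rw [Finset.prod_range_succ, Finset.prod_range_succ]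
    linear_combination ((μ (j + 1) + 1) * ∏ i ∈ Finset.range j, (μ (i + 1) + 1 : ℂ)) * h1 +
      (μ (j + 1) + n + 1)! * h2

theorem fockInner_vbsFock (hK : 1 ≤ K) (h0 : μ 0 = 0) (hμ : μ K = 0) :
    fockInner (vbsFock μ K) (vbsFock μ K) * ∏ i ∈ Finset.range (K - 1), (μ (i + 1) + 1 : ℂ) =
      ∏ i ∈ Finset.range K, ((μ i + μ (i + 1) + 1)! : ℂ) := by
  have h := fockInner_pow_mul_segment μ h0 (⟨K - 1, by omega⟩ : Fin K) 0
  obtain ⟨K, rfl⟩ : ∃ k, K = k + 1 := ⟨K - 1, by omega⟩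
  simp only [pow_zero, one_mul, Nat.cast_zero, zero_add, Nat.add_sub_cancel] at h ⊢
  rw [vbsFock_eq_segment, Nat.add_sub_cancel, h, Finset.prod_range_succ, hμ]
  ring

end ChainNorm

/-! ### The trace of the reduced density matrix -/

section Trace

/-- The sum of the squared norms of the states of a block with given spins of its dangling bonds. -/
def blockTrace (m : ℕ → ℕ) (L : ℕ) (hL : 2 ≤ L) : ℂ :=
  ∑ p ∈ Finset.range (m 0 + 1), ∑ q ∈ Finset.range (m L + 1),
    fockInner (unitTwoSite (firstSite hL) (lastSite hL) (m 0) (m L) p q * vbsFock m L)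
      (unitTwoSite (firstSite hL) (lastSite hL) (m 0) (m L) p q * vbsFock m L)

theorem vbsFock_congr {m m' : ℕ → ℕ} {L : ℕ} (h : ∀ j ≤ L, m j = m' j) :
    vbsFock m L = vbsFock m' L := by
  rw [vbsFock_eq, vbsFock_eq]
  refine Finset.prod_congr rfl fun j _ => ?_
  rw [h _ (by omega)]

theorem blockTrace_congr {m m' : ℕ → ℕ} {L : ℕ} (hL : 2 ≤ L) (h : ∀ j ≤ L, m j = m' j) :
    blockTrace m L hL = blockTrace m' L hL := by
  rw [blockTrace, blockTrace, vbsFock_congr h, h 0 (Nat.zero_le _), h L le_rfl]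

variable {μ : ℕ → ℕ} {K k L : ℕ}

theorem hasSpins_vbsFock (hK : 2 ≤ K) (h0 : μ 0 = 0) (hμ : μ K = 0) :
    HasSpins (twiceSpin μ K) (vbsFock μ K) := by
  rw [hasSpins_iff, twiceSpin_eq μ hK, danglingDegree, h0, hμ, zero_smul, zero_smul, add_zero,
    add_zero]
  exact isWeightedHomogeneous_vbsFock μ K

theorem hasSpins_unitTwoSite_mul_vbsFock {m : ℕ → ℕ} (hL : 2 ≤ L) {p q : ℕ} (hp : p ≤ m 0)
    (hq : q ≤ m L) : HasSpins (twiceSpin m L)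
      (unitTwoSite (firstSite hL) (lastSite hL) (m 0) (m L) p q * vbsFock m L) := by
  refine hasSpins_mul_vbsFock hL ?_
  rw [unitTwoSite, smul_eq_C_mul]
  exact hasSpins_iff.2 ((hasSpins_iff.1 (hasSpins_twoSite hL hp hq)).C_mul _)

theorem sum_mul_conj_toSpin {s : Fin L → ℕ} {f : Fock L} (hf : HasSpins s f) :
    ∑ x, toSpin s f x * conj (toSpin s f x) = fockInner f f := by
  rw [← inner_toSpin hf, PiLp.inner_apply]
  rfl

/-- The trace of `partialTrace_vbsFock`, since a partial trace preserves traces. -/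
theorem fockInner_vbsFock_eq_mul_blockTrace (hk : 1 ≤ k) (hL : 2 ≤ L) (hK : k + L < K)
    (h0 : μ 0 = 0) (hμ : μ K = 0) : fockInner (vbsFock μ K) (vbsFock μ K) =
      fockInner (outerState μ hk hK 0 0) (outerState μ hk hK 0 0) * ((μ k)! * (μ (k + L))!) *
        blockTrace (fun j => μ (k + j)) L hL := by
  have h := trace_partialTrace (e := blockEmbed hK) (twiceSpin μ K) (fun z z' =>
    toSpin (twiceSpin μ K) (vbsFock μ K) z * star (toSpin (twiceSpin μ K) (vbsFock μ K) z'))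
  have h2 : ∑ z, toSpin (twiceSpin μ K) (vbsFock μ K) z *
      star (toSpin (twiceSpin μ K) (vbsFock μ K) z) = fockInner (vbsFock μ K) (vbsFock μ K) :=
    sum_mul_conj_toSpin (hasSpins_vbsFock (by omega) h0 hμ)
  rw [← h2, ← h]
  refine (Finset.sum_congr rfl fun x _ => partialTrace_vbsFock hk hL hK h0 hμ x x).trans ?_
  rw [← Finset.mul_sum, blockTrace, Finset.sum_comm]
  refine congrArg _ (Finset.sum_congr rfl fun p hp => ?_)
  rw [Finset.sum_comm]
  refine Finset.sum_congr rfl fun q hq => ?_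
  rw [Finset.mem_range] at hp hq
  exact sum_mul_conj_toSpin (hasSpins_unitTwoSite_mul_vbsFock (m := fun j => μ (k + j)) hL
    (Nat.le_of_lt_succ hp) (Nat.le_of_lt_succ hq))

theorem densityConst_pos (m : ℕ → ℕ) (L : ℕ) : 0 < densityConst m L := by
  unfold densityConst; positivity

/-- `blockTrace` refers to the block alone, so it may be computed in the chain of `L + 2` sites with
the block at `1, …, L`. There the outer state is `a^{m 0} a^{m L}` with squared norm `(m 0)! (m
L)!`, and `fockInner_vbsFock` gives the norm of the chain. -/
theorem blockTrace_mul_densityConst (m : ℕ → ℕ) (hL : 2 ≤ L) :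
    blockTrace m L hL * densityConst m L = 1 := by
  have hc : ∀ j ≤ L, chainBond L m (1 + j) = m j := fun j hj => by
    rw [add_comm, chainBond, if_pos hj]
  have h0 : chainBond L m 0 = 0 := rfl
  have hμ : chainBond L m (L + 2) = 0 := by rw [chainBond, if_neg (by omega)]
  have h1 := fockInner_vbsFock_eq_mul_blockTrace (μ := chainBond L m) (K := L + 2) le_rfl hL
    (by omega) h0 hμ
  have h2 := fockInner_vbsFock (chainBond L m) (K := L + 2) (by omega) h0 hμ
  have h3 : fockInner (outerState (chainBond L m) (k := 1) (L := L) (K := L + 2) le_rfl (by omega)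
      0 0) (outerState (chainBond L m) (k := 1) (L := L) (K := L + 2) le_rfl (by omega) 0 0) =
      (m 0)! * (m L)! := by
    rw [outerState, spinor_pow_coeff, spinor_pow_coeff, hc L le_rfl,
      show chainBond L m 1 = m 0 from hc 0 (Nat.zero_le _)]
    have e1 : segment (chainBond L m) (L + 2) 0 (1 - 1) = 1 := by simp [segment]
    have e2 : segment (chainBond L m) (L + 2) (1 + L) (L + 2 - 1) = 1 := by
      rw [segment, Finset.Ico_eq_empty_of_le (by omega), Finset.prod_empty]
    simp only [e1, e2, Nat.choose_zero_right, Nat.cast_one, one_smul, pow_zero, mul_one,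
      Nat.sub_zero]
    have e3 : (rightSite (show 1 + L < L + 2 by omega)) ≠ leftSite le_rfl
      (show 1 + L < L + 2 by omega) := by simp [Fin.ext_iff]
    have e5 := fockInner_self_pow_mul
      (c := ((rightSite (show 1 + L < L + 2 by omega)), true)) (Y := 1) (by simp) (m L)
    have e6 := fockInner_self_pow_mul
      (c := ((leftSite le_rfl (show 1 + L < L + 2 by omega)), true))
      (Y := X ((rightSite (show 1 + L < L + 2 by omega)), true) ^ m L * 1) (by
        rw [mul_one, pderiv_pow, pderiv_X_of_ne (by simp [e3])]; simp) (m 0)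
    rw [e5, fockInner_one, mul_one, mul_one] at e6
    rw [e6]
  rw [blockTrace_congr hL hc, h3, hc L le_rfl, show chainBond L m 1 = m 0 from hc 0 (Nat.zero_le _)]
    at h1
  have h4 : ∏ i ∈ Finset.range (L + 2 - 1), (chainBond L m (i + 1) + 1 : ℂ) =
      (m 0 + 1) * (m L + 1) * ∏ j ∈ Finset.Icc 1 (L - 1), (m j + 1 : ℂ) := by
    have e : Finset.Icc 1 (L - 1) = Finset.Ico 1 L := by
      ext; simp only [Finset.mem_Icc, Finset.mem_Ico]; omega
    obtain ⟨l, rfl⟩ : ∃ l, L = l + 1 := ⟨L - 1, by omega⟩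
    rw [e, Finset.prod_Ico_eq_prod_range, Nat.add_sub_cancel,
      Finset.prod_congr rfl fun i hi => by
        rw [add_comm i 1, hc i (by rw [Finset.mem_range] at hi; omega)],
      show l + 1 + 2 - 1 = l + 1 + 1 by omega, Finset.prod_range_succ, Finset.prod_range_succ']
    simp only [add_comm 1]
    ring
  have h5 : ∏ i ∈ Finset.range (L + 2), ((chainBond L m i + chainBond L m (i + 1) + 1)! : ℂ) =
      (m 0 + 1)! * (m L + 1)! * ∏ i : Fin L, ((twiceSpin m L i + 1)! : ℂ) := by
    rw [Finset.prod_range_succ, Finset.prod_range_succ', h0, hμ, add_comm L 1, hc L le_rfl,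
      show chainBond L m (0 + 1) = m 0 from hc 0 (Nat.zero_le _), Finset.prod_range]
    have e : ∀ i : Fin L, (chainBond L m (i + 1) + chainBond L m (i + 1 + 1) + 1)! =
        (twiceSpin m L i + 1)! := fun i => by
      rw [add_comm (i : ℕ) 1, hc _ (by omega), add_assoc 1, hc _ (by omega)]
    simp only [e, zero_add, add_zero]
    ring
  rw [h4, h1, h5, Nat.factorial_succ, Nat.factorial_succ] at h2
  have e1 : ((m 0)! : ℂ) ≠ 0 := by exact_mod_cast Nat.factorial_ne_zero _
  have e2 : ((m L)! : ℂ) ≠ 0 := by exact_mod_cast Nat.factorial_ne_zero _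
  have e3 : (m 0 + 1 : ℂ) ≠ 0 := Nat.cast_add_one_ne_zero _
  have e4 : (m L + 1 : ℂ) ≠ 0 := Nat.cast_add_one_ne_zero _
  have e5 : ∏ i : Fin L, ((twiceSpin m L i + 1)! : ℂ) ≠ 0 :=
    Finset.prod_ne_zero_iff.2 fun i _ => by exact_mod_cast Nat.factorial_ne_zero _
  rw [densityConst]
  push_cast at h2 ⊢
  rw [mul_div_assoc', div_eq_one_iff_eq e5]
  refine mul_left_cancel₀ (mul_ne_zero (mul_ne_zero e3 e4) (mul_ne_zero e1 e2)) ?_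
  linear_combination h2

/-- A sum of rank-one operators `|w⟩⟨w|` is unchanged when the family `w` is transformed by a real
orthogonal matrix, here that of the Clebsch–Gordan coefficients. -/
theorem sum_unitTwoSite_eq_sum_degVBS (m : ℕ → ℕ) (hL : 2 ≤ L) (x x' : Config (twiceSpin m L)) :
    ∑ p ∈ Finset.range (m 0 + 1), ∑ q ∈ Finset.range (m L + 1),
      toSpin (twiceSpin m L) (unitTwoSite (firstSite hL) (lastSite hL) (m 0) (m L) p q *
        vbsFock m L) x * conj (toSpin (twiceSpin m L) (unitTwoSite (firstSite hL) (lastSite hL)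
          (m 0) (m L) p q * vbsFock m L) x') =
      ∑ a ∈ labels m L, degVBS m L hL a.1 a.2 x * conj (degVBS m L hL a.1 a.2 x') := by
  have h : ∀ p ∈ Finset.range (m 0 + 1), ∀ q ∈ Finset.range (m L + 1), ∀ y,
      toSpin (twiceSpin m L) (unitTwoSite (firstSite hL) (lastSite hL) (m 0) (m L) p q *
        vbsFock m L) y = ∑ a ∈ labels m L,
          (clebschGordan (m 0) p (m L) q a.1 a.2 : ℂ) * degVBS m L hL a.1 a.2 y := by
    intro p hp q hq y
    rw [Finset.mem_range] at hp hq
    rw [toSpin_unitTwoSite_mul_vbsFock hL (by omega) (by omega), WithLp.ofLp_sum,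
      Finset.sum_apply]
    rfl
  calc _ = ∑ p ∈ Finset.range (m 0 + 1), ∑ q ∈ Finset.range (m L + 1), ∑ a ∈ labels m L,
        ∑ b ∈ labels m L, ((clebschGordan (m 0) p (m L) q a.1 a.2 *
          clebschGordan (m 0) p (m L) q b.1 b.2 : ℝ) : ℂ) *
            (degVBS m L hL a.1 a.2 x * conj (degVBS m L hL b.1 b.2 x')) := by
        refine Finset.sum_congr rfl fun p hp => Finset.sum_congr rfl fun q hq => ?_
        rw [h p hp q hq, h p hp q hq, map_sum, Finset.sum_mul_sum]
        refine Finset.sum_congr rfl fun a _ => Finset.sum_congr rfl fun b _ => ?_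
        rw [map_mul, Complex.conj_ofReal]; push_cast; ring
    _ = ∑ a ∈ labels m L, ∑ b ∈ labels m L, ((∑ p ∈ Finset.range (m 0 + 1),
        ∑ q ∈ Finset.range (m L + 1), clebschGordan (m 0) p (m L) q a.1 a.2 *
          clebschGordan (m 0) p (m L) q b.1 b.2 : ℝ) : ℂ) *
            (degVBS m L hL a.1 a.2 x * conj (degVBS m L hL b.1 b.2 x')) := by
        push_cast
        simp only [Finset.sum_mul]
        rw [← Finset.sum_product', Finset.sum_comm]
        refine Finset.sum_congr rfl fun a _ => ?_
        rw [Finset.sum_comm]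
        refine Finset.sum_congr rfl fun b _ => ?_
        rw [Finset.sum_product]
    _ = _ := by
        refine Finset.sum_congr rfl fun a ha => ?_
        rw [Finset.sum_eq_single_of_mem a ha fun b hb hba => ?_]
        · rw [sum_clebschGordan_mul ha ha, if_pos rfl, Complex.ofReal_one, one_mul]
        · rw [sum_clebschGordan_mul ha hb, if_neg hba.symm, Complex.ofReal_zero, zero_mul]

theorem partialTrace_div (s : Fin K → ℕ) (e : Fin L → Fin K) (A : Matrix (Config s) (Config s) ℂ)
    (c : ℂ) (x x' : Config fun i => s (e i)) :
    partialTrace s e (fun z z' => A z z' / c) x x' = partialTrace s e A x x' / c := by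
  change Finset.sum _ _ = (Finset.sum _ _) / c
  rw [Finset.sum_div]
  refine Finset.sum_congr rfl fun z _ => ?_
  rw [Finset.sum_div]
  refine Finset.sum_congr rfl fun z' _ => ?_
  split_ifs <;> simp

theorem norm_toSpin_sq {s : Fin L → ℕ} {f : Fock L} (hf : HasSpins s f) :
    ((‖toSpin s f‖ ^ 2 : ℝ) : ℂ) = fockInner f f := by
  rw [← inner_toSpin hf, inner_self_eq_norm_sq_to_K, Complex.ofReal_pow]
  rfl

/-- The norm of the outer state and the factorials of the cut bonds occur both in the partial trace
and in `⟨VBS|VBS⟩`. They cancel and leave `1 / blockTrace`, so no trace of the environment remains.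
-/
theorem blockDensity_apply {N : ℕ} {M : ℕ → ℕ} (hk : 1 ≤ k) (hL : 2 ≤ L) (hkL : k + L ≤ N + 1)
    (x x' : Config (twiceSpin (blockBond N M k) L)) : blockDensity N M k L hkL x x' =
      densityConst (blockBond N M k) L * ∑ a ∈ labels (blockBond N M k) L,
        degVBS (blockBond N M k) L hL a.1 a.2 x *
          conj (degVBS (blockBond N M k) L hL a.1 a.2 x') := by
  have hK : k + L < N + 2 := by omega
  have h0 : chainBond N M 0 = 0 := rfl
  have hμ : chainBond N M (N + 2) = 0 := by rw [chainBond, if_neg (by omega)]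
  have h1 := partialTrace_vbsFock hk hL hK h0 hμ x x'
  have h2 := fockInner_vbsFock_eq_mul_blockTrace hk hL hK h0 hμ
  have h3 := blockTrace_mul_densityConst (blockBond N M k) hL
  have h4 : fockInner (vbsFock (chainBond N M) (N + 2)) (vbsFock (chainBond N M) (N + 2)) ≠ 0 :=
    fun h => vbsFock_ne_zero _ _ (fockInner_self_eq_zero h)
  have h5 := sum_unitTwoSite_eq_sum_degVBS (blockBond N M k) hL x x'
  have h6 : blockDensity N M k L hkL x x' = partialTrace (twiceSpin (chainBond N M) (N + 2))
      (blockEmbed hK) (fun z z' => toSpin _ (vbsFock (chainBond N M) (N + 2)) z *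
        star (toSpin _ (vbsFock (chainBond N M) (N + 2)) z')) x x' /
      fockInner (vbsFock (chainBond N M) (N + 2)) (vbsFock (chainBond N M) (N + 2)) := by
    rw [← norm_toSpin_sq (hasSpins_vbsFock (by omega) h0 hμ)]
    exact partialTrace_div (twiceSpin (chainBond N M) (N + 2)) (blockEmbed hK) (fun z z' =>
      toSpin _ (vbsFock (chainBond N M) (N + 2)) z *
        star (toSpin _ (vbsFock (chainBond N M) (N + 2)) z')) _ x x'
  rw [h6, div_eq_iff h4]
  refine h1.trans ?_
  rw [h2]
  refine (congrArg _ h5).trans ?_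
  change _ = _ * _ * (_ * blockTrace (blockBond N M k) L hL)
  linear_combination (-(fockInner (outerState (chainBond N M) hk hK 0 0)
    (outerState (chainBond N M) hk hK 0 0) * ((chainBond N M k)! * (chainBond N M (k + L))!) *
      ∑ a ∈ labels (blockBond N M k) L, degVBS (blockBond N M k) L hL a.1 a.2 x *
          conj (degVBS (blockBond N M k) L hL a.1 a.2 x'))) * h3

theorem blockDensity_eq {N : ℕ} {M : ℕ → ℕ} (hk : 1 ≤ k) (hL : 2 ≤ L) (hkL : k + L ≤ N + 1) :
    blockDensity N M k L hkL = (densityConst (blockBond N M k) L : ℂ) •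
      ∑ a ∈ labels (blockBond N M k) L, Matrix.vecMulVec (⇑(degVBS (blockBond N M k) L hL a.1 a.2))
        (star ⇑(degVBS (blockBond N M k) L hL a.1 a.2)) := by
  ext x x'
  rw [blockDensity_apply hk hL hkL, Matrix.smul_apply, Matrix.sum_apply]
  rfl

end Trace

/-! ### Sums of multiples of orthogonal projections -/

section Orthogonal

variable {E ι : Type*} [NormedAddCommGroup E] [InnerProductSpace ℂ E] {S : Finset ι} {w : ι → E}
  {T : E →ₗ[ℂ] E} {c : ℝ}

theorem apply_eq_smul_of_orthogonal (hT : ∀ v, T v = (c : ℂ) • ∑ a ∈ S, inner ℂ (w a) v • w a)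
    (ho : ∀ a ∈ S, ∀ b ∈ S, a ≠ b → inner ℂ (w a) (w b) = 0) {a : ι} (ha : a ∈ S) :
    T (w a) = ((c * ‖w a‖ ^ 2 : ℝ) : ℂ) • w a := by
  rw [hT, Finset.sum_eq_single_of_mem a ha fun b hb hba => by rw [ho b hb a ha hba, zero_smul],
    inner_self_eq_norm_sq_to_K, smul_smul]
  push_cast; rfl

/-- Pairing `T v = μ v` with `w a` forces `⟨w a, v⟩ = 0` unless the eigenvalue of `w a` is `μ`. As
`μ ≠ 0`, `v = μ⁻¹ T v` lies in the span of the others. -/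
theorem eigenspace_of_orthogonal (hT : ∀ v, T v = (c : ℂ) • ∑ a ∈ S, inner ℂ (w a) v • w a)
    (ho : ∀ a ∈ S, ∀ b ∈ S, a ≠ b → inner ℂ (w a) (w b) = 0) {μ : ℂ} (hμ : μ ≠ 0) :
    Module.End.eigenspace T μ = Submodule.span ℂ
      {ψ | ∃ a ∈ S, ((c * ‖w a‖ ^ 2 : ℝ) : ℂ) = μ ∧ ψ = w a} := by
  refine le_antisymm (fun v hv => ?_) (Submodule.span_le.2 ?_)
  · rw [Module.End.mem_eigenspace_iff] at hv
    have h1 : ∀ a ∈ S, ((c * ‖w a‖ ^ 2 : ℝ) : ℂ) ≠ μ → inner ℂ (w a) v = 0 := fun a ha hne => by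
      have h2 := congrArg (inner ℂ (w a)) hv
      rw [hT, inner_smul_right, inner_smul_right, inner_sum,
        Finset.sum_eq_single_of_mem a ha fun b hb hba => by
          rw [inner_smul_right, ho a ha b hb hba.symm, mul_zero], inner_smul_right,
        inner_self_eq_norm_sq_to_K] at h2
      have h3 : (((c * ‖w a‖ ^ 2 : ℝ) : ℂ) - μ) * inner ℂ (w a) v = 0 := by
        push_cast
        linear_combination h2
      exact (mul_eq_zero.1 h3).resolve_left (sub_ne_zero.2 hne)
    have h2 : v = μ⁻¹ • T v := by rw [hv, smul_smul, inv_mul_cancel₀ hμ, one_smul]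
    rw [h2, hT]
    refine Submodule.smul_mem _ _ (Submodule.smul_mem _ _ (Submodule.sum_mem _ fun a ha => ?_))
    by_cases h : ((c * ‖w a‖ ^ 2 : ℝ) : ℂ) = μ
    · exact Submodule.smul_mem _ _ (Submodule.subset_span ⟨a, ha, h, rfl⟩)
    · rw [h1 a ha h, zero_smul]; exact Submodule.zero_mem _
  · rintro _ ⟨a, ha, h, rfl⟩
    rw [SetLike.mem_coe, Module.End.mem_eigenspace_iff, apply_eq_smul_of_orthogonal hT ho ha, h]

theorem range_of_orthogonal (hT : ∀ v, T v = (c : ℂ) • ∑ a ∈ S, inner ℂ (w a) v • w a)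
    (ho : ∀ a ∈ S, ∀ b ∈ S, a ≠ b → inner ℂ (w a) (w b) = 0) (hc : 0 < c)
    (hw : ∀ a ∈ S, w a ≠ 0) :
    LinearMap.range T = Submodule.span ℂ {ψ | ∃ a ∈ S, ψ = w a} := by
  refine le_antisymm ?_ (Submodule.span_le.2 ?_)
  · rintro _ ⟨v, rfl⟩
    rw [hT]
    exact Submodule.smul_mem _ _ (Submodule.sum_mem _ fun a ha =>
      Submodule.smul_mem _ _ (Submodule.subset_span ⟨a, ha, rfl⟩))
  · rintro _ ⟨a, ha, rfl⟩
    have h : ((c * ‖w a‖ ^ 2 : ℝ) : ℂ) ≠ 0 := by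
      have := norm_pos_iff.2 (hw a ha)
      exact_mod_cast (by positivity : 0 < c * ‖w a‖ ^ 2).ne'
    refine ⟨((c * ‖w a‖ ^ 2 : ℝ) : ℂ)⁻¹ • w a, ?_⟩
    rw [map_smul, apply_eq_smul_of_orthogonal hT ho ha, smul_smul, inv_mul_cancel₀ h, one_smul]

theorem iSup_eigenspace_of_orthogonal
    (hT : ∀ v, T v = (c : ℂ) • ∑ a ∈ S, inner ℂ (w a) v • w a)
    (ho : ∀ a ∈ S, ∀ b ∈ S, a ≠ b → inner ℂ (w a) (w b) = 0) (hc : 0 < c)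
    (hw : ∀ a ∈ S, w a ≠ 0) :
    ⨆ μ : ℂ, ⨆ _ : μ ≠ 0, Module.End.eigenspace T μ =
      Submodule.span ℂ {ψ | ∃ a ∈ S, ψ = w a} := by
  refine le_antisymm (iSup₂_le fun μ hμ => ?_) (Submodule.span_le.2 ?_)
  · rw [eigenspace_of_orthogonal hT ho hμ]
    exact Submodule.span_mono fun ψ ⟨a, ha, _, h⟩ => ⟨a, ha, h⟩
  · rintro _ ⟨a, ha, rfl⟩
    have h : ((c * ‖w a‖ ^ 2 : ℝ) : ℂ) ≠ 0 := by
      have := norm_pos_iff.2 (hw a ha)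
      exact_mod_cast (by positivity : 0 < c * ‖w a‖ ^ 2).ne'
    exact (le_iSup₂_of_le (f := fun (μ : ℂ) (_ : μ ≠ 0) => Module.End.eigenspace T μ) _ h le_rfl)
      (Module.End.mem_eigenspace_iff.2 (apply_eq_smul_of_orthogonal hT ho ha))

theorem finrank_span_of_orthogonal (ho : ∀ a ∈ S, ∀ b ∈ S, a ≠ b → inner ℂ (w a) (w b) = 0)
    (hw : ∀ a ∈ S, w a ≠ 0) :
    Module.finrank ℂ (Submodule.span ℂ {ψ | ∃ a ∈ S, ψ = w a}) = S.card := by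
  have hli : LinearIndependent ℂ fun a : S => w a :=
    linearIndependent_of_ne_zero_of_inner_eq_zero (fun a => hw a a.2)
      fun a b hab => ho a a.2 b b.2 fun h => hab (Subtype.ext h)
  have h := finrank_span_eq_card hli
  rw [Fintype.card_coe] at h
  rw [← h, show Set.range (fun a : S => w a) = {ψ | ∃ a ∈ S, ψ = w a} by ext ψ; simp [eq_comm]]

end Orthogonal

/-! ### The spectrum of the reduced density matrix -/

section Spectrum

variable {m : ℕ → ℕ} {L : ℕ} (hL : 2 ≤ L)

theorem toEuclideanLin_sum_vecMulVec {n ι : Type*} [Fintype n] [DecidableEq n] (S : Finset ι)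
    (w : ι → EuclideanSpace ℂ n) (c : ℂ) (v : EuclideanSpace ℂ n) :
    Matrix.toEuclideanLin (c • ∑ a ∈ S, Matrix.vecMulVec (⇑(w a)) (star ⇑(w a))) v =
      c • ∑ a ∈ S, inner ℂ (w a) v • w a := by
  rw [map_smul, map_sum, LinearMap.smul_apply, LinearMap.sum_apply]
  congr 1
  refine Finset.sum_congr rfl fun a _ => ?_
  ext i
  rw [Matrix.toLpLin_apply, Matrix.vecMulVec_mulVec, EuclideanSpace.inner_eq_star_dotProduct,
    dotProduct_comm]
  simp [mul_comm]

/-- The generating polynomial of the degenerate VBS states. -/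
def degLadder (m : ℕ → ℕ) (hL : 2 ≤ L) (t : ℕ) : Polynomial (Fock L) :=
  coupling (firstSite hL) (lastSite hL) (m 0) (m L) t * Polynomial.C (vbsFock m L)

/-- `vbsFock` is a singlet of the total spin of the block, so the spin `J` of the dangling bonds
becomes the spin of the whole block. -/
theorem isLadder_degLadder {t : ℕ} (h₁ : t ≤ m 0) (h₂ : t ≤ m L) :
    IsLadder Finset.univ (m 0 + m L - 2 * t) (degLadder m hL t) := by
  have h := (isLadder_coupling (Finset.mem_univ (firstSite hL)) (Finset.mem_univ (lastSite hL))
    h₁ h₂).mul (IsLadder.C (isSinglet_vbsFock m L))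
  rwa [add_zero] at h

theorem degFock_eq_smul {t : ℕ} (h₁ : t ≤ m 0) (h₂ : t ≤ m L) (r : ℕ) : degFock m L hL t r =
    (couplingNorm (m 0) (m L) t r : ℂ) • (degLadder m hL t).coeff r := by
  rw [degFock_eq hL h₁ h₂, coupledState, smul_mul_assoc, degLadder, Polynomial.coeff_mul_C]

theorem degVBS_ne_zero {t r : ℕ} (h₁ : t ≤ m 0) (h₂ : t ≤ m L) (hr : r ≤ m 0 + m L - 2 * t) :
    degVBS m L hL t r ≠ 0 := by
  intro h
  have h1 := toSpin_eq_zero (hasSpins_degFock hL h₁ h₂ r) h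
  rw [degFock_eq hL h₁ h₂, mul_eq_zero] at h1
  have h2 := h1.resolve_right (vbsFock_ne_zero m L)
  have h3 := fockInner_coupledState (firstSite_ne_lastSite hL) h₁ h₂ h₁ h₂ hr (r' := r)
  rw [h2] at h3
  simp at h3

theorem inner_degVBS_eq_zero {a b : (_ : ℕ) × ℕ} (ha : a ∈ labels m L) (hb : b ∈ labels m L)
    (hab : a ≠ b) : inner ℂ (degVBS m L hL a.1 a.2) (degVBS m L hL b.1 b.2) = 0 := by
  obtain ⟨⟨h1, h2⟩, h3⟩ := mem_couplingLabels.1 ha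
  obtain ⟨⟨h1', h2'⟩, h3'⟩ := mem_couplingLabels.1 hb
  rw [degVBS, degVBS, inner_toSpin (hasSpins_degFock hL h1' h2' _), degFock_eq_smul hL h1 h2,
    degFock_eq_smul hL h1' h2', fockInner_smul_smul]
  by_cases h : a.1 = b.1
  · rw [(isLadder_degLadder hL h1 h2).fockInner_eq_zero_of_ne (isLadder_degLadder hL h1' h2'),
      mul_zero]
    intro h'
    exact hab (Sigma.ext h (heq_of_eq h'))
  · rw [(isLadder_degLadder hL h1 h2).fockInner_eq_zero_of_dim_ne (isLadder_degLadder hL h1' h2'),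
      mul_zero]
    omega

/-- The ladder binomial is the same with or without the factor `vbsFock`, and `couplingNorm` already
compensates it. This is why the eigenvalue depends on `J` alone. -/
theorem norm_degVBS_sq {t r : ℕ} (h₁ : t ≤ m 0) (h₂ : t ≤ m L) (hr : r ≤ m 0 + m L - 2 * t) :
    ‖degVBS m L hL t r‖ ^ 2 = ‖degVBS m L hL t 0‖ ^ 2 := by
  have h : ((‖degVBS m L hL t r‖ ^ 2 : ℝ) : ℂ) = ((‖degVBS m L hL t 0‖ ^ 2 : ℝ) : ℂ) := by
    rw [degVBS, degVBS, norm_toSpin_sq (hasSpins_degFock hL h₁ h₂ _),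
      norm_toSpin_sq (hasSpins_degFock hL h₁ h₂ _), degFock_eq_smul hL h₁ h₂,
      degFock_eq_smul hL h₁ h₂, fockInner_smul_smul, fockInner_smul_smul,
      (isLadder_degLadder hL h₁ h₂).fockInner_same (isLadder_degLadder hL h₁ h₂),
      Complex.conj_ofReal, Complex.conj_ofReal]
    have e1 := couplingNorm_sq_mul h₁ h₂ hr
    have e2 := couplingNorm_sq_mul h₁ h₂ (Nat.zero_le (m 0 + m L - 2 * t))
    have e3 : couplingNorm (m 0) (m L) t r ^ 2 * (m 0 + m L - 2 * t).choose r =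
        couplingNorm (m 0) (m L) t 0 ^ 2 := by
      rw [Nat.choose_zero_right, Nat.cast_one, one_mul] at e2
      rw [← mul_assoc] at e1
      exact mul_right_cancel₀ (right_ne_zero_of_mul_eq_one e1) (e1.trans e2.symm)
    have e4 : (couplingNorm (m 0) (m L) t r : ℂ) ^ 2 * (m 0 + m L - 2 * t).choose r =
        (couplingNorm (m 0) (m L) t 0 : ℂ) ^ 2 := by exact_mod_cast e3
    linear_combination fockInner ((degLadder m hL t).coeff 0) ((degLadder m hL t).coeff 0) * e4
  exact_mod_cast h

theorem finrank_degSpan : Module.finrank ℂ (degSpan m L hL) = (m 0 + 1) * (m L + 1) := by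
  rw [degSpan, finrank_span_of_orthogonal (w := fun a : (_ : ℕ) × ℕ => degVBS m L hL a.1 a.2)
    (fun a ha b hb hab => inner_degVBS_eq_zero hL ha hb hab) (fun a ha => ?_), labels_eq,
    card_couplingLabels]
  obtain ⟨⟨h1, h2⟩, h3⟩ := mem_couplingLabels.1 ha
  exact degVBS_ne_zero hL h1 h2 h3

end Spectrum

/-! ### The states `|G; J, Ω⟩` -/

section Homogenize

variable {R : Type*} [CommRing R]

/-- Homogenization turns a generating polynomial in one variable into the form in `u` and `v` that
occurs in `A†_J`. -/
theorem eval_homogenize_eq_sum (f : Polynomial R) (d : ℕ) (u v : R) :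
    MvPolynomial.eval ![v, u] (f.homogenize d) =
      ∑ r ∈ Finset.range (d + 1), u ^ (d - r) * v ^ r * f.coeff r := by
  rw [Polynomial.homogenize, map_sum, Finset.Nat.sum_antidiagonal_eq_sum_range_succ_mk]
  refine Finset.sum_congr rfl fun r _ => ?_
  rw [eval_monomial, Finsupp.prod_fintype _ _ (by simp), Fin.prod_univ_two]
  simp
  ring

end Homogenize

section GState

variable {m : ℕ → ℕ} {L : ℕ} (hL : 2 ≤ L)

theorem natDegree_spinor_pow_le {ι : Type*} (i : ι) (n : ℕ) : (spinor i ^ n).natDegree ≤ n := by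
  have h : (spinor i).natDegree ≤ 1 := by
    rw [spinor]
    compute_degree
  simpa using Polynomial.natDegree_pow_le_of_le n h

theorem eval_homogenize_spinor_pow {ι : Type*} (i : ι) (n : ℕ)
    (u v : MvPolynomial (ι × Bool) ℂ) : MvPolynomial.eval ![v, u] ((spinor i ^ n).homogenize n) =
      (u * X (i, true) + v * X (i, false)) ^ n := by
  rw [eval_homogenize_eq_sum, add_comm (u * _), add_pow]
  refine Finset.sum_congr rfl fun r _ => ?_
  rw [spinor_pow_coeff, smul_eq_C_mul, mul_pow, mul_pow, map_natCast]
  ring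

theorem eval_homogenize_coupling {ι : Type*} (i j : ι) {n₁ n₂ t : ℕ} (h₁ : t ≤ n₁) (h₂ : t ≤ n₂)
    (u v : MvPolynomial (ι × Bool) ℂ) :
    MvPolynomial.eval ![v, u] ((coupling i j n₁ n₂ t).homogenize (n₁ + n₂ - 2 * t)) =
      (u * X (i, true) + v * X (i, false)) ^ (n₁ - t) * bond i j ^ t *
        (u * X (j, true) + v * X (j, false)) ^ (n₂ - t) := by
  rw [coupling, show n₁ + n₂ - 2 * t = n₁ - t + 0 + (n₂ - t) by omega, Polynomial.homogenize_mul,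
    Polynomial.homogenize_mul, map_mul, map_mul, eval_homogenize_spinor_pow,
    eval_homogenize_spinor_pow, Polynomial.homogenize_C]
  · simp
  · exact natDegree_spinor_pow_le _ _
  · simp
  · exact (Polynomial.natDegree_mul_le_of_le (natDegree_spinor_pow_le _ _) (by simp)).trans le_rfl
  · exact natDegree_spinor_pow_le _ _

theorem gFock_eq_sum {t : ℕ} (h₁ : t ≤ m 0) (h₂ : t ≤ m L) (θ ϕ : ℝ) : gFock m L hL t θ ϕ =
    ∑ r ∈ Finset.range (m 0 + m L - 2 * t + 1), (spinorU θ ϕ ^ (m 0 + m L - 2 * t - r) *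
      spinorV θ ϕ ^ r * (couplingNorm (m 0) (m L) t r : ℂ)⁻¹) • degFock m L hL t r := by
  have h := eval_homogenize_coupling (firstSite hL) (lastSite hL) h₁ h₂ (C (spinorU θ ϕ))
    (C (spinorV θ ϕ))
  rw [eval_homogenize_eq_sum] at h
  have h' : aJDag m L hL t θ ϕ = _ := h.symm
  rw [gFock, h', Finset.sum_mul]
  refine Finset.sum_congr rfl fun r _ => ?_
  have hc : (couplingNorm (m 0) (m L) t r : ℂ) ≠ 0 := by
    exact_mod_cast (couplingNorm_pos h₁ h₂ r).ne'
  rw [degFock_eq hL h₁ h₂, coupledState, smul_mul_assoc, smul_smul, mul_assoc _ _⁻¹,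
    inv_mul_cancel₀ hc, mul_one, smul_eq_C_mul, C_mul, C_pow, C_pow]
  ring

theorem hasSpins_gFock {t : ℕ} (h₁ : t ≤ m 0) (h₂ : t ≤ m L) (θ ϕ : ℝ) :
    HasSpins (twiceSpin m L) (gFock m L hL t θ ϕ) := by
  rw [gFock_eq_sum hL h₁ h₂]
  exact HasSpins.sum_smul (fun r _ => hasSpins_degFock hL h₁ h₂ r) _

theorem gState_eq_sum {t : ℕ} (h₁ : t ≤ m 0) (h₂ : t ≤ m L) (θ ϕ : ℝ) : gState m L hL t θ ϕ =
    ∑ r ∈ Finset.range (m 0 + m L - 2 * t + 1), (spinorU θ ϕ ^ (m 0 + m L - 2 * t - r) *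
      spinorV θ ϕ ^ r * (couplingNorm (m 0) (m L) t r : ℂ)⁻¹) • degVBS m L hL t r := by
  rw [gState, gFock_eq_sum hL h₁ h₂, toSpin_sum]
  simp only [toSpin_smul, degVBS]

theorem spinorU_ne_zero_or_spinorV_ne_zero (θ ϕ : ℝ) : spinorU θ ϕ ≠ 0 ∨ spinorV θ ϕ ≠ 0 := by
  by_contra! h
  obtain ⟨h1, h2⟩ := h
  rw [spinorU, mul_eq_zero, or_iff_left (Complex.exp_ne_zero _), Complex.ofReal_eq_zero] at h1
  rw [spinorV, mul_eq_zero, or_iff_left (Complex.exp_ne_zero _), Complex.ofReal_eq_zero] at h2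
  have := Real.cos_sq_add_sin_sq (θ / 2)
  rw [h1, h2] at this
  norm_num at this

theorem C_mul_X_add_C_mul_X_ne_zero {ι : Type*} (i : ι) {u v : ℂ} (h : u ≠ 0 ∨ v ≠ 0) :
    (C u * X (i, true) + C v * X (i, false) : MvPolynomial (ι × Bool) ℂ) ≠ 0 := by
  classical
  intro h0
  have h1 := congrArg (coeff (Finsupp.single (i, true) 1)) h0
  have h2 := congrArg (coeff (Finsupp.single (i, false) 1)) h0
  simp [coeff_X, Finsupp.single_left_inj] at h1 h2
  exact h.elim (fun h => h h1) fun h => h h2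

/-- A product of nonzero polynomials over a field is nonzero. -/
theorem gState_ne_zero {t : ℕ} (h₁ : t ≤ m 0) (h₂ : t ≤ m L) (θ ϕ : ℝ) :
    gState m L hL t θ ϕ ≠ 0 := by
  intro h
  have h1 := toSpin_eq_zero (hasSpins_gFock hL h₁ h₂ θ ϕ) h
  have h2 := fun i : Fin L => C_mul_X_add_C_mul_X_ne_zero i (spinorU_ne_zero_or_spinorV_ne_zero θ ϕ)
  refine mul_ne_zero (mul_ne_zero (mul_ne_zero (pow_ne_zero (m 0 - t) (h2 (firstSite hL)))
    (pow_ne_zero t (irreducible_bond (firstSite_ne_lastSite hL)).ne_zero))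
    (pow_ne_zero (m L - t) (h2 (lastSite hL)))) (vbsFock_ne_zero m L) h1

theorem span_gState {t : ℕ} (h₁ : t ≤ m 0) (h₂ : t ≤ m L) :
    Submodule.span ℂ {ψ | ∃ θ ∈ Set.Icc 0 Real.pi, ∃ ϕ ∈ Set.Icc 0 (2 * Real.pi),
        ψ = gState m L hL t θ ϕ} =
      Submodule.span ℂ {ψ | ∃ r ≤ m 0 + m L - 2 * t, ψ = degVBS m L hL t r} := by
  refine le_antisymm (Submodule.span_le.2 ?_) (Submodule.span_le.2 ?_)
  · rintro _ ⟨θ, _, ϕ, _, rfl⟩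
    rw [gState_eq_sum hL h₁ h₂]
    exact Submodule.sum_mem _ fun r hr => Submodule.smul_mem _ _
      (Submodule.subset_span ⟨r, Nat.le_of_lt_succ (Finset.mem_range.1 hr), rfl⟩)
  · rintro _ ⟨r, hr, rfl⟩
    by_contra hmem
    -- A functional that kills every `|G; J, Ω⟩` gives a polynomial in `v / u` whose coefficients
    -- are nonzero multiples of its values on the multiplet.
    obtain ⟨ℓ, h1, h2⟩ := Submodule.exists_le_ker_of_notMem hmem
    let P : Polynomial ℂ := ∑ s ∈ Finset.range (m 0 + m L - 2 * t + 1),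
      Polynomial.C ((couplingNorm (m 0) (m L) t s : ℂ)⁻¹ * ℓ (degVBS m L hL t s)) *
        Polynomial.X ^ s
    have hP : ∀ x : ℝ, 0 ≤ x → P.IsRoot x := fun x hx => by
      -- For `θ = 2 arctan x`, `ϕ = 0` the ratio `v / u` is `x`, so every nonnegative real is a
      -- root.
      have h3 : ℓ (gState m L hL t (2 * Real.arctan x) 0) = 0 := h2 (Submodule.subset_span
        ⟨_, ⟨by have := Real.arctan_nonneg.2 hx; linarith,
          by have := Real.arctan_lt_pi_div_two x; linarith⟩, 0,
          ⟨le_rfl, by positivity⟩, rfl⟩)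
      have hc : Real.cos (Real.arctan x) ≠ 0 := (Real.cos_arctan_pos x).ne'
      have h4 : (Real.sin (Real.arctan x) : ℂ) = Real.cos (Real.arctan x) * x := by
        rw [← Complex.ofReal_mul]
        congr 1
        rw [← Real.tan_mul_cos hc, Real.tan_arctan, mul_comm]
      have h5 : (Real.cos (Real.arctan x) : ℂ) ^ (m 0 + m L - 2 * t) * P.eval (x : ℂ) = 0 := by
        rw [← h3, gState_eq_sum hL h₁ h₂, map_sum, Polynomial.eval_finsetSum, Finset.mul_sum]
        refine Finset.sum_congr rfl fun s hs => ?_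
        rw [Finset.mem_range] at hs
        rw [map_smul, spinorU, spinorV, mul_div_cancel_left₀ _ two_ne_zero, h4]
        simp only [Complex.ofReal_zero, mul_zero, zero_div, neg_zero, Complex.exp_zero, mul_one,
          Polynomial.eval_mul, Polynomial.eval_C, Polynomial.eval_pow, Polynomial.eval_X,
          smul_eq_mul]
        rw [← Nat.sub_add_cancel (Nat.le_of_lt_succ hs), pow_add, Nat.add_sub_cancel]
        ring
      exact (mul_eq_zero.1 h5).resolve_left (pow_ne_zero _ (by exact_mod_cast hc))
    have hP0 : P = 0 := Polynomial.eq_zero_of_infinite_isRoot P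
      (((Set.Ici_infinite (0 : ℝ)).image Complex.ofReal_injective.injOn).mono (by
        rintro _ ⟨x, hx, rfl⟩; exact hP x hx))
    have h3 := congrArg (Polynomial.coeff · r) hP0
    simp only [P, Polynomial.finsetSum_coeff, Polynomial.coeff_C_mul_X_pow,
      Polynomial.coeff_zero] at h3
    rw [Finset.sum_eq_single_of_mem r (Finset.mem_range.2 (by omega)) fun s _ hs =>
      if_neg hs.symm, if_pos rfl, mul_eq_zero] at h3
    exact h1 (h3.resolve_left (inv_ne_zero (by exact_mod_cast (couplingNorm_pos h₁ h₂ r).ne')))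

theorem span_gState_all : Submodule.span ℂ {ψ | ∃ t ≤ min (m 0) (m L), ∃ θ ∈ Set.Icc 0 Real.pi,
    ∃ ϕ ∈ Set.Icc 0 (2 * Real.pi), ψ = gState m L hL t θ ϕ} = degSpan m L hL := by
  have h : ∀ t ≤ min (m 0) (m L), Submodule.span ℂ {ψ | ∃ θ ∈ Set.Icc 0 Real.pi,
      ∃ ϕ ∈ Set.Icc 0 (2 * Real.pi), ψ = gState m L hL t θ ϕ} =
      Submodule.span ℂ {ψ | ∃ r ≤ m 0 + m L - 2 * t, ψ = degVBS m L hL t r} := fun t ht =>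
    span_gState hL (ht.trans (min_le_left _ _)) (ht.trans (min_le_right _ _))
  refine le_antisymm (Submodule.span_le.2 ?_) (Submodule.span_le.2 ?_)
  · rintro _ ⟨t, ht, θ, hθ, ϕ, hϕ, rfl⟩
    have h1 : gState m L hL t θ ϕ ∈ Submodule.span ℂ {ψ | ∃ r ≤ m 0 + m L - 2 * t,
        ψ = degVBS m L hL t r} := by
      rw [← h t ht]; exact Submodule.subset_span ⟨θ, hθ, ϕ, hϕ, rfl⟩
    refine Submodule.span_mono ?_ h1
    rintro _ ⟨r, hr, rfl⟩
    exact ⟨⟨t, r⟩, mem_couplingLabels.2 ⟨⟨ht.trans (min_le_left _ _), ht.trans (min_le_right _ _)⟩,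
      hr⟩, rfl⟩
  · rintro _ ⟨a, ha, rfl⟩
    obtain ⟨⟨h1, h2⟩, h3⟩ := mem_couplingLabels.1 ha
    have h4 : degVBS m L hL a.1 a.2 ∈ Submodule.span ℂ {ψ | ∃ θ ∈ Set.Icc 0 Real.pi,
        ∃ ϕ ∈ Set.Icc 0 (2 * Real.pi), ψ = gState m L hL a.1 θ ϕ} := by
      rw [h _ (le_min h1 h2)]; exact Submodule.subset_span ⟨a.2, h3, rfl⟩
    refine Submodule.span_mono ?_ h4
    rintro _ ⟨θ, hθ, ϕ, hϕ, rfl⟩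
    exact ⟨a.1, le_min h1 h2, θ, hθ, ϕ, hϕ, rfl⟩

end GState

/-! ### Independence of the environment of the block -/

section Independence

variable {m m' : ℕ → ℕ} {L : ℕ}

/-- The two configurations have different types, as `m` and `m'` may differ beyond `L`, so they are
compared through their values. -/
theorem degVBS_congr (hL : 2 ≤ L) (h : ∀ j ≤ L, m j = m' j) (t r : ℕ)
    {x : Config (twiceSpin m L)} {x' : Config (twiceSpin m' L)} (hx : ∀ i, (x i : ℕ) = x' i) :
    degVBS m L hL t r x = degVBS m' L hL t r x' := by
  have h1 : degFock m L hL t r = degFock m' L hL t r := by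
    rw [degFock, degFock, coupledCreate, coupledCreate, vbsFock_congr h, h 0 (Nat.zero_le _),
      h L le_rfl]
  have h2 : ∀ i : Fin L, twiceSpin m L i = twiceSpin m' L i := fun i => by
    rw [twiceSpin, twiceSpin, h _ i.2.le, h _ i.2]
  have h3 : occupation (twiceSpin m L) x = occupation (twiceSpin m' L) x' := by
    ext ⟨i, γ⟩
    cases γ
    · rw [occupation_false, occupation_false, hx, h2]
    · rw [occupation_true, occupation_true, hx]
  rw [degVBS, degVBS, toSpin_apply, toSpin_apply, h1, h3, configWeight, configWeight]
  congr 4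
  funext i
  rw [hx, h2]

theorem labels_congr (h : ∀ j ≤ L, m j = m' j) : labels m L = labels m' L := by
  rw [labels, labels, h 0 (Nat.zero_le _), h L le_rfl]

theorem densityConst_congr (h : ∀ j ≤ L, m j = m' j) : densityConst m L = densityConst m' L := by
  have h2 : ∀ i : Fin L, twiceSpin m L i = twiceSpin m' L i := fun i => by
    rw [twiceSpin, twiceSpin, h _ i.2.le, h _ i.2]
  simp only [densityConst, h2]
  rw [h 0 (Nat.zero_le _), h L le_rfl, Finset.prod_congr rfl fun j hj => by
    rw [h j (by rw [Finset.mem_Icc] at hj; omega)]]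

theorem blockBond_eq {N k j : ℕ} (M : ℕ → ℕ) (hk : 1 ≤ k) (h : k + j ≤ N + 1) :
    blockBond N M k j = M (k - 1 + j) := by
  rw [blockBond, show k + j = k - 1 + j + 1 by omega, chainBond, if_pos (by omega)]

theorem blockDensity_congr {N N' k k' : ℕ} {M M' : ℕ → ℕ} (hL : 2 ≤ L) (hk : 1 ≤ k)
    (hk' : 1 ≤ k') (hkL : k + L ≤ N + 1) (hkL' : k' + L ≤ N' + 1)
    (hM : ∀ j ≤ L, M' (k' - 1 + j) = M (k - 1 + j))
    {x y : Config (twiceSpin (blockBond N M k) L)} {x' y' : Config (twiceSpin (blockBond N' M' k') L)}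
    (hx : ∀ i, (x i : ℕ) = x' i) (hy : ∀ i, (y i : ℕ) = y' i) :
    blockDensity N' M' k' L hkL' x' y' = blockDensity N M k L hkL x y := by
  have h : ∀ j ≤ L, blockBond N M k j = blockBond N' M' k' j := fun j hj => by
    rw [blockBond_eq M hk (by omega), blockBond_eq M' hk' (by omega), hM j hj]
  rw [blockDensity_apply hk' hL hkL', blockDensity_apply hk hL hkL, densityConst_congr h,
    labels_congr h]
  refine congrArg _ (Finset.sum_congr rfl fun a _ => ?_)
  have h1 := degVBS_congr hL h a.1 a.2 hx
  have h2 := degVBS_congr hL h a.1 a.2 hy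
  exact congrArg₂ (fun z w => z * conj w) h1.symm h2.symm

end Independence

end AKLT

end

/-! ### The main theorem -/

theorem theorem1 (N : ℕ) (M : ℕ → ℕ) (hM : ∀ j ≤ N, 1 ≤ M j)
    (k L : ℕ) (hk : 1 ≤ k) (hL : 2 ≤ L) (hkL : k + L ≤ N + 1)
    (C : ℕ → ℕ → ℝ) (hC : ∀ j t, 0 < C j t) :
    let m : ℕ → ℕ := blockBond N M k
    let ρ := blockDensity N M k L hkL
    let ρop := Matrix.toEuclideanLin ρ
    let H := blockHamiltonian m L C
    -- all states have the correct number of bosons at each site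
    (HasSpins (twiceSpin (chainBond N M) (N + 2)) (vbsFock (chainBond N M) (N + 2)) ∧
      (∀ a ∈ labels m L, HasSpins (twiceSpin m L) (degFock m L hL a.1 a.2)) ∧
      (∀ t ≤ min (m 0) (m L), ∀ θ ϕ : ℝ, HasSpins (twiceSpin m L) (gFock m L hL t θ ϕ))) ∧
    -- the density matrix is a constant times the sum of `|VBS_L(J,M)⟩⟨VBS_L(J,M)|`
    (ρ = (densityConst m L : ℂ) • ∑ a ∈ labels m L,
      Matrix.vecMulVec (⇑(degVBS m L hL a.1 a.2)) (star ⇑(degVBS m L hL a.1 a.2))) ∧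
    -- there are `(M_{01} + 1) (M_{L,L+1} + 1)` of these states; they are nonzero and orthogonal
    (labels m L).card = (m 0 + 1) * (m L + 1) ∧
    (∀ a ∈ labels m L, degVBS m L hL a.1 a.2 ≠ 0) ∧
    (∀ a ∈ labels m L, ∀ b ∈ labels m L, a ≠ b →
      inner ℂ (degVBS m L hL a.1 a.2) (degVBS m L hL b.1 b.2) = 0) ∧
    -- they, and the nonzero states `|G; J, Ω⟩`, are eigenvectors with nonzero eigenvalues, and they
    -- determine all eigenvectors with nonzero eigenvalues
    (∃ Λ : ℕ → ℝ, (∀ t ≤ min (m 0) (m L), 0 < Λ t) ∧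
      (∀ a ∈ labels m L,
        ρop (degVBS m L hL a.1 a.2) = (Λ a.1 : ℂ) • degVBS m L hL a.1 a.2) ∧
      (∀ t ≤ min (m 0) (m L), ∀ θ ∈ Set.Icc 0 Real.pi, ∀ ϕ ∈ Set.Icc 0 (2 * Real.pi),
        gState m L hL t θ ϕ ≠ 0 ∧
        ρop (gState m L hL t θ ϕ) = (Λ t : ℂ) • gState m L hL t θ ϕ) ∧
      (∀ μ : ℂ, μ ≠ 0 → Module.End.eigenspace ρop μ =
        Submodule.span ℂ {ψ | ∃ a ∈ labels m L, (Λ a.1 : ℂ) = μ ∧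
          ψ = degVBS m L hL a.1 a.2})) ∧
    -- for each `J` the states `|G; J, Ω⟩` and the states `|VBS_L(J,M)⟩` have the same span
    (∀ t ≤ min (m 0) (m L),
      Submodule.span ℂ {ψ | ∃ θ ∈ Set.Icc 0 Real.pi, ∃ ϕ ∈ Set.Icc 0 (2 * Real.pi),
          ψ = gState m L hL t θ ϕ} =
        Submodule.span ℂ {ψ | ∃ r ≤ m 0 + m L - 2 * t, ψ = degVBS m L hL t r}) ∧
    -- the block Hamiltonian is nonnegative, and its zero-energy ground states are the span of the
    -- `|VBS_L(J,M)⟩`, i.e. the span of the `|G; J, Ω⟩`, i.e. the span of the eigenvectors of `ρ`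
    -- with nonzero eigenvalues, i.e. the range of `ρ`
    H.IsPositive ∧
    LinearMap.ker H = Submodule.span ℂ {ψ | ∃ a ∈ labels m L, ψ = degVBS m L hL a.1 a.2} ∧
    LinearMap.ker H = Submodule.span ℂ {ψ | ∃ t ≤ min (m 0) (m L), ∃ θ ∈ Set.Icc 0 Real.pi,
      ∃ ϕ ∈ Set.Icc 0 (2 * Real.pi), ψ = gState m L hL t θ ϕ} ∧
    LinearMap.ker H = ⨆ μ : ℂ, ⨆ _ : μ ≠ 0, Module.End.eigenspace ρop μ ∧
    LinearMap.ker H = LinearMap.range ρop ∧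
    Module.finrank ℂ (LinearMap.ker H) = (m 0 + 1) * (m L + 1) ∧
    -- the density matrix does not depend on the spins outside the block: any other chain with a
    -- block with the same bond numbers gives the same matrix
    (∀ (N' : ℕ) (M' : ℕ → ℕ) (k' : ℕ) (hkL' : k' + L ≤ N' + 1),
      (∀ j ≤ N', 1 ≤ M' j) → 1 ≤ k' → (∀ j ≤ L, M' (k' - 1 + j) = M (k - 1 + j)) →
      ∀ (x y : Config (twiceSpin (blockBond N M k) L))
        (x' y' : Config (twiceSpin (blockBond N' M' k') L)),
        (∀ i, (x i : ℕ) = x' i) → (∀ i, (y i : ℕ) = y' i) →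
        blockDensity N' M' k' L hkL' x' y' = ρ x y) := by
  intro m ρ ρop H
  have hρ : ρ = (densityConst m L : ℂ) • ∑ a ∈ labels m L,
      Matrix.vecMulVec (⇑(degVBS m L hL a.1 a.2)) (star ⇑(degVBS m L hL a.1 a.2)) :=
    blockDensity_eq hk hL hkL
  have hop : ∀ v, ρop v = (densityConst m L : ℂ) • ∑ a ∈ labels m L,
      inner ℂ (degVBS m L hL a.1 a.2) v • degVBS m L hL a.1 a.2 := fun v => by
    change Matrix.toEuclideanLin ρ v = _
    rw [hρ]
    exact toEuclideanLin_sum_vecMulVec _ (fun a : (_ : ℕ) × ℕ => degVBS m L hL a.1 a.2) _ v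
  have ho : ∀ a ∈ labels m L, ∀ b ∈ labels m L, a ≠ b →
      inner ℂ (degVBS m L hL a.1 a.2) (degVBS m L hL b.1 b.2) = 0 := fun a ha b hb hab =>
    inner_degVBS_eq_zero hL ha hb hab
  have hne : ∀ a ∈ labels m L, degVBS m L hL a.1 a.2 ≠ 0 := fun a ha => by
    obtain ⟨⟨h1, h2⟩, h3⟩ := mem_couplingLabels.1 ha
    exact degVBS_ne_zero hL h1 h2 h3
  have hc := densityConst_pos m L
  have hmin : ∀ t ≤ min (m 0) (m L), t ≤ m 0 ∧ t ≤ m L := fun t ht => le_min_iff.1 ht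
  have hnorm : ∀ a ∈ labels m L,
      ‖degVBS m L hL a.1 a.2‖ ^ 2 = ‖degVBS m L hL a.1 0‖ ^ 2 := fun a ha => by
    obtain ⟨⟨h1, h2⟩, h3⟩ := mem_couplingLabels.1 ha
    exact norm_degVBS_sq hL h1 h2 h3
  have heig : ∀ a ∈ labels m L, ρop (degVBS m L hL a.1 a.2) =
      ((densityConst m L * ‖degVBS m L hL a.1 0‖ ^ 2 : ℝ) : ℂ) • degVBS m L hL a.1 a.2 :=
    fun a ha => by
      rw [← hnorm a ha]
      exact apply_eq_smul_of_orthogonal (w := fun a : (_ : ℕ) × ℕ => degVBS m L hL a.1 a.2)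
        hop ho ha
  have hker : LinearMap.ker H = degSpan m L hL := ker_blockHamiltonian hL hC
  refine ⟨⟨hasSpins_vbsFock (by omega) rfl (if_neg (by omega)), fun a ha => ?_,
    fun t ht θ ϕ => hasSpins_gFock hL (hmin t ht).1 (hmin t ht).2 θ ϕ⟩, hρ,
    card_couplingLabels _ _, hne, ho, ⟨fun t => densityConst m L * ‖degVBS m L hL t 0‖ ^ 2,
      fun t ht => ?_, heig, fun t ht θ _ ϕ _ => ⟨gState_ne_zero hL (hmin t ht).1 (hmin t ht).2 θ ϕ,
        ?_⟩, fun μ hμ => ?_⟩, fun t ht => span_gState hL (hmin t ht).1 (hmin t ht).2,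
    blockHamiltonian_isPositive hC, hker, hker.trans (span_gState_all hL).symm,
    hker.trans (iSup_eigenspace_of_orthogonal hop ho hc hne).symm,
    hker.trans (range_of_orthogonal hop ho hc hne).symm, ?_, ?_⟩
  · obtain ⟨⟨h1, h2⟩, _⟩ := mem_couplingLabels.1 ha
    exact hasSpins_degFock hL h1 h2 _
  · have := norm_pos_iff.2 (degVBS_ne_zero hL (hmin t ht).1 (hmin t ht).2 (Nat.zero_le _))
    positivity
  -- The state `|G; J, Ω⟩` is a combination of states with the same `J`, hence with one common
  -- eigenvalue.
  · rw [gState_eq_sum hL (hmin t ht).1 (hmin t ht).2, map_sum, Finset.smul_sum]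
    refine Finset.sum_congr rfl fun r hr => ?_
    have h := heig ⟨t, r⟩ (mem_couplingLabels.2 ⟨hmin t ht, by
      rw [Finset.mem_range] at hr; exact Nat.le_of_lt_succ hr⟩)
    rw [map_smul, h, smul_comm]
  · refine (eigenspace_of_orthogonal (w := fun a : (_ : ℕ) × ℕ => degVBS m L hL a.1 a.2) hop ho
      hμ).trans (congrArg (Submodule.span ℂ) (Set.ext fun ψ => exists_congr fun a =>
        and_congr_right fun ha => ?_))
    rw [hnorm a ha]
  · rw [hker, finrank_degSpan hL]
  · intro N' M' k' hkL' _ hk' hMM x y x' y' hx hy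
    exact blockDensity_congr hL hk hk' hkL hkL' hMM hx hy
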